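/- Let $\Delta=\{(x_1,x_2)\in\mathbb{R}^2 : x_1>0,\ x_2>0,\ x_1+x_2<\pi/2\}$. A point $X=(x_1,x_2)\in\Delta$ represents the obtuse triangle $T_X$ (unique up to similarity) whose small angles are $x_1$ and $x_2$; its sides are labelled $1,2,3$, where side $j$ ($j=1,2$) is opposite the angle $x_j$ and side $3$ is the longest side. For a periodic bi-infinite word $W$ in the digits $1,2,3$, the orbit tile $O(W)\subset\Delta$ is the set of all $X\in\Delta$ such that $T_X$ has a periodic billiard path which successively hits the sides of $T_X$ (in their interiors) in the order given by $W$. For an integer $n\ge 4$ let $V_n=(\pi/2n,\pi/2n)$. For $\epsilon>0$ let $N(n,\epsilon)$ be the open Euclidean $\epsilon$-ball around $V_n$, and for signs $\sigma,\tau\in\{+,-\}$ let $N_{\sigma\tau}(n,\epsilon)$ be the set of $X\in N(n,\epsilon)$ such that the first and the second coordinate of $X-V_n$ are nonzero and have sign $\sigma$ and $\tau$ respectively. Theorem. For each $n\ge 4$ there are periodic words $A_n$, $B_n$, $C_n$ and some $\epsilon_n>0$ such that $$N_{--}(n,\epsilon_n)\subset O(A_n),\qquad N_{-+}(n,\epsilon_n)\subset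 O(B_n),\qquad N_{+-}(n,\epsilon_n)\subset O(C_n),$$ and $$N(n,\epsilon_n)\setminus\overline{N_{++}(n,\epsilon_n)}\ \subset\ O(A_n)\cup O(B_n)\cup O(C_n).$$ -/

import Mathlib

/-- A periodic bi-infinite word in three digits.
The digits `1, 2, 3` are represented by `0, 1, 2 : Fin 3`. -/
structure PeriodicWord where
  digit : ℤ → Fin 3
  periodic : ∃ m : ℕ, 0 < m ∧ ∀ k : ℤ, digit (k + m) = digit k

/-- The parameter space of obtuse triangles: the point `x` stands for the obtuse triangle with
small angles `x 0` and `x 1` (in radians). -/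
def parameterSpace : Set (EuclideanSpace ℝ (Fin 2)) :=
  {x | 0 < x 0 ∧ 0 < x 1 ∧ x 0 + x 1 < Real.pi / 2}

/-- The vertices of the triangle with parameter `x`, drawn in the Euclidean plane `ℂ`.
Vertex `0` has angle `x 0`, vertex `1` has angle `x 1`, vertex `2` is the obtuse one, and the long
side, from vertex `0` to vertex `1`, has length one. The distance from vertex `0` to vertex `2` is
given by the law of sines. -/
noncomputable def triangleVertex (x : EuclideanSpace ℝ (Fin 2)) : Fin 3 → ℂ :=
  ![0, 1, ((Real.sin (x 1) / Real.sin (x 0 + x 1) : ℝ) : ℂ) * Complex.exp ((x 0 : ℂ) * Complex.I)]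

/-- The side with label `i` of the triangle with vertices `v`, without its endpoints.
It is opposite to vertex `i` (addition in `Fin 3` is modulo three). -/
def openSide (v : Fin 3 → ℂ) (i : Fin 3) : Set ℂ :=
  openSegment ℝ (v (i + 1)) (v (i + 2))

/-- The line through the origin parallel to the side with label `i`. -/
noncomputable def sideDirection (v : Fin 3 → ℂ) (i : Fin 3) : Submodule ℝ ℂ :=
  Submodule.span ℝ {v (i + 2) - v (i + 1)}

/-- `p` is the sequence of bounce points of a periodic billiard path in the triangle with vertices
`v`, and the successive sides that the path hits are given by `W`. -/
structure IsPeriodicBilliardPath (v : Fin 3 → ℂ) (W : ℤ → Fin 3) (p : ℤ → ℂ) : Prop where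
  /-- Every bounce takes place in the interior of the side prescribed by the word. -/
  mem_side : ∀ k, p k ∈ openSide v (W k)
  /-- Successive bounce points are distinct, so the path really moves. -/
  ne_succ : ∀ k, p k ≠ p (k + 1)
  /-- The angle of incidence equals the angle of reflection: the outgoing direction is the incoming
  direction reflected in the side that is hit. -/
  reflect : ∀ k, SameRay ℝ ((sideDirection v (W k)).reflection (p k - p (k - 1)))
    (p (k + 1) - p k)
  /-- The path closes up. -/
  closes : ∃ m : ℕ, 0 < m ∧ ∀ k : ℤ, p (k + m) = p k

/-- The orbit tile of a periodic word: the parameters of those obtuse triangles in which the word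
describes the combinatorics of a periodic billiard path. -/
def orbitTile (W : PeriodicWord) : Set (EuclideanSpace ℝ (Fin 2)) :=
  {x | x ∈ parameterSpace ∧ ∃ p : ℤ → ℂ, IsPeriodicBilliardPath (triangleVertex x) W.digit p}

/-- The Veech point `V_n = (π / 2n, π / 2n)`. -/
noncomputable def veechPoint (n : ℕ) : EuclideanSpace ℝ (Fin 2) :=
  !₂[Real.pi / (2 * n), Real.pi / (2 * n)]

/-- The part of the open `ε`-ball around the Veech point `V_n` that lies in the open quadrant, with
apex `V_n`, in which the two coordinates of `x - V_n` have the signs `σ` and `τ`. -/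
def quadrantNhd (σ τ : SignType) (n : ℕ) (ε : ℝ) : Set (EuclideanSpace ℝ (Fin 2)) :=
  {x | x ∈ Metric.ball (veechPoint n) ε ∧
    SignType.sign (x 0 - veechPoint n 0) = σ ∧ SignType.sign (x 1 - veechPoint n 1) = τ}

/-!
**Unfolding.** Reflecting the triangle, instead of the path, in the sides that a billiard path hits
turns the path into a straight line that crosses a chain of triangles. Conversely, a word is
realized as soon as some directed line crosses, in the given order, the interiors of the sides in
the chain, and the last triangle of the chain is the first one translated along the line
(`mem_orbitTile_of_crosses`). A line is given by its direction `τ` and an offset `c`, and the side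
on which a point lies by the sign of `height τ c`, so that the crossing conditions are strict
inequalities between heights of vertices.

**The words.** The triangle is turned about vertex `0` by `2 n α` if its two sides at this vertex
are hit `2 n` times in alternation (`fanZero`), and about vertex `1` by `2 n β` likewise (`fanOne`).
The words have the form `pretzel n K`: a core `K`, the turn about vertex `0`, the core backwards,
and the turn back. The chain then closes up with a translation for all angles, and its way back
along the core is a rotated image of the way out. So the word is realized if the line and its image
under a rotation both cross the chain of `K` (`mem_orbitTile_pretzel`).

At the Veech point `2 n α = 2 n β = π`, hence all full turns are half turns, and the chain has a
base line in the direction of the required translation, which contains the first and the last vertex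
of the core. All vertices of the chain that are off this line stay on their side of it near the
Veech point (`LinesNear`); the heights of the few vertices on the line decide where the word is
realized.

* The core `strandOne n` is itself symmetric: a word `J`, a full turn about vertex `1`, and `J`
  backwards. At the Veech point the pivot of this turn is the midpoint of the segment from the
  origin to the end of the core. The line midway between the two bounds that the ends of the core
  give leaves the pivot on its left, as it should, when `sin (2 n α)` and `sin (2 n β)` are
  positive, that is, when both angles are smaller than `π / (2 n)`
  (`eventually_mem_orbitTile_strandOne`).
* In the chain of `strandTwo n`, two obtuse vertices, `apexOne` and `apexTwo`, lie on the base line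
  at the Veech point. The line and its image under the turn both have to leave them on the right.
  The first-order expansions of these vertices and of the end of the core (`HasJet`) show that there
  is room for such a line when `α < π / (2 n) ≤ β`
  (`eventually_im_signs`, `exists_room`, `eventually_mem_orbitTile_strandTwo`). The crucial
  inequality is the one between cosines in `SmallAngle.comb_neg`.
* The third word is the mirror image of the second one (`mem_orbitTile_mirror`), and takes care of
  `β < π / (2 n) ≤ α`.

A point near the Veech point and outside the closed quadrant where both angles are at least
`π / (2 n)` is in one of these three regions (`lt_or_lt_of_notMem_closure`).
-/

open Complex ComplexConjugate Filter Topology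

/-! ### Placed triangles and lines that cross their sides -/

/-- The unit complex number with argument `θ`. -/
noncomputable def cis (θ : ℝ) : ℂ := Complex.exp (θ * I)

lemma cis_re (θ : ℝ) : (cis θ).re = Real.cos θ := Complex.exp_ofReal_mul_I_re θ

lemma cis_im (θ : ℝ) : (cis θ).im = Real.sin θ := Complex.exp_ofReal_mul_I_im θ

lemma cis_zero : cis 0 = 1 := by simp [cis]

lemma cis_add (θ φ : ℝ) : cis (θ + φ) = cis θ * cis φ := by
  simp [cis, add_mul, Complex.exp_add]

lemma conj_cis (θ : ℝ) : conj (cis θ) = cis (-θ) := by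
  apply Complex.ext <;> simp [cis_re, cis_im]

lemma cis_mul_cis_neg (θ : ℝ) : cis θ * cis (-θ) = 1 := by
  rw [← cis_add, add_neg_cancel, cis_zero]

@[fun_prop]
lemma continuous_cis : Continuous cis := by unfold cis; fun_prop

/-- The length of the side from the vertex with angle `α` to the obtuse vertex, in the triangle
with small angles `α`, `β` and long side of length one. -/
noncomputable def legLength (α β : ℝ) : ℝ := Real.sin β / Real.sin (α + β)

/-- A copy of the triangle with small angles `α`, `β` in the plane. The sign `σ` is `1` for a copy
with the orientation of the standard triangle and `-1` for a mirror image, `θ` is the argument of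
the long side, directed from vertex `0` to vertex `1`, and `base` is the place of vertex `0`. -/
structure Placement where
  /-- the orientation, `1` or `-1` -/
  σ : ℝ
  /-- the argument of the long side -/
  θ : ℝ
  /-- the place of vertex `0` -/
  base : ℂ

namespace Placement

/-- The vertices of the placed triangle. -/
noncomputable def vertex (α β : ℝ) (s : Placement) : Fin 3 → ℂ :=
  ![s.base, s.base + cis s.θ, s.base + legLength α β * cis (s.θ + s.σ * α)]

/-- The placement obtained by reflecting the triangle in its side `i`. -/
noncomputable def step (α β : ℝ) (s : Placement) : Fin 3 → Placement
  | 0 => ⟨-s.σ, s.θ - 2 * s.σ * β, s.base + cis s.θ - cis (s.θ - 2 * s.σ * β)⟩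
  | 1 => ⟨-s.σ, s.θ + 2 * s.σ * α, s.base⟩
  | 2 => ⟨-s.σ, s.θ, s.base⟩

/-- The last triangle of the unfolding along a word. -/
noncomputable def run (α β : ℝ) (s : Placement) (L : List (Fin 3)) : Placement :=
  L.foldl (step α β) s

/-- The translate of a placement. -/
def shift (T : ℂ) (s : Placement) : Placement := ⟨s.σ, s.θ, s.base + T⟩

/-- The linear part of the isometry that places the standard triangle. -/
noncomputable def lin (s : Placement) (z : ℂ) : ℂ := cis s.θ * (z.re + s.σ * z.im * I)

end Placement

/-- The signed height of `z` over the line `Im (z * conj τ) = c`, scaled by `‖τ‖`. -/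
noncomputable def height (τ : ℂ) (c : ℝ) (z : ℂ) : ℝ := (z * conj τ).im - c

/-- The line `height τ c = 0`, directed by `τ`, leaves the placed triangle through the interior of
side `i`. -/
def Exits (α β : ℝ) (τ : ℂ) (c : ℝ) (s : Placement) (i : Fin 3) : Prop :=
  s.σ * height τ c (s.vertex α β (i + 1)) < 0 ∧ 0 < s.σ * height τ c (s.vertex α β (i + 2))

/-- The line `height τ c = 0`, directed by `τ`, crosses one after the other the sides of the
unfolding along the word `L`, which starts with the triangle `s`. -/
def Crosses (α β : ℝ) (τ : ℂ) (c : ℝ) : Placement → List (Fin 3) → Prop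
  | _, [] => True
  | s, i :: L => Exits α β τ c s i ∧ Crosses α β τ c (s.step α β i) L

lemma height_add (τ : ℂ) (c : ℝ) (z w : ℂ) :
    height τ c (z + w) = height τ c z + (w * conj τ).im := by
  simp only [height, add_mul, add_im]; ring

lemma height_add_self (τ : ℂ) (c : ℝ) (z : ℂ) : height τ c (z + τ) = height τ c z := by
  rw [height_add, Complex.mul_conj, ofReal_im, add_zero]

namespace Placement

variable {α β : ℝ}

@[simp] lemma run_nil (s : Placement) : s.run α β [] = s := rfl

@[simp] lemma run_cons (s : Placement) (i : Fin 3) (L : List (Fin 3)) :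
    s.run α β (i :: L) = (s.step α β i).run α β L := rfl

lemma run_append (s : Placement) (L M : List (Fin 3)) :
    s.run α β (L ++ M) = (s.run α β L).run α β M := List.foldl_append

lemma step_σ (s : Placement) (i : Fin 3) : (s.step α β i).σ = -s.σ := by
  fin_cases i <;> rfl

lemma step_σ_sq {s : Placement} (hs : s.σ ^ 2 = 1) (i : Fin 3) : (s.step α β i).σ ^ 2 = 1 := by
  rw [step_σ, neg_sq, hs]

lemma step_shift (T : ℂ) (s : Placement) (i : Fin 3) :
    (s.shift T).step α β i = (s.step α β i).shift T := by
  fin_cases i <;> simp [step, shift]; ring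

lemma vertex_shift (T : ℂ) (s : Placement) (i : Fin 3) :
    (s.shift T).vertex α β i = s.vertex α β i + T := by
  fin_cases i <;> simp [vertex, shift] <;> ring

end Placement

/-- The law of sines: the two legs, one from each end of the long side, meet. -/
lemma legLength_mul_cis {α β : ℝ} (h : Real.sin (α + β) ≠ 0) :
    (legLength α β : ℂ) * cis α = 1 - legLength β α * cis (-β) := by
  apply Complex.ext
  · simp only [re_ofReal_mul, sub_re, cis_re, legLength, add_comm β α, one_re, Real.cos_neg]
    field_simp
    rw [Real.sin_add]; ring
  · simp only [im_ofReal_mul, sub_im, cis_im, legLength, add_comm β α, one_im, Real.sin_neg]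
    field_simp
    ring

lemma eq_one_or_neg_one_of_sq {σ : ℝ} (h : σ ^ 2 = 1) : σ = 1 ∨ σ = -1 :=
  mul_self_eq_one_iff.1 (by rw [← sq]; exact h)

namespace Placement

variable {α β : ℝ}

/-- The two ends of the side in which a triangle is reflected stay in place. -/
lemma vertex_step (h : Real.sin (α + β) ≠ 0) {s : Placement} (hs : s.σ ^ 2 = 1) (i : Fin 3) :
    (s.step α β i).vertex α β (i + 1) = s.vertex α β (i + 1) ∧
      (s.step α β i).vertex α β (i + 2) = s.vertex α β (i + 2) := by
  have key := legLength_mul_cis h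
  have key' := congrArg conj key
  simp only [map_mul, map_sub, conj_cis, conj_ofReal, map_one, neg_neg] at key'
  obtain ⟨σ, θ, b⟩ := s
  fin_cases i
  · refine ⟨by simp [vertex, step], ?_⟩
    simp only [vertex, step, Fin.mk_zero, zero_add, Matrix.cons_val]
    rcases eq_one_or_neg_one_of_sq hs with rfl | rfl
    · have e1 : cis (θ - 2 * 1 * β + -1 * α) = cis θ * cis (-β) * cis (-β) * cis (-α) := by
        rw [← cis_add, ← cis_add, ← cis_add]; ring_nf
      have e2 : cis (θ - 2 * 1 * β) = cis θ * cis (-β) * cis (-β) := by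
        rw [← cis_add, ← cis_add]; ring_nf
      rw [e1, e2, one_mul, cis_add]
      linear_combination (cis θ * cis (-β) * cis (-β)) * key' - cis θ * key -
        cis θ * legLength β α * cis (-β) * cis_mul_cis_neg β
    · have e1 : cis (θ - 2 * -1 * β + - -1 * α) = cis θ * cis β * cis β * cis α := by
        rw [← cis_add, ← cis_add, ← cis_add]; ring_nf
      have e2 : cis (θ - 2 * -1 * β) = cis θ * cis β * cis β := by
        rw [← cis_add, ← cis_add]; ring_nf
      rw [e1, e2, neg_one_mul, cis_add]
      linear_combination (cis θ * cis β * cis β) * key - cis θ * key' -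
        cis θ * legLength β α * cis β * cis_mul_cis_neg β
  · refine ⟨?_, by simp [vertex, step]⟩
    simp only [vertex, step, Fin.mk_one, Fin.reduceAdd, Matrix.cons_val]
    ring_nf
  · exact ⟨by simp [vertex, step], by simp [vertex, step]⟩

/-- The oriented area of a placed triangle, seen from any vertex. -/
lemma cross_vertex {s : Placement} (hs : s.σ ^ 2 = 1) (i : Fin 3) :
    (conj (s.vertex α β (i + 1) - s.vertex α β i) *
      (s.vertex α β (i + 2) - s.vertex α β i)).im = s.σ * (legLength α β * Real.sin α) := by
  obtain ⟨σ, θ, b⟩ := s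
  have h1 : Real.sin (θ + σ * α) * Real.cos θ - Real.cos (θ + σ * α) * Real.sin θ =
      σ * Real.sin α := by
    rw [← Real.sin_sub, add_sub_cancel_left]
    rcases eq_one_or_neg_one_of_sq hs with h | h <;> simp only at h <;> subst h <;> simp
  fin_cases i <;>
  · simp [vertex, cis_re, cis_im]
    linear_combination (legLength α β) * h1

end Placement

/-! ### The bounce points on a line through the unfolding -/

/-- A directed line that enters a triangle through one side at `C`, at the point `C + p`, and meets
another side at `C` in the point `C + q`, runs from the first point to the second, if it passes `C`
on the proper side. -/
lemma exists_pos_smul_of_height {τ C p q : ℂ} {c κ : ℝ} (hC : κ * height τ c C < 0)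
    (hp : height τ c (C + p) = 0) (hq : height τ c (C + q) = 0)
    (harea : 0 < κ * (conj q * p).im) : ∃ r : ℝ, 0 < r ∧ q - p = r * τ := by
  rw [height_add] at hp hq
  have hm : 0 < κ * (q * conj τ).im := by
    rw [show (q * conj τ).im = -height τ c C by linarith]; linarith
  have hτ : 0 < normSq τ := by
    rw [normSq_pos]; rintro rfl; simp at hm
  have hreal : (((q - p) * conj τ).re : ℂ) = (q - p) * conj τ := by
    apply Complex.ext
    · simp
    · rw [ofReal_im, sub_mul, sub_im]; linarith
  have hmul : τ * conj τ = normSq τ := mul_conj τ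
  set ν := ((q - p) * conj τ).re with hν
  have hne : (normSq τ : ℂ) ≠ 0 := by exact_mod_cast hτ.ne'
  have hqp : q - p = (ν / normSq τ : ℝ) * τ := by
    push_cast
    field_simp
    rw [← hmul]
    linear_combination -τ * hreal
  refine ⟨ν / normSq τ, ?_, hqp⟩
  have h1 : (conj q * p).im = ν / normSq τ * (q * conj τ).im := by
    have : p = q - (ν / normSq τ : ℝ) * τ := by rw [← hqp]; ring
    rw [this]
    simp only [mul_im, sub_im, sub_re, mul_re, conj_re, conj_im, ofReal_re, ofReal_im]
    ring
  rw [h1, mul_left_comm] at harea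
  exact pos_of_mul_pos_left harea hm.le

namespace Placement

variable {α β : ℝ}

/-- The barycentric coordinate on side `i` of the point where the line meets this side. -/
noncomputable def coord (α β : ℝ) (τ : ℂ) (c : ℝ) (s : Placement) (i : Fin 3) : ℝ :=
  height τ c (s.vertex α β (i + 1)) /
    (height τ c (s.vertex α β (i + 1)) - height τ c (s.vertex α β (i + 2)))

/-- The point where the line meets side `i` of the placed triangle. -/
noncomputable def hit (α β : ℝ) (τ : ℂ) (c : ℝ) (s : Placement) (i : Fin 3) : ℂ :=
  s.vertex α β (i + 1) +
    s.coord α β τ c i * (s.vertex α β (i + 2) - s.vertex α β (i + 1))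

lemma coord_mem {τ : ℂ} {c : ℝ} {s : Placement} (hs : s.σ ^ 2 = 1) {i : Fin 3}
    (h : Exits α β τ c s i) : 0 < s.coord α β τ c i ∧ s.coord α β τ c i < 1 := by
  obtain ⟨h1, h2⟩ := h
  unfold coord
  generalize height τ c (s.vertex α β (i + 1)) = u at *
  generalize height τ c (s.vertex α β (i + 2)) = w at *
  rcases eq_one_or_neg_one_of_sq hs with h | h <;> rw [h] at h1 h2
  · rw [← neg_div_neg_eq]
    exact ⟨div_pos (by linarith) (by linarith), (div_lt_one (by linarith)).2 (by linarith)⟩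
  · exact ⟨div_pos (by linarith) (by linarith), (div_lt_one (by linarith)).2 (by linarith)⟩

lemma height_hit {τ : ℂ} {c : ℝ} {s : Placement} {i : Fin 3}
    (h : Exits α β τ c s i) : height τ c (s.hit α β τ c i) = 0 := by
  have hne : height τ c (s.vertex α β (i + 1)) - height τ c (s.vertex α β (i + 2)) ≠ 0 := by
    obtain ⟨h1, h2⟩ := h
    intro h0
    rw [sub_eq_zero.1 h0] at h1
    linarith
  have h2 : ((s.vertex α β (i + 2) - s.vertex α β (i + 1)) * conj τ).im =
      height τ c (s.vertex α β (i + 2)) - height τ c (s.vertex α β (i + 1)) := by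
    simp only [height, sub_mul, sub_im]; ring
  rw [hit, height_add, mul_assoc, im_ofReal_mul, h2, coord]
  field_simp
  ring

lemma hit_step (h : Real.sin (α + β) ≠ 0) {τ : ℂ} {c : ℝ} {s : Placement} (hs : s.σ ^ 2 = 1)
    (i : Fin 3) : (s.step α β i).hit α β τ c i = s.hit α β τ c i := by
  simp only [hit, coord, vertex_step h hs i]

/-- Along the unfolding, the line proceeds in its own direction from each side to the next. -/
lemma exists_hit_sub_hit (h : Real.sin (α + β) ≠ 0) (hα : 0 < legLength α β * Real.sin α)
    {τ : ℂ} {c : ℝ} {s : Placement} (hs : s.σ ^ 2 = 1) {e i : Fin 3} (he : Exits α β τ c s e)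
    (hi : Exits α β τ c (s.step α β e) i) :
    ∃ r : ℝ, 0 < r ∧ (s.step α β e).hit α β τ c i - s.hit α β τ c e = r * τ := by
  have hs' := step_σ_sq (α := α) (β := β) hs e
  have hh1 := height_hit he
  have hh2 := height_hit hi
  obtain ⟨hc1, hc1'⟩ := coord_mem hs he
  obtain ⟨hc2, hc2'⟩ := coord_mem hs' hi
  rw [← hit_step h hs] at hh1 ⊢
  rw [Exits, ← neg_neg s.σ, ← step_σ (α := α) (β := β), ← (vertex_step h hs e).1,
    ← (vertex_step h hs e).2] at he
  have hcc : s.coord α β τ c e = (s.step α β e).coord α β τ c e := by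
    simp only [coord, vertex_step h hs e]
  rw [hcc] at hc1 hc1'
  clear hcc
  generalize s.step α β e = t at *
  have hcr := cross_vertex (α := α) (β := β) hs'
  have hpos : 0 < t.σ * (t.σ * (legLength α β * Real.sin α)) := by
    rw [← mul_assoc, ← sq, hs', one_mul]; exact hα
  obtain rfl | rfl | rfl := (by decide : ∀ i e : Fin 3, i = e ∨ i = e + 1 ∨ i = e + 2) i e
  · exact absurd he.1 (by have := hi.1; linarith)
  · have e1 : e + 1 + 1 = e + 2 := (by decide : ∀ e : Fin 3, e + 1 + 1 = e + 2) e
    have e2 : e + 1 + 2 = e := (by decide : ∀ e : Fin 3, e + 1 + 2 = e) e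
    have e3 : e + 2 + 1 = e := (by decide : ∀ e : Fin 3, e + 2 + 1 = e) e
    have e4 : e + 2 + 2 = e + 1 := (by decide : ∀ e : Fin 3, e + 2 + 2 = e + 1) e
    set u := t.coord α β τ c e
    set w := t.coord α β τ c (e + 1)
    set C := t.vertex α β (e + 2)
    have hp : t.hit α β τ c e = C + ((1 - u : ℝ) : ℂ) * (t.vertex α β (e + 1) - C) := by
      simp only [hit]; push_cast; ring
    have hq : t.hit α β τ c (e + 1) = C + (w : ℂ) * (t.vertex α β e - C) := by
      simp only [hit, e1, e2]; rfl
    rw [hp] at hh1 ⊢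
    rw [hq] at hh2 ⊢
    rw [add_sub_add_left_eq_sub]
    refine exists_pos_smul_of_height (κ := t.σ) (by have := hi.1; rwa [e1] at this) hh1 hh2 ?_
    have := hcr (e + 2)
    rw [e3, e4] at this
    rw [map_mul, conj_ofReal, mul_mul_mul_comm, ← ofReal_mul, im_ofReal_mul, this,
      mul_left_comm]
    exact mul_pos (mul_pos hc2 (by linarith)) hpos
  · have e1 : e + 2 + 1 = e := (by decide : ∀ e : Fin 3, e + 2 + 1 = e) e
    have e2 : e + 2 + 2 = e + 1 := (by decide : ∀ e : Fin 3, e + 2 + 2 = e + 1) e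
    have e3 : e + 1 + 1 = e + 2 := (by decide : ∀ e : Fin 3, e + 1 + 1 = e + 2) e
    have e4 : e + 1 + 2 = e := (by decide : ∀ e : Fin 3, e + 1 + 2 = e) e
    set u := t.coord α β τ c e
    set w := t.coord α β τ c (e + 2)
    set C := t.vertex α β (e + 1)
    have hp : t.hit α β τ c e = C + (u : ℂ) * (t.vertex α β (e + 2) - C) := rfl
    have hq : t.hit α β τ c (e + 2) = C + ((1 - w : ℝ) : ℂ) * (t.vertex α β e - C) := by
      simp only [hit, e1, e2]; push_cast; ring
    rw [hp] at hh1 ⊢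
    rw [hq] at hh2 ⊢
    rw [add_sub_add_left_eq_sub]
    refine exists_pos_smul_of_height (κ := -t.σ) (by have := hi.2; rw [e2] at this; linarith)
      hh1 hh2 ?_
    have := hcr (e + 1)
    rw [e3, e4] at this
    have h5 : (conj (t.vertex α β e - C) * (t.vertex α β (e + 2) - C)).im =
        -(t.σ * (legLength α β * Real.sin α)) := by
      rw [← this]; simp only [mul_im, conj_re, conj_im]; ring
    rw [map_mul, conj_ofReal, mul_mul_mul_comm, ← ofReal_mul, im_ofReal_mul, h5]
    have : 0 < (1 - w) * u := mul_pos (by linarith) hc1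
    nlinarith

end Placement

/-! ### From a line through the unfolding to a periodic billiard path -/

lemma reflection_span_mul_cis (r φ : ℝ) (hr : r ≠ 0) (z : ℂ) :
    (Submodule.span ℝ {(r : ℂ) * cis φ}).reflection z = cis (2 * φ) * conj z := by
  rw [Submodule.reflection_singleton_apply]
  have hn : ‖(r : ℂ) * cis φ‖ ^ 2 = r ^ 2 := by
    rw [norm_mul, mul_pow, Complex.norm_real, Real.norm_eq_abs, sq_abs, cis,
      Complex.norm_exp_ofReal_mul_I, one_pow, mul_one]
  have hsq := Real.sin_sq_add_cos_sq φ
  have hr2 : r ^ 2 ≠ 0 := pow_ne_zero 2 hr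
  rw [Complex.inner, RCLike.ofReal_real_eq_id, id, hn]
  have hc : ((z * conj (r * cis φ)).re / r ^ 2 : ℝ) =
      (z.re * Real.cos φ + z.im * Real.sin φ) / r := by
    simp only [mul_re, mul_im, map_mul, conj_re, conj_im, conj_ofReal, ofReal_re, ofReal_im,
      cis_re, cis_im]
    field_simp
    ring
  rw [hc]
  apply Complex.ext
  · simp only [two_nsmul, real_smul, sub_re, add_re, mul_re, mul_im, conj_re, conj_im, ofReal_re,
      ofReal_im, cis_re, cis_im, Real.cos_two_mul, Real.sin_two_mul]
    field_simp
    ring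
  · simp only [two_nsmul, real_smul, sub_im, add_im, mul_re, mul_im, conj_re, conj_im, ofReal_re,
      ofReal_im, cis_re, cis_im, Real.cos_two_mul, Real.sin_two_mul]
    field_simp
    linear_combination (2 * z.im * r) * hsq

namespace Placement

lemma lin_cis {s : Placement} (hs : s.σ ^ 2 = 1) (φ : ℝ) :
    s.lin (cis φ) = cis (s.θ + s.σ * φ) := by
  rw [lin, cis_add]
  congr 1
  rcases eq_one_or_neg_one_of_sq hs with h | h <;> rw [h] <;>
    apply Complex.ext <;>
    simp only [add_re, add_im, mul_re, mul_im, ofReal_re, ofReal_im, I_re, I_im, cis_re, cis_im,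
      one_mul, neg_one_mul, Real.cos_neg, Real.sin_neg] <;> ring

lemma lin_ofReal_mul (s : Placement) (r : ℝ) (z : ℂ) : s.lin (r * z) = r * s.lin z := by
  simp only [lin, re_ofReal_mul, im_ofReal_mul]; push_cast; ring

lemma lin_add (s : Placement) (z w : ℂ) : s.lin (z + w) = s.lin z + s.lin w := by
  simp only [lin, add_re, add_im]; push_cast; ring

lemma lin_sub (s : Placement) (z w : ℂ) : s.lin (z - w) = s.lin z - s.lin w := by
  simp only [lin, sub_re, sub_im]; push_cast; ring

lemma exists_lin_eq {s : Placement} (hs : s.σ ^ 2 = 1) (w : ℂ) : ∃ z, s.lin z = w := by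
  rcases eq_one_or_neg_one_of_sq hs with h | h
  · refine ⟨cis (-s.θ) * w, ?_⟩
    rw [lin, h, ofReal_one, one_mul, re_add_im, ← mul_assoc, cis_mul_cis_neg, one_mul]
  · refine ⟨conj (cis (-s.θ) * w), ?_⟩
    have : ((conj (cis (-s.θ) * w)).re + ((-1 : ℝ) : ℂ) * (conj (cis (-s.θ) * w)).im * I : ℂ) =
        cis (-s.θ) * w := by
      conv_rhs => rw [← re_add_im (cis (-s.θ) * w)]
      simp only [conj_re, conj_im]
      push_cast; ring
    rw [lin, h, this, ← mul_assoc, cis_mul_cis_neg, one_mul]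

lemma lin_injective {s : Placement} (hs : s.σ ^ 2 = 1) {z w : ℂ} (h : s.lin z = s.lin w) :
    z = w := by
  have hc : cis s.θ ≠ 0 := Complex.exp_ne_zero _
  have h1 := mul_left_cancel₀ hc h
  have hre := congrArg Complex.re h1
  have him := congrArg Complex.im h1
  rcases eq_one_or_neg_one_of_sq hs with h | h <;> rw [h] at hre him <;> simp at hre him <;>
    exact Complex.ext hre him

end Placement

variable {x : EuclideanSpace ℝ (Fin 2)}

lemma sin_add_pos_of_mem (hx : x ∈ parameterSpace) : 0 < Real.sin (x 0 + x 1) :=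
  Real.sin_pos_of_pos_of_lt_pi (by have := hx.1; have := hx.2.1; linarith)
    (by have := hx.2.2; linarith [Real.pi_pos])

lemma sin_pos_of_mem (hx : x ∈ parameterSpace) (i : Fin 2) : 0 < Real.sin (x i) := by
  obtain ⟨h0, h1, h2⟩ := hx
  have := Real.pi_pos
  fin_cases i
  · exact Real.sin_pos_of_pos_of_lt_pi h0 (by simp; linarith)
  · exact Real.sin_pos_of_pos_of_lt_pi h1 (by simp; linarith)

lemma triangleVertex_two :
    triangleVertex x 2 = legLength (x 0) (x 1) * cis (x 0) := by
  simp [triangleVertex, legLength, cis]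

namespace Placement

lemma vertex_eq {s : Placement} (hs : s.σ ^ 2 = 1) (i : Fin 3) :
    s.vertex (x 0) (x 1) i = s.base + s.lin (triangleVertex x i) := by
  fin_cases i
  · simp [vertex, triangleVertex, lin]
  · simp [vertex, triangleVertex, lin]
  · change s.base + _ = s.base + s.lin (triangleVertex x 2)
    rw [triangleVertex_two, lin_ofReal_mul, lin_cis hs]

/-- Placing the reflected triangle is the same as reflecting first and placing afterwards. -/
lemma lin_step_reflection (hx : x ∈ parameterSpace) {s : Placement} (hs : s.σ ^ 2 = 1)
    (i : Fin 3) (z : ℂ) :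
    (s.step (x 0) (x 1) i).lin ((sideDirection (triangleVertex x) i).reflection z) = s.lin z := by
  have h01 := sin_add_pos_of_mem hx
  have key := legLength_mul_cis h01.ne'
  have hl : ∀ {u w : ℝ}, 0 < Real.sin w → 0 < Real.sin (u + w) → -legLength u w ≠ 0 := by
    intro u w h1 h2
    exact neg_ne_zero.2 (div_pos h1 h2).ne'
  -- on both sides stand real-linear maps, and each placement is a rotation or its mirror image
  have aux : ∀ φ : ℝ, (s.step (x 0) (x 1) i).θ = s.θ + 2 * s.σ * φ →
      (s.step (x 0) (x 1) i).lin (cis (2 * φ) * conj z) = s.lin z := by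
    intro φ hφ
    have h1 : cis (s.θ + 2 * s.σ * φ) = cis s.θ * cis (s.σ * (2 * φ)) := by
      rw [← cis_add]; ring_nf
    rw [lin, lin, hφ, step_σ, h1, mul_assoc]
    congr 1
    have hsq := Real.sin_sq_add_cos_sq (2 * φ)
    rcases eq_one_or_neg_one_of_sq hs with h | h <;> rw [h] <;> apply Complex.ext <;>
      simp only [add_re, add_im, mul_re, mul_im, conj_re, conj_im, ofReal_re, ofReal_im, I_re, I_im,
        cis_re, cis_im, one_mul, neg_one_mul, neg_neg, Real.cos_neg, Real.sin_neg]
    · linear_combination z.re * hsq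
    · linear_combination z.im * hsq
    · linear_combination z.re * hsq
    · linear_combination -z.im * hsq
  fin_cases i
  · have hd : triangleVertex x 2 - triangleVertex x 1 =
        ((-legLength (x 1) (x 0) : ℝ) : ℂ) * cis (-x 1) := by
      rw [triangleVertex_two, key]; simp [triangleVertex]
    simp only [sideDirection, Fin.zero_eta, zero_add, hd] at aux ⊢
    rw [reflection_span_mul_cis _ _ (hl (sin_pos_of_mem hx 0) (by rwa [add_comm]))]
    exact aux _ (by simp only [step]; ring)
  · have hd : triangleVertex x (1 + 2) - triangleVertex x (1 + 1) =
        ((-legLength (x 0) (x 1) : ℝ) : ℂ) * cis (x 0) := by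
      change triangleVertex x 0 - triangleVertex x 2 = _
      rw [triangleVertex_two]; simp [triangleVertex]
    simp only [sideDirection, Fin.mk_one, hd] at aux ⊢
    rw [reflection_span_mul_cis _ _ (hl (sin_pos_of_mem hx 1) h01)]
    exact aux _ (by simp only [step])
  · have hd : triangleVertex x (2 + 2) - triangleVertex x (2 + 1) =
        ((1 : ℝ) : ℂ) * cis 0 := by
      change triangleVertex x 1 - triangleVertex x 0 = _
      simp [triangleVertex, cis_zero]
    simp only [sideDirection, Fin.reduceFinMk, hd] at aux ⊢
    rw [reflection_span_mul_cis _ _ one_ne_zero]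
    exact aux _ (by simp only [step]; ring)

end Placement

/-- The bi-infinite word that repeats a finite word. -/
def PeriodicWord.ofList (L : List (Fin 3)) (hL : L ≠ []) : PeriodicWord where
  digit k := L.getD (k % L.length).toNat 0
  periodic := ⟨L.length, List.length_pos_of_ne_nil hL, fun k => by simp⟩

lemma apply_toNat_emod_add_one {X : Type*} {f : ℕ → X} {m : ℕ} (hm : 0 < m)
    (hf : ∀ k, f (k + m) = f k) (k : ℤ) :
    f ((k + 1) % m).toNat = f ((k % m).toNat + 1) := by
  have hmod : ∀ a, f (a % m) = f a := fun a => (show Function.Periodic f m from hf).map_mod_nat a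
  obtain ⟨a, ha⟩ := Int.eq_ofNat_of_zero_le
    (Int.emod_nonneg k (b := (m : ℤ)) (by exact_mod_cast hm.ne'))
  rw [← Int.emod_add_emod, ha]
  have : ((a : ℤ) + 1) % m = ((a + 1) % m : ℕ) := by push_cast; rfl
  rw [this, Int.toNat_natCast, Int.toNat_natCast, hmod]

lemma Crosses.exits_getElem {α β : ℝ} {τ : ℂ} {c : ℝ} : ∀ {s : Placement} {L : List (Fin 3)},
    Crosses α β τ c s L → ∀ (k : ℕ) (hk : k < L.length),
      Exits α β τ c (s.run α β (L.take k)) L[k]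
  | _, _ :: _, h, 0, _ => h.1
  | _, _ :: _, h, k + 1, hk => exits_getElem h.2 k (Nat.lt_of_succ_lt_succ hk)

/-- A line that crosses an unfolding which ends with a translate of the first triangle by a vector
along the line folds up to a periodic billiard path. -/
theorem mem_orbitTile_of_crosses (hx : x ∈ parameterSpace) {L : List (Fin 3)} (hL : L ≠ [])
    {s : Placement} (hs : s.σ ^ 2 = 1) {τ : ℂ} {c : ℝ}
    (hrun : s.run (x 0) (x 1) L = s.shift τ) (hcross : Crosses (x 0) (x 1) τ c s L) :
    x ∈ orbitTile (PeriodicWord.ofList L hL) := by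
  refine ⟨hx, ?_⟩
  have hm : 0 < L.length := List.length_pos_of_ne_nil hL
  have h01 := (sin_add_pos_of_mem hx).ne'
  have hα : 0 < legLength (x 0) (x 1) * Real.sin (x 0) :=
    mul_pos (div_pos (sin_pos_of_mem hx 1) (sin_add_pos_of_mem hx)) (sin_pos_of_mem hx 0)
  set m := L.length with hmdef
  set w : ℕ → Fin 3 := fun k => L.getD (k % m) 0 with hw
  have hwm : ∀ k, w (k + m) = w k := fun k => by simp [hw]
  let st : ℕ → Placement := fun k => Nat.rec s (fun j t => t.step (x 0) (x 1) (w j)) k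
  have st_succ : ∀ k, st (k + 1) = (st k).step (x 0) (x 1) (w k) := fun k => rfl
  have hwget : ∀ k (hk : k < L.length), w k = L[k] := fun k hk => by
    simp only [hw]
    rw [Nat.mod_eq_of_lt hk, List.getD_eq_getElem _ _ hk]
  have st_take : ∀ k ≤ m, st k = s.run (x 0) (x 1) (L.take k) := by
    intro k
    induction k with
    | zero => intro _; simp [st]
    | succ k ih =>
      intro hk
      rw [st_succ, ih (by omega), List.take_add_one, Placement.run_append, hwget k (by omega),
        List.getElem?_eq_getElem (by omega)]
      rfl
  have st_m : st m = s.shift τ := by rw [st_take m le_rfl, hmdef, List.take_length, hrun]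
  have st_add : ∀ k, st (k + m) = (st k).shift τ := by
    intro k
    induction k with
    | zero => rw [zero_add, st_m]; rfl
    | succ k ih => rw [Nat.add_right_comm, st_succ, ih, hwm, Placement.step_shift, st_succ]
  have st_σ : ∀ k, (st k).σ ^ 2 = 1 := by
    intro k
    induction k with
    | zero => exact hs
    | succ k ih => rw [st_succ]; exact Placement.step_σ_sq ih _
  have hheight : ∀ k i, height τ c ((st (k + m)).vertex (x 0) (x 1) i) =
      height τ c ((st k).vertex (x 0) (x 1) i) := by
    intro k i
    rw [st_add, Placement.vertex_shift, height_add_self]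
  have hexit : ∀ k, Exits (x 0) (x 1) τ c (st k) (w k) := by
    intro k
    induction k using Nat.strong_induction_on with
    | _ k ih =>
      rcases lt_or_ge k m with hk | hk
      · rw [st_take k hk.le, hwget k hk]
        exact hcross.exits_getElem k hk
      · obtain ⟨j, rfl⟩ := Nat.exists_eq_add_of_le' hk
        have := ih j (by omega)
        rw [Exits, hheight, hheight, hwm, st_add]
        exact this
  set v := triangleVertex x with hv
  let t : ℕ → ℝ := fun k => (st k).coord (x 0) (x 1) τ c (w k)
  let q : ℕ → ℂ := fun k => v (w k + 1) + t k * (v (w k + 2) - v (w k + 1))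
  have hqm : ∀ k, q (k + m) = q k := by
    intro k
    simp only [q, t, Placement.coord, hheight, hwm]
  -- the bounce points, seen in the unfolding from either side of the crossed side
  have hit_eq : ∀ k, (st k).hit (x 0) (x 1) τ c (w k) = (st k).base + (st k).lin (q k) := by
    intro k
    simp only [Placement.hit, Placement.vertex_eq (st_σ k), q, t, Placement.lin_add,
      Placement.lin_ofReal_mul, Placement.lin_sub]
    ring
  have hit_eq' : ∀ k, (st k).hit (x 0) (x 1) τ c (w k) =
      (st (k + 1)).base + (st (k + 1)).lin (q k) := by
    intro k
    have h2 := Placement.vertex_step h01 (st_σ k) (w k)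
    have hc : (st (k + 1)).coord (x 0) (x 1) τ c (w k) = t k := by
      simp only [Placement.coord, st_succ, h2, t]
    rw [← Placement.hit_step h01 (st_σ k), ← st_succ]
    simp only [Placement.hit, Placement.vertex_eq (st_σ (k + 1)), hc, q, Placement.lin_add,
      Placement.lin_ofReal_mul, Placement.lin_sub]
    ring
  have hstep : ∀ k, ∃ r : ℝ, 0 < r ∧ (st (k + 1)).lin (q (k + 1) - q k) = r * τ := by
    intro k
    obtain ⟨r, hr, h⟩ := Placement.exists_hit_sub_hit h01 hα (st_σ k) (hexit k) (hexit (k + 1))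
    refine ⟨r, hr, ?_⟩
    rw [← h, ← st_succ, hit_eq (k + 1), hit_eq' k, Placement.lin_sub]
    ring
  have hτ : τ ≠ 0 := by
    rintro rfl
    have h1 := (hexit 0).1
    have h2 := (hexit 0).2
    simp only [height, map_zero, mul_zero, zero_im] at h1 h2
    linarith
  have hne : ∀ k, q k ≠ q (k + 1) := by
    intro k h
    obtain ⟨r, hr, h'⟩ := hstep k
    rw [h, sub_self] at h'
    have : (st (k + 1)).lin 0 = 0 := by simp [Placement.lin]
    rw [this] at h'
    exact mul_ne_zero (by exact_mod_cast hr.ne') hτ h'.symm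
  have hray : ∀ k, SameRay ℝ ((sideDirection v (w (k + 1))).reflection (q (k + 1) - q k))
      (q (k + 2) - q (k + 1)) := by
    intro k
    obtain ⟨r, hr, h⟩ := hstep k
    obtain ⟨r', hr', h'⟩ := hstep (k + 1)
    obtain ⟨z, hz⟩ := Placement.exists_lin_eq (st_σ (k + 2)) τ
    have e1 : (sideDirection v (w (k + 1))).reflection (q (k + 1) - q k) = r • z := by
      apply Placement.lin_injective (st_σ (k + 2))
      rw [st_succ (k + 1), hv, Placement.lin_step_reflection hx (st_σ (k + 1)), h, real_smul,
        Placement.lin_ofReal_mul, ← st_succ (k + 1), hz]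
    have e2 : q (k + 2) - q (k + 1) = r' • z := by
      apply Placement.lin_injective (st_σ (k + 2))
      rw [real_smul, Placement.lin_ofReal_mul, hz]
      exact h'
    rw [e1, e2]
    exact sameRay_smul_smul_of_mul_nonneg (mul_nonneg hr.le hr'.le)
  refine ⟨fun k => q (k % m).toNat, ?_, ?_, ?_, ⟨m, hm, fun k => by simp⟩⟩
  · intro k
    have hmod : (k % (m : ℤ)).toNat % m = (k % (m : ℤ)).toNat := by
      apply Nat.mod_eq_of_lt
      have := Int.emod_lt_of_pos k (b := (m : ℤ)) (by exact_mod_cast hm)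
      omega
    have hdig : (PeriodicWord.ofList L hL).digit k = w (k % m).toNat := by
      simp only [hw, hmod]; rfl
    rw [hdig]
    obtain ⟨h0, h1⟩ := Placement.coord_mem (st_σ (k % m).toNat) (hexit (k % m).toNat)
    exact ⟨1 - t (k % m).toNat, t (k % m).toNat, by simpa [t] using h1, h0, by ring, by
      simp only [q, real_smul]; push_cast; ring⟩
  · intro k
    rw [apply_toNat_emod_add_one hm hqm]
    exact hne _
  · intro k
    obtain ⟨j, rfl⟩ : ∃ j : ℤ, k = j + 1 := ⟨k - 1, by ring⟩
    have hdig : (PeriodicWord.ofList L hL).digit (j + 1) = w ((j % m).toNat + 1) := by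
      have h := apply_toNat_emod_add_one hm hwm j
      rw [← h]
      have hmod : ((j + 1) % (m : ℤ)).toNat % m = ((j + 1) % (m : ℤ)).toNat := by
        apply Nat.mod_eq_of_lt
        have := Int.emod_lt_of_pos (j + 1) (b := (m : ℤ)) (by exact_mod_cast hm)
        omega
      simp only [hw, hmod]; rfl
    have h1 := apply_toNat_emod_add_one hm hqm j
    have h2 : q ((j + 1 + 1) % m).toNat = q ((j % m).toNat + 2) := by
      rw [apply_toNat_emod_add_one hm hqm (j + 1)]
      exact apply_toNat_emod_add_one (f := fun k => q (k + 1)) hm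
        (fun k => by rw [Nat.add_right_comm, hqm]) j
    rw [hdig]
    change SameRay ℝ ((sideDirection v _).reflection (q _ - q _)) (q _ - q _)
    rw [h1, h2, add_sub_cancel_right]
    exact hray _

/-! ### Fans, reversal, and words with a rotational symmetry -/

/-- The word `(1 2)ʲ`, along which the triangle turns about its vertex `0`. -/
def fanZero : ℕ → List (Fin 3)
  | 0 => []
  | j + 1 => 1 :: 2 :: fanZero j

/-- The word `(0 2)ʲ`, along which the triangle turns about its vertex `1`. -/
def fanOne : ℕ → List (Fin 3)
  | 0 => []
  | j + 1 => 0 :: 2 :: fanOne j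

variable {α β : ℝ} {τ : ℂ} {c : ℝ}

lemma Crosses.append : ∀ {s : Placement} {L M : List (Fin 3)}, Crosses α β τ c s L →
    Crosses α β τ c (s.run α β L) M → Crosses α β τ c s (L ++ M)
  | _, [], _, _, h => h
  | _, _ :: _, _, h, h' => ⟨h.1, Crosses.append h.2 h'⟩

lemma height_neg (z : ℂ) : height (-τ) (-c) z = -height τ c z := by
  simp only [height, map_neg, mul_neg, neg_im]; ring

namespace Placement

lemma step_step (s : Placement) (i : Fin 3) : (s.step α β i).step α β i = s := by
  obtain ⟨σ, θ, b⟩ := s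
  fin_cases i <;> simp [step]

lemma run_reverse (s : Placement) (L : List (Fin 3)) :
    (s.run α β L).run α β L.reverse = s := by
  induction L generalizing s with
  | nil => rfl
  | cons i L ih => rw [run_cons, List.reverse_cons, run_append, ih, run_cons, step_step, run_nil]

lemma run_fanZero (s : Placement) (j : ℕ) :
    s.run α β (fanZero j) = ⟨s.σ, s.θ + s.σ * (2 * j * α), s.base⟩ := by
  induction j generalizing s with
  | zero => simp [fanZero]
  | succ j ih =>
    rw [fanZero, run_cons, run_cons, ih]
    simp only [step, neg_neg, Nat.cast_succ]
    ring_nf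

lemma run_fanOne (s : Placement) (j : ℕ) :
    s.run α β (fanOne j) = ⟨s.σ, s.θ - s.σ * (2 * j * β),
      s.base + cis s.θ - cis (s.θ - s.σ * (2 * j * β))⟩ := by
  induction j generalizing s with
  | zero => simp [fanOne]
  | succ j ih =>
    rw [fanOne, run_cons, run_cons, ih]
    have : s.θ - 2 * s.σ * β - s.σ * (2 * j * β) = s.θ - s.σ * (2 * (j + 1) * β) := by ring
    simp only [step, neg_neg, Nat.cast_succ, this, sub_add_cancel]

/-- The image of a placement under the rigid motion `z ↦ cis ω * z + w`. -/
noncomputable def move (ω : ℝ) (w : ℂ) (s : Placement) : Placement :=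
  ⟨s.σ, s.θ + ω, cis ω * s.base + w⟩

lemma step_move (ω : ℝ) (w : ℂ) (s : Placement) (i : Fin 3) :
    (s.move ω w).step α β i = (s.step α β i).move ω w := by
  fin_cases i <;> simp only [step, move, mk.injEq, true_and, and_true]
  · have h : s.θ + ω - 2 * s.σ * β = s.θ - 2 * s.σ * β + ω := by ring
    refine ⟨h, ?_⟩
    rw [h, cis_add, cis_add]
    ring
  · ring

lemma run_move (ω : ℝ) (w : ℂ) (s : Placement) (L : List (Fin 3)) :
    (s.move ω w).run α β L = (s.run α β L).move ω w := by
  induction L generalizing s with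
  | nil => rfl
  | cons i L ih => rw [run_cons, step_move, ih, run_cons]

lemma vertex_move (ω : ℝ) (w : ℂ) (s : Placement) (i : Fin 3) :
    (s.move ω w).vertex α β i = cis ω * s.vertex α β i + w := by
  have h : s.θ + ω + s.σ * α = ω + (s.θ + s.σ * α) := by ring
  fin_cases i <;> simp [vertex, move]
  · rw [add_comm s.θ, cis_add]; ring
  · rw [h, cis_add ω]; ring

/-- Seen from the other end of the long side, the obtuse vertex is on the other leg. -/
lemma vertex_two_eq (h : Real.sin (α + β) ≠ 0) {s : Placement} (hs : s.σ ^ 2 = 1) :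
    s.vertex α β 2 = s.base + cis s.θ - legLength β α * cis (s.θ - s.σ * β) := by
  have key := legLength_mul_cis h
  have key' := congrArg conj key
  simp only [map_mul, map_sub, conj_cis, conj_ofReal, map_one, neg_neg] at key'
  change s.base + legLength α β * cis (s.θ + s.σ * α) = _
  rw [sub_eq_add_neg s.θ]
  rcases eq_one_or_neg_one_of_sq hs with h | h <;> rw [h] <;>
    simp only [one_mul, neg_one_mul, neg_neg, cis_add s.θ]
  · linear_combination cis s.θ * key
  · linear_combination cis s.θ * key'

end Placement

lemma Exits.step_neg (h : Real.sin (α + β) ≠ 0) {s : Placement} (hs : s.σ ^ 2 = 1) {i : Fin 3}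
    (hi : Exits α β τ c s i) : Exits α β (-τ) (-c) (s.step α β i) i := by
  rw [Exits, Placement.step_σ, height_neg, height_neg, (Placement.vertex_step h hs i).1,
    (Placement.vertex_step h hs i).2, neg_mul_neg, neg_mul_neg]
  exact hi

/-- A line that crosses an unfolding also crosses the reversed unfolding, in the opposite
direction. -/
lemma Crosses.reverse (h : Real.sin (α + β) ≠ 0) {s : Placement} (hs : s.σ ^ 2 = 1)
    {L : List (Fin 3)} (hL : Crosses α β τ c s L) :
    Crosses α β (-τ) (-c) (s.run α β L) L.reverse := by
  induction L generalizing s with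
  | nil => trivial
  | cons i L ih =>
    rw [List.reverse_cons]
    refine (ih (Placement.step_σ_sq hs i) hL.2).append ?_
    rw [Placement.run_reverse]
    exact ⟨hL.1.step_neg h hs, trivial⟩

lemma height_move (ω : ℝ) (w z : ℂ) :
    height τ c (cis ω * z + w) = height (cis (-ω) * τ) (c - (w * conj τ).im) z := by
  rw [height_add, height, height, map_mul, conj_cis, neg_neg,
    show cis ω * z * conj τ = z * (cis ω * conj τ) by ring]
  ring

lemma crosses_move (ω : ℝ) (w : ℂ) {s : Placement} {L : List (Fin 3)}
    (hL : Crosses α β (cis (-ω) * τ) (c - (w * conj τ).im) s L) :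
    Crosses α β τ c (s.move ω w) L := by
  induction L generalizing s with
  | nil => trivial
  | cons i L ih =>
    refine ⟨?_, ?_⟩
    · rw [Exits, Placement.vertex_move, Placement.vertex_move, height_move, height_move]
      exact hL.1
    · rw [Placement.step_move]
      exact ih hL.2

/-- Between two rays from `P` at an angle less than `π`, the points at distance `r` from `P` are
beyond the line through the two end points, so they are beyond any line that separates these from
`P`. -/
lemma height_ray_neg {P : ℂ} {r κ φ₀ φ₁ φ : ℝ} (hP : 0 < κ * height τ c P)
    (h₀ : κ * height τ c (P + r * cis φ₀) < 0) (h₁ : κ * height τ c (P + r * cis φ₁) < 0)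
    (hφ₀ : φ₀ ≤ φ) (hφ₁ : φ ≤ φ₁) (hπ : φ₁ - φ₀ < Real.pi) :
    κ * height τ c (P + r * cis φ) < 0 := by
  rcases hφ₀.eq_or_lt with rfl | h0
  · exact h₀
  rcases hφ₁.eq_or_lt with rfl | h1
  · exact h₁
  have hs : 0 < Real.sin (φ₁ - φ₀) := Real.sin_pos_of_pos_of_lt_pi (by linarith) hπ
  have hs0 : 0 < Real.sin (φ₁ - φ) := Real.sin_pos_of_pos_of_lt_pi (by linarith) (by linarith)
  have hs1 : 0 < Real.sin (φ - φ₀) := Real.sin_pos_of_pos_of_lt_pi (by linarith) (by linarith)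
  have hsum : Real.sin (φ₁ - φ₀) ≤ Real.sin (φ₁ - φ) + Real.sin (φ - φ₀) := by
    rw [show φ₁ - φ₀ = (φ₁ - φ) + (φ - φ₀) by ring, Real.sin_add]
    have e1 := Real.cos_le_one (φ - φ₀)
    have e2 := Real.cos_le_one (φ₁ - φ)
    nlinarith
  have hlin : Real.sin (φ₁ - φ₀) * (r * cis φ * conj τ).im =
      Real.sin (φ₁ - φ) * (r * cis φ₀ * conj τ).im +
        Real.sin (φ - φ₀) * (r * cis φ₁ * conj τ).im := by
    simp only [mul_re, mul_im, ofReal_re, ofReal_im, cis_re, cis_im, Real.sin_sub]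
    ring
  rw [height_add] at h₀ h₁ ⊢
  set k := height τ c P
  by_contra hcon
  push Not at hcon
  have a0 : Real.sin (φ₁ - φ) * (κ * (k + (r * cis φ₀ * conj τ).im)) < 0 :=
    mul_neg_of_pos_of_neg hs0 h₀
  have a1 : Real.sin (φ - φ₀) * (κ * (k + (r * cis φ₁ * conj τ).im)) < 0 :=
    mul_neg_of_pos_of_neg hs1 h₁
  have a2 := mul_nonneg hs.le hcon
  have a3 := mul_le_mul_of_nonneg_right hsum hP.le
  have a4 : Real.sin (φ₁ - φ₀) * (κ * (k + (r * cis φ * conj τ).im)) =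
      Real.sin (φ₁ - φ₀) * (κ * k) + κ * (Real.sin (φ₁ - φ) * (r * cis φ₀ * conj τ).im +
        Real.sin (φ - φ₀) * (r * cis φ₁ * conj τ).im) := by
    rw [← hlin]; ring
  nlinarith

/-- The rays of a fan: if the first and the last one end beyond the line, so do those between. -/
lemma height_fan_neg {P : ℂ} {r κ σ θ a u l t : ℝ} (hσ : σ ^ 2 = 1) (ha : 0 < a)
    (hP : 0 < κ * height τ c P) (h₀ : κ * height τ c (P + r * cis (θ + σ * (u * a))) < 0)
    (h₁ : κ * height τ c (P + r * cis (θ + σ * (l * a))) < 0) (hut : u ≤ t) (htl : t ≤ l)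
    (hπ : (l - u) * a < Real.pi) : κ * height τ c (P + r * cis (θ + σ * (t * a))) < 0 := by
  have h1 : u * a ≤ t * a := mul_le_mul_of_nonneg_right hut ha.le
  have h2 : t * a ≤ l * a := mul_le_mul_of_nonneg_right htl ha.le
  rcases eq_one_or_neg_one_of_sq hσ with rfl | rfl
  · exact height_ray_neg hP h₀ h₁ (by linarith) (by linarith) (by linarith)
  · exact height_ray_neg hP h₁ h₀ (by linarith) (by linarith) (by linarith)

lemma crosses_fanZero_of_forall {s : Placement} {j : ℕ} (hb : 0 < s.σ * height τ c s.base)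
    (hr : ∀ i < j,
      s.σ * height τ c (s.base + legLength α β * cis (s.θ + s.σ * ((2 * i + 1 : ℝ) * α))) < 0 ∧
      s.σ * height τ c (s.base + cis (s.θ + s.σ * ((2 * i + 2 : ℝ) * α))) < 0) :
    Crosses α β τ c s (fanZero j) := by
  induction j generalizing s with
  | zero => trivial
  | succ j ih =>
    have h0 := hr 0 (by omega)
    simp only [Nat.cast_zero, mul_zero, zero_add, one_mul] at h0
    refine ⟨⟨h0.1, hb⟩, ⟨?_, ?_⟩, ih ?_ ?_⟩
    · change -s.σ * height τ c s.base < 0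
      linarith
    · change 0 < -s.σ * height τ c (s.base + cis (s.θ + 2 * s.σ * α))
      rw [show s.θ + 2 * s.σ * α = s.θ + s.σ * (2 * α) by ring]
      linarith
    · simpa [Placement.step] using hb
    · intro i hi
      have := hr (i + 1) (by omega)
      simp only [Placement.step, neg_neg]
      convert this using 6 <;> push_cast <;> ring_nf

lemma crosses_fanOne_of_forall (h : Real.sin (α + β) ≠ 0) {s : Placement} (hs : s.σ ^ 2 = 1)
    {j : ℕ} (hb : 0 < -s.σ * height τ c (s.base + cis s.θ))
    (hr : ∀ i < j,
      -s.σ * height τ c (s.base + cis s.θ +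
        (-legLength β α : ℝ) * cis (s.θ + -s.σ * ((2 * i + 1 : ℝ) * β))) < 0 ∧
      -s.σ * height τ c (s.base + cis s.θ +
        (-1 : ℝ) * cis (s.θ + -s.σ * ((2 * i + 2 : ℝ) * β))) < 0) :
    Crosses α β τ c s (fanOne j) := by
  induction j generalizing s with
  | zero => trivial
  | succ j ih =>
    have h0 := hr 0 (by omega)
    simp only [Nat.cast_zero, mul_zero, zero_add, one_mul] at h0
    have hv : s.vertex α β 2 = s.base + cis s.θ +
        (-legLength β α : ℝ) * cis (s.θ + -s.σ * β) := by
      rw [Placement.vertex_two_eq h hs]; push_cast; ring_nf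
    have hbase : (((s.step α β 0).step α β 2).base + cis ((s.step α β 0).step α β 2).θ) =
        s.base + cis s.θ := by simp [Placement.step]
    refine ⟨⟨?_, ?_⟩, ⟨?_, ?_⟩, ih ?_ ?_ ?_⟩
    · change s.σ * height τ c (s.base + cis s.θ) < 0
      linarith
    · change 0 < s.σ * height τ c (s.vertex α β 2)
      rw [hv]; linarith
    · change -s.σ * height τ c (s.base + cis s.θ - cis (s.θ - 2 * s.σ * β)) < 0
      convert h0.2 using 3
      push_cast
      ring_nf
    · change 0 < -s.σ * height τ c (s.base + cis s.θ - cis (s.θ - 2 * s.σ * β) +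
        cis (s.θ - 2 * s.σ * β))
      rwa [sub_add_cancel]
    · exact Placement.step_σ_sq (Placement.step_σ_sq hs 0) 2
    · rw [hbase]; simpa [Placement.step] using hb
    · intro i hi
      have := hr (i + 1) (by omega)
      rw [hbase]
      simp only [Placement.step, neg_neg]
      convert this using 6 <;> push_cast <;> ring_nf

/-- A line crosses the fan about vertex `0` if it separates this vertex from the first and last
ends of the short and of the long rays. -/
lemma crosses_fanZero {s : Placement} (hs : s.σ ^ 2 = 1) (hα : 0 < α) {j : ℕ} (k l : ℝ)
    (hk : 2 * j - 1 ≤ k) (hkπ : (k - 1) * α < Real.pi) (hl : 2 * j ≤ l)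
    (hlπ : (l - 2) * α < Real.pi) (hb : 0 < s.σ * height τ c s.base)
    (h₁ : s.σ * height τ c (s.base + legLength α β * cis (s.θ + s.σ * (1 * α))) < 0)
    (h₁' : s.σ * height τ c (s.base + legLength α β * cis (s.θ + s.σ * (k * α))) < 0)
    (h₂ : s.σ * height τ c (s.base + cis (s.θ + s.σ * (2 * α))) < 0)
    (h₂' : s.σ * height τ c (s.base + cis (s.θ + s.σ * (l * α))) < 0) :
    Crosses α β τ c s (fanZero j) := by
  refine crosses_fanZero_of_forall hb fun i hi => ?_
  have hi' : (i : ℝ) + 1 ≤ j := by exact_mod_cast hi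
  have hi0 : (0 : ℝ) ≤ i := Nat.cast_nonneg i
  refine ⟨height_fan_neg hs hα hb h₁ h₁' (by linarith) (by linarith) hkπ, ?_⟩
  have := height_fan_neg (r := 1) (t := 2 * i + 2) hs hα hb (by simpa using h₂)
    (by simpa using h₂') (by linarith) (by linarith) hlπ
  simpa using this

/-- A line crosses the fan about vertex `1` if it separates this vertex from the first and last
ends of the short and of the long rays. -/
lemma crosses_fanOne (h : Real.sin (α + β) ≠ 0) {s : Placement} (hs : s.σ ^ 2 = 1) (hβ : 0 < β)
    {j : ℕ} (k l : ℝ) (hk : 2 * j - 1 ≤ k) (hkπ : (k - 1) * β < Real.pi) (hl : 2 * j ≤ l)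
    (hlπ : (l - 2) * β < Real.pi) (hb : s.σ * height τ c (s.base + cis s.θ) < 0)
    (h₁ : 0 < s.σ * height τ c (s.base + cis s.θ - legLength β α * cis (s.θ - s.σ * (1 * β))))
    (h₁' : 0 < s.σ * height τ c (s.base + cis s.θ - legLength β α * cis (s.θ - s.σ * (k * β))))
    (h₂ : 0 < s.σ * height τ c (s.base + cis s.θ - cis (s.θ - s.σ * (2 * β))))
    (h₂' : 0 < s.σ * height τ c (s.base + cis s.θ - cis (s.θ - s.σ * (l * β)))) :
    Crosses α β τ c s (fanOne j) := by
  have hb' : 0 < -s.σ * height τ c (s.base + cis s.θ) := by linarith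
  have hs' : (-s.σ) ^ 2 = 1 := by rwa [neg_sq]
  have conv : ∀ r t : ℝ, 0 < s.σ * height τ c (s.base + cis s.θ - r * cis (s.θ - s.σ * (t * β))) →
      -s.σ * height τ c (s.base + cis s.θ + (-r : ℝ) * cis (s.θ + -s.σ * (t * β))) < 0 := by
    intro r t h
    rw [show s.θ + -s.σ * (t * β) = s.θ - s.σ * (t * β) by ring, ofReal_neg, neg_mul (r : ℂ),
      ← sub_eq_add_neg]
    linarith
  refine crosses_fanOne_of_forall h hs hb' fun i hi => ?_
  have hi' : (i : ℝ) + 1 ≤ j := by exact_mod_cast hi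
  have hi0 : (0 : ℝ) ≤ i := Nat.cast_nonneg i
  exact ⟨height_fan_neg hs' hβ hb' (conv _ _ h₁) (conv _ _ h₁') (by linarith) (by linarith) hkπ,
    height_fan_neg hs' hβ hb' (conv 1 2 (by simpa using h₂)) (conv 1 l (by simpa using h₂'))
      (by linarith) (by linarith) hlπ⟩

/-- A word that turns about a vertex `0` by `2 n α`, follows `K`, turns about another vertex `0` and
returns along `K`. -/
def pretzel (n : ℕ) (K : List (Fin 3)) : List (Fin 3) :=
  K ++ (fanZero n).reverse ++ K.reverse ++ fanZero n

lemma pretzel_ne_nil {n : ℕ} (hn : n ≠ 0) (K : List (Fin 3)) : pretzel n K ≠ [] := by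
  obtain ⟨m, rfl⟩ := Nat.exists_eq_succ_of_ne_zero hn
  simp [pretzel, fanZero]

lemma crosses_shift {T : ℂ} {s : Placement} {L : List (Fin 3)} (hT : (T * conj τ).im = 0)
    (hL : Crosses α β τ c s L) : Crosses α β τ c (s.shift T) L := by
  have : s.shift T = s.move 0 T := by simp [Placement.shift, Placement.move, cis_zero]
  rw [this]
  apply crosses_move
  simpa [cis_zero, hT] using hL

/-- The return along `K` is the first passage, turned about the vertex `0` where `K` ends. So a line
crosses the unfolding of the pretzel word if it crosses both fans, and if two lines cross `K`: this
line, and the one that the turn carries to it. -/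
theorem mem_orbitTile_pretzel {x : EuclideanSpace ℝ (Fin 2)} (hx : x ∈ parameterSpace) {n : ℕ}
    (hn : n ≠ 0) {K : List (Fin 3)} {θ : ℝ} {D T : ℂ}
    (hK : (⟨1, 0, 0⟩ : Placement).run (x 0) (x 1) K = ⟨1, θ, D⟩)
    (hT : T = D - cis (-(2 * n * x 0)) * D)
    (h₁ : Crosses (x 0) (x 1) T c ⟨1, 0, 0⟩ K)
    (h₂ : Crosses (x 0) (x 1) (-(cis (2 * n * x 0) * T)) (-c) ⟨1, 0, 0⟩ K)
    (h₃ : Crosses (x 0) (x 1) (-T) (-c) ⟨1, θ - 2 * n * x 0, D⟩ (fanZero n))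
    (h₄ : Crosses (x 0) (x 1) T c ⟨1, -(2 * n * x 0), 0⟩ (fanZero n)) :
    x ∈ orbitTile (PeriodicWord.ofList (pretzel n K) (pretzel_ne_nil hn K)) := by
  have h01 := (sin_add_pos_of_mem hx).ne'
  have hTT : (T * conj T).im = 0 := by rw [mul_conj, ofReal_im]
  have one_sq' : (1 : ℝ) ^ 2 = 1 := one_pow 2
  have hfan : (⟨1, θ - 2 * n * x 0, D⟩ : Placement).run (x 0) (x 1) (fanZero n) = ⟨1, θ, D⟩ := by
    rw [Placement.run_fanZero]
    simp
  have hmove : (⟨1, θ - 2 * n * x 0, D⟩ : Placement) =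
      (⟨1, θ, D⟩ : Placement).move (-(2 * n * x 0)) T := by
    simp only [Placement.move, hT, sub_eq_add_neg θ]
    congr 1
    ring
  have hrun1 : (⟨1, 0, 0⟩ : Placement).run (x 0) (x 1) (K ++ (fanZero n).reverse) =
      (⟨1, θ, D⟩ : Placement).move (-(2 * n * x 0)) T := by
    have := Placement.run_reverse (α := x 0) (β := x 1) ⟨1, θ - 2 * n * x 0, D⟩ (fanZero n)
    rw [hfan] at this
    rw [Placement.run_append, hK, this, hmove]
  have hrun2 : (⟨1, 0, 0⟩ : Placement).run (x 0) (x 1) (K ++ (fanZero n).reverse ++ K.reverse) =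
      (⟨1, -(2 * n * x 0), 0⟩ : Placement).shift T := by
    rw [Placement.run_append, hrun1, Placement.run_move, ← hK, Placement.run_reverse]
    simp [Placement.move, Placement.shift]
  refine mem_orbitTile_of_crosses hx _ (s := ⟨1, 0, 0⟩) (τ := T) (c := c) one_sq' ?_ ?_
  · rw [pretzel, Placement.run_append, hrun2, Placement.run_fanZero]
    simp [Placement.shift]
  · refine ((h₁.append ?_).append ?_).append ?_
    · have := h₃.reverse h01 one_sq'
      rw [neg_neg, neg_neg, hfan] at this
      rwa [hK]
    · rw [hrun1]
      apply crosses_move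
      have := h₂.reverse h01 one_sq'
      rw [neg_neg, neg_neg, hK] at this
      rwa [neg_neg, hTT, sub_zero]
    · rw [hrun2]
      exact crosses_shift hTT h₄

/-- A fan about vertex `1` after `J` turns the last triangle of `J` about the pivot `G`. -/
lemma run_append_fanOne {n : ℕ} {J : List (Fin 3)} {θ : ℝ} {b G D : ℂ}
    (hJ : (⟨1, 0, 0⟩ : Placement).run α β J = ⟨-1, θ, b⟩) (hG : G = b + cis θ)
    (hD : D = G - cis (2 * n * β) * G) :
    (⟨1, 0, 0⟩ : Placement).run α β (J ++ fanOne n) =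
      (⟨-1, θ, b⟩ : Placement).move (2 * n * β) D := by
  rw [Placement.run_append, hJ, Placement.run_fanOne]
  simp only [Placement.move, neg_one_mul, sub_neg_eq_add, hD, hG, cis_add]
  congr 1
  ring

lemma run_append_fanOne_reverse {n : ℕ} {J : List (Fin 3)} {θ : ℝ} {b G D : ℂ}
    (hJ : (⟨1, 0, 0⟩ : Placement).run α β J = ⟨-1, θ, b⟩) (hG : G = b + cis θ)
    (hD : D = G - cis (2 * n * β) * G) :
    (⟨1, 0, 0⟩ : Placement).run α β (J ++ fanOne n ++ J.reverse) = ⟨1, 2 * n * β, D⟩ := by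
  rw [Placement.run_append, run_append_fanOne hJ hG hD, Placement.run_move, ← hJ,
    Placement.run_reverse]
  simp [Placement.move]

/-- The unfolding along `J`, a fan about vertex `1` and `J` reversed is symmetric under a turn about
the pivot of the fan. So a line crosses it if the line crosses the fan, and if the line and the one
that the turn carries to it cross `J`. -/
theorem crosses_append_fanOne_reverse (h : Real.sin (α + β) ≠ 0) {n : ℕ} {J : List (Fin 3)} {θ : ℝ}
    {b G D : ℂ} (hJ : (⟨1, 0, 0⟩ : Placement).run α β J = ⟨-1, θ, b⟩) (hG : G = b + cis θ)
    (hD : D = G - cis (2 * n * β) * G) (h₁ : Crosses α β τ c ⟨1, 0, 0⟩ J)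
    (h₂ : Crosses α β (-(cis (-(2 * n * β)) * τ)) (-(c - (D * conj τ).im)) ⟨1, 0, 0⟩ J)
    (h₃ : Crosses α β τ c ⟨-1, θ, b⟩ (fanOne n)) :
    Crosses α β τ c ⟨1, 0, 0⟩ (J ++ fanOne n ++ J.reverse) := by
  refine (h₁.append (by rwa [hJ])).append ?_
  rw [run_append_fanOne hJ hG hD]
  apply crosses_move
  have := h₂.reverse h (one_pow 2)
  rwa [neg_neg, neg_neg, hJ] at this

/-! ### Fans with two signs, and the pivots of the words -/

section Fans

variable {α β θ : ℝ} {τ b V : ℂ} {c : ℝ} {j : ℕ}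

lemma crosses_fanZero_of_above (hα : 0 < α) (k l : ℝ)
    (hk : 2 * j - 1 ≤ k) (hkπ : (k - 1) * α < Real.pi) (hl : 2 * j ≤ l)
    (hlπ : (l - 2) * α < Real.pi) (hb : 0 < height τ c b)
    (h₁ : height τ c (b + legLength α β * cis (θ + α)) < 0)
    (h₁' : height τ c (b + legLength α β * cis (θ + k * α)) < 0)
    (h₂ : height τ c (b + cis (θ + 2 * α)) < 0)
    (h₂' : height τ c (b + cis (θ + l * α)) < 0) :
    Crosses α β τ c ⟨1, θ, b⟩ (fanZero j) :=
  crosses_fanZero (one_pow 2) hα k l hk hkπ hl hlπ (by simpa using hb) (by simpa using h₁)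
    (by simpa using h₁') (by simpa using h₂) (by simpa using h₂')

lemma crosses_fanZero_of_below (hα : 0 < α) (k l : ℝ)
    (hk : 2 * j - 1 ≤ k) (hkπ : (k - 1) * α < Real.pi) (hl : 2 * j ≤ l)
    (hlπ : (l - 2) * α < Real.pi) (hb : height τ c b < 0)
    (h₁ : 0 < height τ c (b + legLength α β * cis (θ - α)))
    (h₁' : 0 < height τ c (b + legLength α β * cis (θ - k * α)))
    (h₂ : 0 < height τ c (b + cis (θ - 2 * α)))
    (h₂' : 0 < height τ c (b + cis (θ - l * α))) :
    Crosses α β τ c ⟨-1, θ, b⟩ (fanZero j) :=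
  crosses_fanZero (by norm_num) hα k l hk hkπ hl hlπ (by simpa using hb)
    (by simpa [← sub_eq_add_neg] using h₁) (by simpa [← sub_eq_add_neg] using h₁')
    (by simpa [← sub_eq_add_neg] using h₂) (by simpa [← sub_eq_add_neg] using h₂')

lemma crosses_fanOne_of_below (h : Real.sin (α + β) ≠ 0) (hβ : 0 < β) (k l : ℝ)
    (hk : 2 * j - 1 ≤ k) (hkπ : (k - 1) * β < Real.pi) (hl : 2 * j ≤ l)
    (hlπ : (l - 2) * β < Real.pi) (hV : V = b + cis θ) (hb : height τ c V < 0)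
    (h₁ : 0 < height τ c (V - legLength β α * cis (θ - β)))
    (h₁' : 0 < height τ c (V - legLength β α * cis (θ - k * β)))
    (h₂ : 0 < height τ c (V - cis (θ - 2 * β)))
    (h₂' : 0 < height τ c (V - cis (θ - l * β))) :
    Crosses α β τ c ⟨1, θ, b⟩ (fanOne j) := by
  subst hV
  exact crosses_fanOne h (one_pow 2) hβ k l hk hkπ hl hlπ (by simpa using hb) (by simpa using h₁)
    (by simpa using h₁') (by simpa using h₂) (by simpa using h₂')

lemma crosses_fanOne_of_above (h : Real.sin (α + β) ≠ 0) (hβ : 0 < β) (k l : ℝ)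
    (hk : 2 * j - 1 ≤ k) (hkπ : (k - 1) * β < Real.pi) (hl : 2 * j ≤ l)
    (hlπ : (l - 2) * β < Real.pi) (hV : V = b + cis θ) (hb : 0 < height τ c V)
    (h₁ : height τ c (V - legLength β α * cis (θ + β)) < 0)
    (h₁' : height τ c (V - legLength β α * cis (θ + k * β)) < 0)
    (h₂ : height τ c (V - cis (θ + 2 * β)) < 0)
    (h₂' : height τ c (V - cis (θ + l * β)) < 0) :
    Crosses α β τ c ⟨-1, θ, b⟩ (fanOne j) := by
  subst hV
  exact crosses_fanOne h (by norm_num) hβ k l hk hkπ hl hlπ (by simpa using hb)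
    (by simpa using h₁) (by simpa using h₁') (by simpa using h₂) (by simpa using h₂')

end Fans

/-- The long sides that join the successive pivots of the unfolding along the core words, for small
angles `α`, `β`. -/
noncomputable def edge (n α β : ℝ) : ℕ → ℂ
  | 0 => 1
  | 1 => -cis (-((2 * n - 2) * β))
  | 2 => cis ((2 * n - 2) * (α - β))
  | 3 => -cis ((2 * n - 2) * α + 2 * β)
  | 4 => cis (2 * β)
  | 5 => -cis ((2 * n - 2) * β)
  | 6 => cis ((2 * n - 2) * β - (2 * n - 6) * α)
  | 7 => -cis ((4 * n - 8) * β - (2 * n - 6) * α)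
  | 8 => cis ((4 * n - 8) * β - (4 * n - 10) * α)
  | 9 => -cis ((6 * n - 10) * β - (4 * n - 10) * α)
  | _ => 0

/-- The pivots of the unfolding along the core words; the first one is the origin. -/
noncomputable def joint (n α β : ℝ) (k : ℕ) : ℂ := ∑ i ∈ Finset.range k, edge n α β i

lemma joint_succ (n α β : ℝ) (k : ℕ) : joint n α β (k + 1) = joint n α β k + edge n α β k :=
  Finset.sum_range_succ _ _

lemma joint_one (n α β : ℝ) : joint n α β 1 = 1 := by simp [joint, edge]

section Continuity

variable {X : Type*} [TopologicalSpace X] {x₀ : X}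

@[fun_prop]
lemma ContinuousAt.cis {θ : X → ℝ} (h : ContinuousAt θ x₀) :
    ContinuousAt (fun x => cis (θ x)) x₀ := continuous_cis.continuousAt.comp h

@[fun_prop]
lemma ContinuousAt.edge {n : ℝ} {α β : X → ℝ} {k : ℕ} (hα : ContinuousAt α x₀)
    (hβ : ContinuousAt β x₀) : ContinuousAt (fun x => edge n (α x) (β x) k) x₀ := by
  rcases k with _ | _ | _ | _ | _ | _ | _ | _ | _ | _ | k <;> unfold _root_.edge <;> fun_prop

@[fun_prop]
lemma ContinuousAt.joint {n : ℝ} {α β : X → ℝ} {k : ℕ} (hα : ContinuousAt α x₀)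
    (hβ : ContinuousAt β x₀) : ContinuousAt (fun x => joint n (α x) (β x) k) x₀ := by
  unfold _root_.joint
  fun_prop

@[fun_prop]
lemma ContinuousAt.height {τ z : X → ℂ} {c : X → ℝ} (hτ : ContinuousAt τ x₀)
    (hc : ContinuousAt c x₀) (hz : ContinuousAt z x₀) :
    ContinuousAt (fun x => height (τ x) (c x) (z x)) x₀ := by
  unfold _root_.height
  exact (Complex.continuous_im.continuousAt.comp
    (hz.mul (Complex.continuous_conj.continuousAt.comp hτ))).sub hc

end Continuity

/-- The core of the first word: two fans, and the short side where the second one ends. -/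
def coreOne (n : ℕ) : List (Fin 3) := fanOne (n - 1) ++ (fanZero (n - 2) ++ [1])

lemma run_coreOne_fanOne {n : ℕ} (hn : 4 ≤ n) (α β : ℝ) :
    (⟨1, 0, 0⟩ : Placement).run α β (fanOne (n - 1)) =
      ⟨1, -((2 * n - 2) * β), joint n α β 2⟩ := by
  have h1 : ((n - 1 : ℕ) : ℝ) = n - 1 := by rw [Nat.cast_sub (by omega)]; simp
  rw [Placement.run_fanOne, h1, joint_succ, joint_one]
  simp only [cis_zero, zero_add, zero_sub, one_mul, edge, ← sub_eq_add_neg]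
  ring_nf

lemma run_coreOne {n : ℕ} (hn : 4 ≤ n) (α β : ℝ) :
    (⟨1, 0, 0⟩ : Placement).run α β (coreOne n) =
      ⟨-1, (2 * n - 2) * (α - β), joint n α β 2⟩ := by
  have h2 : ((n - 2 : ℕ) : ℝ) = n - 2 := by rw [Nat.cast_sub (by omega)]; simp
  rw [coreOne, Placement.run_append, Placement.run_append, run_coreOne_fanOne hn,
    Placement.run_fanZero, h2]
  simp only [Placement.run_cons, Placement.run_nil, Placement.step]
  ring_nf

/-! ### Lines near a base line -/

/-- The obtuse vertex next to the pivot `joint 2`, where the core of the first word ends. -/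
noncomputable def apexOne (n α β : ℝ) : ℂ :=
  joint n α β 2 + legLength α β * cis ((2 * n - 3) * α - (2 * n - 2) * β)

lemma crosses_coreOne {n : ℕ} (hn : 4 ≤ n) {α β c : ℝ} {τ : ℂ} (h : Real.sin (α + β) ≠ 0)
    (hα : 0 < α) (hβ : 0 < β) (hαπ : (2 * n - 2) * α < Real.pi) (hβπ : (2 * n - 2) * β < Real.pi)
    (h₁ : height τ c 1 < 0)
    (h₂ : 0 < height τ c (1 - legLength β α * cis (-β)))
    (h₃ : 0 < height τ c (1 - legLength β α * cis (-((2 * n - 3) * β))))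
    (h₄ : 0 < height τ c (1 - cis (-(2 * β))))
    (h₅ : 0 < height τ c (joint n α β 2))
    (h₆ : height τ c (joint n α β 2 + legLength α β * cis (-((2 * n - 2) * β) + α)) < 0)
    (h₇ : height τ c (apexOne n α β) < 0)
    (h₈ : height τ c (joint n α β 2 + cis (-((2 * n - 2) * β) + 2 * α)) < 0)
    (h₉ : height τ c (joint n α β 2 + cis (-((2 * n - 2) * β) + (2 * n - 4) * α)) < 0) :
    Crosses α β τ c ⟨1, 0, 0⟩ (coreOne n) := by
  have c1 : ((n - 1 : ℕ) : ℝ) = n - 1 := by rw [Nat.cast_sub (by omega)]; simp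
  have c2 : ((n - 2 : ℕ) : ℝ) = n - 2 := by rw [Nat.cast_sub (by omega)]; simp
  have hap : joint n α β 2 + legLength α β * cis (-((2 * n - 2) * β) + (2 * n - 3) * α) =
      apexOne n α β := by rw [apexOne]; ring_nf
  refine Crosses.append ?_ (Crosses.append ?_ ?_)
  · refine crosses_fanOne_of_below (V := 1) h hβ (2 * n - 3) (2 * n - 2) (by rw [c1]; linarith)
      (by linarith) (by rw [c1]; linarith) (by linarith) (by simp [cis_zero]) h₁ ?_ ?_ ?_ ?_
    · rwa [zero_sub]
    · rwa [zero_sub]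
    · rwa [zero_sub]
    · rw [zero_sub]
      rw [joint_succ, joint_one] at h₅
      exact h₅
  · rw [run_coreOne_fanOne hn]
    refine crosses_fanZero_of_above hα (2 * n - 3) (2 * n - 4) (by rw [c2]; linarith)
      (by linarith) (by rw [c2]; linarith) (by linarith) h₅ h₆ (by rwa [hap]) h₈ h₉
  · rw [run_coreOne_fanOne hn, Placement.run_fanZero, c2]
    refine ⟨⟨?_, ?_⟩, trivial⟩
    · change 1 * height τ c (joint n α β 2 + legLength α β *
        cis (-((2 * n - 2) * β) + 1 * (2 * (n - 2) * α) + 1 * α)) < 0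
      rw [one_mul, show -((2 * n - 2) * β) + 1 * (2 * (n - 2) * α) + 1 * α =
        -((2 * n - 2) * β) + (2 * n - 3) * α by ring, hap]
      exact h₇
    · change 0 < 1 * height τ c (joint n α β 2)
      rwa [one_mul]

section Base

variable {X : Type*} [TopologicalSpace X] {x₀ : X}

/-- A family of angles `α`, `β` and lines, continuous at the point `x₀`, where both angles are `b`
and the line goes through the origin in the direction of `S`. -/
structure LinesNear (b : ℝ) (S : ℂ) (x₀ : X) (α β c : X → ℝ) (τ : X → ℂ) : Prop where
  contα : ContinuousAt α x₀
  contβ : ContinuousAt β x₀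
  contc : ContinuousAt c x₀
  contτ : ContinuousAt τ x₀
  α₀ : α x₀ = b
  β₀ : β x₀ = b
  c₀ : c x₀ = 0
  τ₀ : ∃ k : ℝ, 0 < k ∧ τ x₀ = k * S

lemma height_ofReal_mul_left (k : ℝ) (S z : ℂ) : height (k * S) 0 z = k * height S 0 z := by
  simp only [height, map_mul, conj_ofReal, sub_zero]
  rw [mul_left_comm, im_ofReal_mul]

variable {b : ℝ} {S : ℂ} {α β c : X → ℝ} {τ : X → ℂ}

lemma LinesNear.pos (H : LinesNear b S x₀ α β c τ) {z : X → ℂ} (hz : ContinuousAt z x₀)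
    (h : 0 < height S 0 (z x₀)) : ∀ᶠ x in 𝓝 x₀, 0 < height (τ x) (c x) (z x) := by
  have hc : ContinuousAt (fun x => height (τ x) (c x) (z x)) x₀ := H.contτ.height H.contc hz
  refine hc.eventually (lt_mem_nhds ?_)
  obtain ⟨k, hk, hτ⟩ := H.τ₀
  beta_reduce
  rw [hτ, H.c₀, height_ofReal_mul_left]
  exact mul_pos hk h

lemma LinesNear.neg (H : LinesNear b S x₀ α β c τ) {z : X → ℂ} (hz : ContinuousAt z x₀)
    (h : height S 0 (z x₀) < 0) : ∀ᶠ x in 𝓝 x₀, height (τ x) (c x) (z x) < 0 := by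
  have hc : ContinuousAt (fun x => height (τ x) (c x) (z x)) x₀ := H.contτ.height H.contc hz
  refine hc.eventually (gt_mem_nhds ?_)
  obtain ⟨k, hk, hτ⟩ := H.τ₀
  beta_reduce
  rw [hτ, H.c₀, height_ofReal_mul_left]
  exact mul_neg_of_pos_of_neg hk h

lemma LinesNear.contLeg (H : LinesNear b S x₀ α β c τ) (hb : Real.sin (b + b) ≠ 0) :
    ContinuousAt (fun x => legLength (α x) (β x)) x₀ := by
  have h1 := H.contα
  have h2 := H.contβ
  refine ContinuousAt.div (by fun_prop) (by fun_prop) ?_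
  rwa [H.α₀, H.β₀]

lemma LinesNear.contLeg' (H : LinesNear b S x₀ α β c τ) (hb : Real.sin (b + b) ≠ 0) :
    ContinuousAt (fun x => legLength (β x) (α x)) x₀ := by
  have h1 := H.contα
  have h2 := H.contβ
  refine ContinuousAt.div (by fun_prop) (by fun_prop) ?_
  rwa [H.α₀, H.β₀]

lemma height_zero_add (z w : ℂ) : height S 0 (z + w) = height S 0 z + height S 0 w := by
  simp only [height, add_mul, add_im]; ring

lemma height_zero_sub (z w : ℂ) : height S 0 (z - w) = height S 0 z - height S 0 w := by
  simp only [height, sub_mul, sub_im]; ring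

lemma height_zero_neg (z : ℂ) : height S 0 (-z) = -height S 0 z := by
  simp only [height, neg_mul, neg_im]; ring

lemma height_zero_ofReal_mul (r : ℝ) (z : ℂ) : height S 0 (r * z) = r * height S 0 z := by
  simp only [height, mul_assoc, im_ofReal_mul, sub_zero]

lemma height_zero_one : height S 0 1 = height S 0 (cis 0) := by rw [cis_zero]

lemma cis_eq_neg_of_sub {θ φ : ℝ} (h : θ = φ - Real.pi) : cis θ = -cis φ := by
  subst h
  apply Complex.ext <;> simp only [cis_re, cis_im, neg_re, neg_im, Real.cos_sub_pi, Real.sin_sub_pi]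

lemma cis_eq_neg_of_add {θ φ : ℝ} (h : θ = φ + Real.pi) : cis θ = -cis φ := by
  subst h
  apply Complex.ext <;> simp only [cis_re, cis_im, neg_re, neg_im, Real.cos_add_pi, Real.sin_add_pi]

variable {n : ℝ}

lemma edge_one (h : 2 * n * b = Real.pi) : edge n b b 1 = cis (2 * b) := by
  rw [edge, cis_eq_neg_of_sub (φ := 2 * b) (by linear_combination -h), neg_neg]

lemma edge_two : edge n b b 2 = cis 0 := by rw [edge, sub_self, mul_zero]

lemma edge_three (h : 2 * n * b = Real.pi) : edge n b b 3 = cis 0 := by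
  rw [edge, cis_eq_neg_of_add (φ := 0) (by linear_combination h), neg_neg]

lemma edge_four : edge n b b 4 = cis (2 * b) := rfl

lemma edge_five (h : 2 * n * b = Real.pi) : edge n b b 5 = cis (-(2 * b)) := by
  rw [edge, cis_eq_neg_of_add (φ := -(2 * b)) (by linear_combination h), neg_neg]

lemma edge_six : edge n b b 6 = cis (4 * b) := by rw [edge]; ring_nf

lemma edge_seven (h : 2 * n * b = Real.pi) : edge n b b 7 = cis (-(2 * b)) := by
  rw [edge, cis_eq_neg_of_add (φ := -(2 * b)) (by linear_combination h), neg_neg]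

lemma edge_eight : edge n b b 8 = cis (2 * b) := by rw [edge]; ring_nf

lemma edge_nine (h : 2 * n * b = Real.pi) : edge n b b 9 = cis 0 := by
  rw [edge, cis_eq_neg_of_add (φ := 0) (by linear_combination h), neg_neg]

lemma legLength_self (hs : Real.sin b ≠ 0) (hc : Real.cos b ≠ 0) :
    legLength b b * (2 * Real.cos b) = 1 := by
  rw [legLength, ← two_mul, Real.sin_two_mul]
  field_simp

/-- A line crosses the fan about a vertex `Q` near the base line, as soon as it passes `Q` on the
proper side, if the ends of the first and the last rays are clear of the base line. -/
lemma LinesNear.eventually_crosses_star {n : ℕ} (H : LinesNear b S x₀ α β c τ) (hb : 0 < b)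
    (hn : 2 * n * b = Real.pi) (hs : Real.sin (b + b) ≠ 0) {ψ : X → ℝ} {Q : X → ℂ}
    (hψ : ContinuousAt ψ x₀) (hQ : ContinuousAt Q x₀) (hQ₀ : height S 0 (Q x₀) = 0)
    (h₁ : height S 0 (cis (ψ x₀ + b)) < 0) (h₂ : 0 < height S 0 (cis (ψ x₀ - b)))
    (h₃ : height S 0 (cis (ψ x₀ + 2 * b)) < 0) (h₄ : 0 < height S 0 (cis (ψ x₀))) :
    ∀ᶠ x in 𝓝 x₀, 0 < height (τ x) (c x) (Q x) →
      Crosses (α x) (β x) (τ x) (c x) ⟨1, ψ x, Q x⟩ (fanZero n) := by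
  have hr := H.contLeg hs
  have hα := H.contα
  have hl : 0 < legLength b b := by
    have hbπ : b + b ≤ Real.pi := by
      have h1 : n ≠ 0 := by
        rintro rfl
        simp only [Nat.cast_zero, mul_zero, zero_mul] at hn
        exact Real.pi_ne_zero hn.symm
      have h2 : (1 : ℝ) ≤ n := by exact_mod_cast Nat.one_le_iff_ne_zero.2 h1
      nlinarith
    have h5 := Real.sin_nonneg_of_nonneg_of_le_pi (x := b + b) (by linarith) hbπ
    exact div_pos (Real.sin_pos_of_pos_of_lt_pi hb (by linarith))
      (lt_of_le_of_ne h5 hs.symm)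
  have e1 : ∀ᶠ x in 𝓝 x₀, height (τ x) (c x)
      (Q x + legLength (α x) (β x) * cis (ψ x + α x)) < 0 := by
    refine H.neg (by fun_prop) ?_
    rw [height_zero_add, hQ₀, height_zero_ofReal_mul, H.α₀, H.β₀, zero_add]
    exact mul_neg_of_pos_of_neg hl h₁
  have e2 : ∀ᶠ x in 𝓝 x₀, height (τ x) (c x)
      (Q x + legLength (α x) (β x) * cis (ψ x + (2 * n - 1) * α x)) < 0 := by
    refine H.neg (by fun_prop) ?_
    rw [height_zero_add, hQ₀, height_zero_ofReal_mul, H.α₀, H.β₀, zero_add,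
      cis_eq_neg_of_add (φ := ψ x₀ - b) (by linear_combination hn), height_zero_neg]
    exact mul_neg_of_pos_of_neg hl (by linarith)
  have e3 : ∀ᶠ x in 𝓝 x₀, height (τ x) (c x) (Q x + cis (ψ x + 2 * α x)) < 0 := by
    refine H.neg (by fun_prop) ?_
    rw [height_zero_add, hQ₀, H.α₀, zero_add]
    exact h₃
  have e4 : ∀ᶠ x in 𝓝 x₀, height (τ x) (c x) (Q x + cis (ψ x + 2 * n * α x)) < 0 := by
    refine H.neg (by fun_prop) ?_
    rw [height_zero_add, hQ₀, H.α₀, zero_add,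
      cis_eq_neg_of_add (φ := ψ x₀) (by linear_combination hn), height_zero_neg]
    linarith
  have e5 : ∀ᶠ x in 𝓝 x₀, 0 < α x := hα.eventually (lt_mem_nhds (by rwa [H.α₀]))
  have e6 : ∀ᶠ x in 𝓝 x₀, (2 * n - 2) * α x < Real.pi := by
    have : ContinuousAt (fun x => (2 * n - 2) * α x) x₀ := by fun_prop
    exact this.eventually (gt_mem_nhds (by beta_reduce; rw [H.α₀]; linarith))
  filter_upwards [e1, e2, e3, e4, e5, e6] with x h1 h2 h3 h4 h5 h6 hQ
  exact crosses_fanZero_of_above h5 (2 * n - 1) (2 * n) le_rfl (by linarith) le_rfl h6 hQ h1 h2 h3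
    h4

end Base

/-! ### The core of the first word -/

section CoreOne

lemma height_two_add_cis (b θ : ℝ) :
    height (2 + cis (2 * b)) 0 (cis θ) = 2 * Real.sin θ + Real.sin (θ - 2 * b) := by
  simp only [height, map_add, conj_cis, mul_add, add_im, mul_im, cis_re, cis_im, Real.sin_sub,
    Real.cos_neg, Real.sin_neg, map_ofNat, re_ofNat, im_ofNat]
  ring

variable {X : Type*} [TopologicalSpace X] {x₀ : X} {b : ℝ} {α β c : X → ℝ} {τ : X → ℂ}

/-- The number `b` is the angle `π / (2 n)`, where `n` is at least four. -/
structure SmallAngle (n : ℕ) (b : ℝ) : Prop where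
  four_le : 4 ≤ n
  pos : 0 < b
  mul_eq : 2 * n * b = Real.pi

lemma SmallAngle.le {n : ℕ} (h : SmallAngle n b) : 8 * b ≤ Real.pi := by
  have : (4 : ℝ) ≤ n := by exact_mod_cast h.four_le
  rw [← h.mul_eq]
  have := h.pos
  nlinarith

lemma SmallAngle.sin_pos {n : ℕ} (h : SmallAngle n b) {k : ℝ} (hk : 0 < k) (hk' : k ≤ 7) :
    0 < Real.sin (k * b) := by
  have h1 := h.le
  have h2 := h.pos
  exact Real.sin_pos_of_pos_of_lt_pi (by positivity) (by nlinarith)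

lemma SmallAngle.sin_add_ne {n : ℕ} (h : SmallAngle n b) : Real.sin (b + b) ≠ 0 := by
  rw [← two_mul]
  exact (h.sin_pos two_pos (by norm_num)).ne'

lemma SmallAngle.cos_pos {n : ℕ} (h : SmallAngle n b) : 0 < Real.cos b := by
  have h1 := h.le
  have h2 := h.pos
  exact Real.cos_pos_of_mem_Ioo ⟨by linarith, by linarith⟩

lemma SmallAngle.leg_mul {n : ℕ} (h : SmallAngle n b) : legLength b b * (2 * Real.cos b) = 1 :=
  legLength_self (by simpa using (h.sin_pos one_pos (by norm_num)).ne') h.cos_pos.ne'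

lemma SmallAngle.leg_pos {n : ℕ} (h : SmallAngle n b) : 0 < legLength b b := by
  have := h.leg_mul
  have := h.cos_pos
  exact pos_of_mul_pos_left (by linarith) (by positivity : (0:ℝ) ≤ 2 * Real.cos b)

/-- The product formula for sines, divided by `2 cos b`. -/
lemma SmallAngle.leg_mul_sin {n : ℕ} (h : SmallAngle n b) (k : ℝ) :
    legLength b b * Real.sin ((k - 1) * b) + legLength b b * Real.sin ((k + 1) * b) =
      Real.sin (k * b) := by
  have h1 : Real.sin ((k - 1) * b) + Real.sin ((k + 1) * b) =
      2 * Real.cos b * Real.sin (k * b) := by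
    rw [show (k - 1) * b = k * b - b by ring, show (k + 1) * b = k * b + b by ring,
      Real.sin_sub, Real.sin_add]
    ring
  linear_combination legLength b b * h1 + Real.sin (k * b) * h.leg_mul

lemma SmallAngle.eventually {n : ℕ} (h : SmallAngle n b) {S : ℂ}
    (H : LinesNear b S x₀ α β c τ) : ∀ᶠ x in 𝓝 x₀, Real.sin (α x + β x) ≠ 0 ∧ 0 < α x ∧ 0 < β x ∧
      (2 * n - 2) * α x < Real.pi ∧ (2 * n - 2) * β x < Real.pi := by
  have hα := H.contα
  have hβ := H.contβ
  have hn := h.mul_eq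
  have hb := h.pos
  have e1 : ∀ᶠ x in 𝓝 x₀, Real.sin (α x + β x) ≠ 0 := by
    have : ContinuousAt (fun x => Real.sin (α x + β x)) x₀ := by fun_prop
    exact this.eventually_ne (by rw [H.α₀, H.β₀]; exact h.sin_add_ne)
  have e2 : ∀ᶠ x in 𝓝 x₀, 0 < α x := hα.eventually (lt_mem_nhds (by rwa [H.α₀]))
  have e3 : ∀ᶠ x in 𝓝 x₀, 0 < β x := hβ.eventually (lt_mem_nhds (by rwa [H.β₀]))
  have e4 : ∀ᶠ x in 𝓝 x₀, (2 * n - 2) * α x < Real.pi := by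
    have : ContinuousAt (fun x => (2 * n - 2) * α x) x₀ := by fun_prop
    exact this.eventually (gt_mem_nhds (by beta_reduce; rw [H.α₀]; linarith))
  have e5 : ∀ᶠ x in 𝓝 x₀, (2 * n - 2) * β x < Real.pi := by
    have : ContinuousAt (fun x => (2 * n - 2) * β x) x₀ := by fun_prop
    exact this.eventually (gt_mem_nhds (by beta_reduce; rw [H.β₀]; linarith))
  filter_upwards [e1, e2, e3, e4, e5] with x h1 h2 h3 h4 h5 using ⟨h1, h2, h3, h4, h5⟩

@[fun_prop]
lemma ContinuousAt.ofReal_comp {f : X → ℝ} (h : ContinuousAt f x₀) :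
    ContinuousAt (fun x => (f x : ℂ)) x₀ := Complex.continuous_ofReal.continuousAt.comp h

/-- The values of the height over the line through the origin in the direction `2 + cis (2 b)`. -/
lemma heights_two_add_cis (b : ℝ) :
    height (2 + cis (2 * b)) 0 (cis 0) = -Real.sin (2 * b) ∧
    height (2 + cis (2 * b)) 0 (cis b) = Real.sin (1 * b) ∧
    height (2 + cis (2 * b)) 0 (cis (-b)) = -2 * Real.sin (1 * b) - Real.sin (3 * b) ∧
    height (2 + cis (2 * b)) 0 (cis (2 * b)) = 2 * Real.sin (2 * b) ∧
    height (2 + cis (2 * b)) 0 (cis (-(2 * b))) = -2 * Real.sin (2 * b) - Real.sin (4 * b) ∧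
    height (2 + cis (2 * b)) 0 (cis (3 * b)) = 2 * Real.sin (3 * b) + Real.sin (1 * b) ∧
    height (2 + cis (2 * b)) 0 (cis (4 * b)) = 2 * Real.sin (4 * b) + Real.sin (2 * b) := by
  simp only [height_two_add_cis]
  refine ⟨?_, ?_, ?_, ?_, ?_, ?_, ?_⟩
  · simp
  · rw [show b - 2 * b = -b by ring, Real.sin_neg, one_mul]; ring
  · rw [show -b - 2 * b = -(3 * b) by ring, Real.sin_neg, Real.sin_neg, one_mul]; ring
  · simp
  · rw [show -(2 * b) - 2 * b = -(4 * b) by ring, Real.sin_neg, Real.sin_neg]; ring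
  · rw [show 3 * b - 2 * b = 1 * b by ring]
  · rw [show 4 * b - 2 * b = 2 * b by ring]

lemma apexOne_eq (n : ℝ) {α β : ℝ} (h : Real.sin (α + β) ≠ 0) :
    apexOne n α β = joint n α β 3 - legLength β α * cis ((2 * n - 2) * (α - β) + β) := by
  have := Placement.vertex_two_eq h (s := ⟨-1, (2 * n - 2) * (α - β), joint n α β 2⟩)
    (by norm_num)
  change joint n α β 2 + legLength α β * cis ((2 * n - 2) * (α - β) + -1 * α) = _ at this
  rw [apexOne, joint_succ n α β 2, edge,
    show (2 * n - 3) * α - (2 * n - 2) * β = (2 * n - 2) * (α - β) + -1 * α by ring, this]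
  simp only [neg_one_mul, sub_neg_eq_add]

lemma joint_two_base {n : ℝ} (hn : 2 * n * b = Real.pi) :
    joint n b b 2 = cis 0 + cis (2 * b) := by
  rw [joint_succ, joint_one, edge_one hn, cis_zero]

lemma joint_three_base {n : ℝ} (hn : 2 * n * b = Real.pi) :
    joint n b b 3 = cis 0 + cis (2 * b) + cis 0 := by
  rw [joint_succ, joint_two_base hn, edge_two]

lemma height_apexOne {n : ℝ} (hn : 2 * n * b = Real.pi) (S : ℂ) :
    height S 0 (apexOne n b b) = height S 0 (cis 0) + height S 0 (cis (2 * b)) +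
      legLength b b * height S 0 (cis (-b)) := by
  rw [apexOne, joint_two_base hn, show (2 * n - 3) * b - (2 * n - 2) * b = -b by ring]
  simp only [height_zero_add, height_zero_ofReal_mul]

lemma LinesNear.contApexOne {S : ℂ} (H : LinesNear b S x₀ α β c τ) (hb : Real.sin (b + b) ≠ 0)
    (n : ℝ) : ContinuousAt (fun x => apexOne n (α x) (β x)) x₀ := by
  have hr := H.contLeg hb
  have hα := H.contα
  have hβ := H.contβ
  unfold apexOne
  fun_prop

/-- Whether the core of the first word is crossed near the base point is decided by strict
inequalities at the base point, except for the apex next to the last pivot. -/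
lemma LinesNear.eventually_crosses_coreOne {n : ℕ} (h : SmallAngle n b) {S : ℂ}
    (H : LinesNear b S x₀ α β c τ) (h₁ : height S 0 (cis 0) < 0)
    (h₂ : 0 < height S 0 (cis 0) - legLength b b * height S 0 (cis (-b)))
    (h₃ : 0 < height S 0 (cis 0) + legLength b b * height S 0 (cis (3 * b)))
    (h₄ : 0 < height S 0 (cis 0) - height S 0 (cis (-(2 * b))))
    (h₅ : 0 < height S 0 (cis 0) + height S 0 (cis (2 * b)))
    (h₆ : height S 0 (cis 0) + height S 0 (cis (2 * b)) -
      legLength b b * height S 0 (cis (3 * b)) < 0)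
    (h₈ : height S 0 (cis 0) + height S 0 (cis (2 * b)) - height S 0 (cis (4 * b)) < 0)
    (h₉ : height S 0 (cis 0) + height S 0 (cis (2 * b)) + height S 0 (cis (-(2 * b))) < 0) :
    ∀ᶠ x in 𝓝 x₀, height (τ x) (c x) (apexOne n (α x) (β x)) < 0 →
      Crosses (α x) (β x) (τ x) (c x) ⟨1, 0, 0⟩ (coreOne n) := by
  have hr := H.contLeg h.sin_add_ne
  have hr' := H.contLeg' h.sin_add_ne
  have hα := H.contα
  have hβ := H.contβ
  have hn := h.mul_eq
  have e1 := H.neg (z := fun _ => 1) (by fun_prop) (by rwa [height_zero_one])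
  have e2 := H.pos (z := fun x => 1 - legLength (β x) (α x) * cis (-(β x))) (by fun_prop) (by
    rwa [height_zero_sub, height_zero_one, height_zero_ofReal_mul, H.α₀, H.β₀])
  have e3 := H.pos (z := fun x => 1 - legLength (β x) (α x) * cis (-((2 * n - 3) * β x)))
    (by fun_prop) (by
    rwa [height_zero_sub, height_zero_one, height_zero_ofReal_mul, H.α₀, H.β₀,
      cis_eq_neg_of_sub (θ := -((2 * n - 3) * b)) (φ := 3 * b) (by linear_combination -hn),
      height_zero_neg, mul_neg, sub_neg_eq_add])
  have e4 := H.pos (z := fun x => 1 - cis (-(2 * β x))) (by fun_prop) (by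
    rwa [height_zero_sub, height_zero_one, H.β₀])
  have e5 := H.pos (z := fun x => joint n (α x) (β x) 2) (by fun_prop) (by
    rwa [H.α₀, H.β₀, joint_two_base hn, height_zero_add])
  have e6 := H.neg (z := fun x => joint n (α x) (β x) 2 +
      legLength (α x) (β x) * cis (-((2 * n - 2) * β x) + α x)) (by fun_prop) (by
    rwa [H.α₀, H.β₀, joint_two_base hn, height_zero_add, height_zero_add, height_zero_ofReal_mul,
      cis_eq_neg_of_sub (θ := -((2 * n - 2) * b) + b) (φ := 3 * b) (by linear_combination -hn),
      height_zero_neg, mul_neg, ← sub_eq_add_neg])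
  have e8 := H.neg (z := fun x => joint n (α x) (β x) 2 +
      cis (-((2 * n - 2) * β x) + 2 * α x)) (by fun_prop) (by
    rwa [H.α₀, H.β₀, joint_two_base hn, height_zero_add, height_zero_add,
      cis_eq_neg_of_sub (θ := -((2 * n - 2) * b) + 2 * b) (φ := 4 * b) (by linear_combination -hn),
      height_zero_neg, ← sub_eq_add_neg])
  have e9 := H.neg (z := fun x => joint n (α x) (β x) 2 +
      cis (-((2 * n - 2) * β x) + (2 * n - 4) * α x)) (by fun_prop) (by
    rwa [H.α₀, H.β₀, joint_two_base hn, height_zero_add, height_zero_add,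
      show -((2 * n - 2) * b) + (2 * n - 4) * b = -(2 * b) by ring])
  filter_upwards [e1, e2, e3, e4, e5, e6, e8, e9, h.eventually H] with
    x h1 h2 h3 h4 h5 h6 h8 h9 ⟨i1, i2, i3, i4, i5⟩ h7
  exact crosses_coreOne h.four_le i1 i2 i3 i4 i5 h1 h2 h3 h4 h5 h6 h7 h8 h9

/-- Both the core of the first word and the fan after it are crossed near the base point by a line
which passes on the left of the pivot of that fan. -/
lemma LinesNear.eventually_crosses_wordOne {n : ℕ} (h : SmallAngle n b)
    (H : LinesNear b (2 + cis (2 * b)) x₀ α β c τ) :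
    ∀ᶠ x in 𝓝 x₀, Crosses (α x) (β x) (τ x) (c x) ⟨1, 0, 0⟩ (coreOne n) ∧
      (0 < height (τ x) (c x) (joint n (α x) (β x) 3) →
        Crosses (α x) (β x) (τ x) (c x)
          ⟨-1, (2 * n - 2) * (α x - β x), joint n (α x) (β x) 2⟩ (fanOne n)) := by
  have hr := H.contLeg h.sin_add_ne
  have hr' := H.contLeg' h.sin_add_ne
  have hα := H.contα
  have hβ := H.contβ
  have hap := H.contApexOne h.sin_add_ne n
  have hn := h.mul_eq
  obtain ⟨g0, g1, g1', g2, g2', g3, g4⟩ := heights_two_add_cis b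
  have s1 := h.sin_pos one_pos (by norm_num)
  have s2 := h.sin_pos two_pos (by norm_num)
  have s3 := h.sin_pos three_pos (by norm_num)
  have s4 := h.sin_pos four_pos (by norm_num)
  have l1 := mul_pos h.leg_pos s1
  have l3 := mul_pos h.leg_pos s3
  have hs2 : legLength b b * Real.sin (1 * b) + legLength b b * Real.sin (3 * b) =
      Real.sin (2 * b) := by
    have := h.leg_mul_sin 2
    norm_num at this ⊢
    exact this
  have g3₀ : height (2 + cis (2 * b)) 0 (joint n b b 3) = 0 := by
    rw [joint_three_base hn, height_zero_add, height_zero_add, g0, g2]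
    ring
  have ecore := H.eventually_crosses_coreOne h (by rw [g0]; linarith) (by rw [g0, g1']; linarith)
    (by rw [g0, g3]; linarith) (by rw [g0, g2']; linarith) (by rw [g0, g2]; linarith)
    (by rw [g0, g2, g3]; linarith) (by rw [g0, g2, g4]; linarith) (by rw [g0, g2, g2']; linarith)
  have e1 := H.neg (z := fun x => apexOne n (α x) (β x)) hap (by
    rw [H.α₀, H.β₀, height_apexOne hn, g0, g2, g1']; linarith)
  have e2 := H.neg (z := fun x => joint n (α x) (β x) 3 - legLength (β x) (α x) *
      cis ((2 * n - 2) * (α x - β x) + (2 * n - 1) * β x)) (by fun_prop) (by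
    rw [H.α₀, H.β₀, height_zero_sub, g3₀, height_zero_ofReal_mul,
      cis_eq_neg_of_add (θ := (2 * n - 2) * (b - b) + (2 * n - 1) * b) (φ := -b)
        (by linear_combination hn), height_zero_neg, g1']
    linarith)
  have e3 := H.neg (z := fun x => joint n (α x) (β x) 3 -
      cis ((2 * n - 2) * (α x - β x) + 2 * β x)) (by fun_prop) (by
    rw [H.α₀, H.β₀, height_zero_sub, g3₀, show (2 * n - 2) * (b - b) + 2 * b = 2 * b by ring, g2]
    linarith)
  have e4 := H.neg (z := fun x => joint n (α x) (β x) 3 -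
      cis ((2 * n - 2) * (α x - β x) + 2 * n * β x)) (by fun_prop) (by
    rw [H.α₀, H.β₀, height_zero_sub, g3₀,
      cis_eq_neg_of_add (θ := (2 * n - 2) * (b - b) + 2 * n * b) (φ := 0)
        (by linear_combination hn), height_zero_neg, g0]
    linarith)
  filter_upwards [ecore, e1, e2, e3, e4, h.eventually H] with
    x h0 h1 h2 h3 h4 ⟨i1, i2, i3, i4, i5⟩
  refine ⟨h0 h1, fun hpos => ?_⟩
  rw [apexOne_eq _ i1] at h1
  exact crosses_fanOne_of_above i1 i3 (2 * n - 1) (2 * n) le_rfl (by linarith) le_rfl i5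
    (joint_succ _ _ _ _) hpos h1 h2 h3 h4

end CoreOne

/-! ### The first word -/

section WordOne

lemma height_neg_left (S z : ℂ) : height (-S) 0 z = -height S 0 z := by
  simp only [height, map_neg, mul_neg, neg_im, sub_zero]

lemma im_mul_conj_sub_cis_mul (D : ℂ) (Q : ℝ) :
    (D * conj (D - cis (-Q) * D)).im = -(normSq D * Real.sin Q) := by
  simp only [map_sub, map_mul, conj_cis, neg_neg, mul_im, mul_re, sub_re, sub_im, conj_re, conj_im,
    cis_re, cis_im, normSq_apply]
  ring

lemma normSq_sub_cis_mul (g : ℂ) (P : ℝ) :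
    normSq (g - cis P * g) = 2 * normSq g * (1 - Real.cos P) := by
  simp only [mul_im, mul_re, sub_re, sub_im, cis_re, cis_im, normSq_apply]
  linear_combination (g.re ^ 2 + g.im ^ 2) * Real.sin_sq_add_cos_sq P

/-- The pivot `g` of a turn by `P` lies on the left of the middle line of the strip. -/
lemma height_pivot (g : ℂ) (P Q : ℝ) {D T : ℂ} {c : ℝ} (hD : D = g - cis P * g)
    (hT : T = D - cis (-Q) * D) (hc : c = (D * conj T).im / 2) :
    height T c g = normSq g * (Real.sin P * (1 - Real.cos Q)) := by
  have h1 : (D * conj T).im = -(normSq D * Real.sin Q) := by rw [hT, im_mul_conj_sub_cis_mul]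
  rw [height, hc, h1, hD, normSq_sub_cis_mul, hT, hD]
  simp only [map_sub, map_mul, conj_cis, neg_neg, mul_im, mul_re, sub_re, sub_im, conj_re, conj_im,
    cis_re, cis_im, normSq_apply, Real.sin_neg, Real.cos_neg]
  ring

/-- The pivot `g` is also on the left of the line that the turn by `Q` carries to the middle line,
that is, of the line that the way back along the core has to follow. -/
lemma height_pivot' (g : ℂ) (P Q : ℝ) {D T : ℂ} {c : ℝ} (hD : D = g - cis P * g)
    (hT : T = D - cis (-Q) * D) (hc : c = (D * conj T).im / 2) :
    height (-(cis Q * T)) (-c) g = normSq g * (Real.sin P * (1 - Real.cos Q)) := by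
  have h1 : (D * conj T).im = -(normSq D * Real.sin Q) := by rw [hT, im_mul_conj_sub_cis_mul]
  have h2 : -(cis Q * T) = D - cis Q * D := by
    rw [hT]
    linear_combination D * cis_mul_cis_neg Q
  rw [h2, height, hc, h1, hD, normSq_sub_cis_mul]
  simp only [map_sub, map_mul, conj_cis, mul_im, mul_re, sub_re, sub_im, conj_re, conj_im,
    cis_re, cis_im, normSq_apply, Real.sin_neg, Real.cos_neg]
  ring

lemma veechPoint_zero (n : ℕ) : veechPoint n 0 = Real.pi / (2 * n) := by simp [veechPoint]

lemma veechPoint_one (n : ℕ) : veechPoint n 1 = Real.pi / (2 * n) := by simp [veechPoint]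

lemma smallAngle_pi_div {n : ℕ} (hn : 4 ≤ n) : SmallAngle n (Real.pi / (2 * n)) := by
  have : (0 : ℝ) < n := by exact_mod_cast (by omega : 0 < n)
  exact ⟨hn, by positivity, by field_simp⟩

lemma eventually_mem_parameterSpace {n : ℕ} {b : ℝ} (h : SmallAngle n b)
    {x₀ : EuclideanSpace ℝ (Fin 2)} (h0 : x₀ 0 = b) (h1 : x₀ 1 = b) :
    ∀ᶠ x in 𝓝 x₀, x ∈ parameterSpace := by
  have hb := h.pos
  have hπ := h.le
  have c0 : ContinuousAt (fun x : EuclideanSpace ℝ (Fin 2) => x 0) x₀ := by fun_prop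
  have c1 : ContinuousAt (fun x : EuclideanSpace ℝ (Fin 2) => x 1) x₀ := by fun_prop
  filter_upwards [c0.eventually (lt_mem_nhds (a := 0) (by beta_reduce; rwa [h0])),
    c1.eventually (lt_mem_nhds (a := 0) (by beta_reduce; rwa [h1])),
    (c0.add c1).eventually (gt_mem_nhds (a := Real.pi / 2) (by
      rw [Pi.add_apply]; rw [h0, h1]; linarith))] with x i0 i1 i2 using ⟨i0, i1, i2⟩

/-- The pretzel word is realized near the base point, if the middle line passes between the two
pivots of the turns about vertex `0`, and if this line and its image cross the core `K`. -/
theorem LinesNear.eventually_mem_orbitTile_pretzel {n : ℕ} {b : ℝ} (h : SmallAngle n b) {S : ℂ}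
    {x₀ : EuclideanSpace ℝ (Fin 2)} {c : EuclideanSpace ℝ (Fin 2) → ℝ}
    {T : EuclideanSpace ℝ (Fin 2) → ℂ} (H : LinesNear b S x₀ (fun x => x 0) (fun x => x 1) c T)
    (h₀ : height S 0 (cis 0) < 0) (h₁ : 0 < height S 0 (cis b))
    (h₁' : height S 0 (cis (-b)) < 0) (h₂ : 0 < height S 0 (cis (2 * b)))
    {K : List (Fin 3)} (hn : n ≠ 0) {θ : EuclideanSpace ℝ (Fin 2) → ℝ}
    {D : EuclideanSpace ℝ (Fin 2) → ℂ}
    (hθ : ContinuousAt θ x₀) (hD : ContinuousAt D x₀) (hθ₀ : θ x₀ = Real.pi)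
    (hD₀ : height S 0 (D x₀) = 0)
    (hK : ∀ᶠ x in 𝓝 x₀, (⟨1, 0, 0⟩ : Placement).run (x 0) (x 1) K = ⟨1, θ x, D x⟩)
    (hT : ∀ x, T x = D x - cis (-(2 * n * x 0)) * D x) :
    ∀ᶠ x in 𝓝 x₀, c x < 0 → (D x * conj (T x)).im < c x →
      Crosses (x 0) (x 1) (T x) (c x) ⟨1, 0, 0⟩ K →
      Crosses (x 0) (x 1) (-(cis (2 * n * x 0) * T x)) (-(c x)) ⟨1, 0, 0⟩ K →
      x ∈ orbitTile (PeriodicWord.ofList (pretzel n K) (pretzel_ne_nil hn K)) := by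
  have hα := H.contα
  have hβ := H.contβ
  have hc := H.contc
  have hτ := H.contτ
  have hnb := h.mul_eq
  have H' : LinesNear b (-S) x₀ (fun x => x 0) (fun x => x 1) (fun x => -(c x))
      (fun x => -(T x)) :=
    ⟨hα, hβ, by fun_prop, by fun_prop, H.α₀, H.β₀, by simp [H.c₀], by
      obtain ⟨k, hk, e⟩ := H.τ₀
      exact ⟨k, hk, by rw [e, mul_neg]⟩⟩
  have hα₀ : x₀ 0 = b := H.α₀
  have hψ : θ x₀ - 2 * n * x₀ 0 = 0 := by rw [hθ₀, hα₀, hnb, sub_self]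
  have e1 := H'.eventually_crosses_star h.pos hnb h.sin_add_ne
    (ψ := fun x => θ x - 2 * n * x 0) (Q := D) (by fun_prop) hD
    (by rw [height_neg_left, hD₀, neg_zero])
    (by rw [hψ, zero_add, height_neg_left]; linarith)
    (by rw [hψ, zero_sub, height_neg_left]; linarith)
    (by rw [hψ, zero_add, height_neg_left]; linarith) (by rw [hψ, height_neg_left]; linarith)
  have e2 := H.eventually_crosses_star h.pos hnb h.sin_add_ne
    (ψ := fun x => -(2 * n * x 0)) (Q := fun _ => 0) (by fun_prop) (by fun_prop) (by simp [height])
    (by rw [hα₀, hnb, cis_eq_neg_of_sub (φ := b) (by ring), height_zero_neg]; linarith)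
    (by rw [hα₀, hnb, cis_eq_neg_of_sub (φ := -b) (by ring), height_zero_neg]; linarith)
    (by rw [hα₀, hnb, cis_eq_neg_of_sub (φ := 2 * b) (by ring), height_zero_neg]; linarith)
    (by rw [hα₀, hnb, cis_eq_neg_of_sub (φ := 0) (by ring), height_zero_neg]; linarith)
  filter_upwards [e1, e2, hK, eventually_mem_parameterSpace h H.α₀ H.β₀] with
    x h3 h4 hrun hx hc hcT hx1 hx2
  refine mem_orbitTile_pretzel hx hn hrun (hT x) hx1 hx2 (h3 ?_) (h4 ?_)
  · simp only [height, map_neg, mul_neg, neg_im]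
    linarith
  · simp only [height, zero_mul, zero_im]
    linarith

/-- The core of the first pretzel word. -/
def strandOne (n : ℕ) : List (Fin 3) := coreOne n ++ fanOne n ++ (coreOne n).reverse

/-- The first word is realized near the Veech point where both angles are smaller than `π / (2 n)`.
The line is the middle line of the strip that the first and the last vertex of the core allow. -/
theorem eventually_mem_orbitTile_strandOne {n : ℕ} (hn : 4 ≤ n) (hn' : n ≠ 0) :
    ∀ᶠ x in 𝓝 (veechPoint n), x 0 < Real.pi / (2 * n) → x 1 < Real.pi / (2 * n) →
      x ∈ orbitTile (PeriodicWord.ofList (pretzel n (strandOne n)) (pretzel_ne_nil hn' _)) := by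
  have h := smallAngle_pi_div hn
  have v0 := veechPoint_zero n
  have v1 := veechPoint_one n
  set b := Real.pi / (2 * n)
  set x₀ := veechPoint n
  have hnb := h.mul_eq
  let g : EuclideanSpace ℝ (Fin 2) → ℂ := fun x => joint n (x 0) (x 1) 3
  let D : EuclideanSpace ℝ (Fin 2) → ℂ := fun x => g x - cis (2 * n * x 1) * g x
  let T : EuclideanSpace ℝ (Fin 2) → ℂ := fun x => D x - cis (-(2 * n * x 0)) * D x
  let c : EuclideanSpace ℝ (Fin 2) → ℝ := fun x => (D x * conj (T x)).im / 2
  have cα : ContinuousAt (fun x : EuclideanSpace ℝ (Fin 2) => x 0) x₀ := by fun_prop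
  have cβ : ContinuousAt (fun x : EuclideanSpace ℝ (Fin 2) => x 1) x₀ := by fun_prop
  have cg : ContinuousAt g x₀ := by fun_prop
  have cD : ContinuousAt D x₀ := by fun_prop
  have cT : ContinuousAt T x₀ := by fun_prop
  have cDT : ContinuousAt (fun x => (D x * conj (T x)).im) x₀ :=
    continuous_im.continuousAt.comp (cD.mul (continuous_conj.continuousAt.comp cT))
  have cc : ContinuousAt c x₀ := cDT.div_const 2
  have cisπ : cis Real.pi = -1 := by
    rw [cis_eq_neg_of_add (φ := 0) (by ring), cis_zero]
  have cisnπ : cis (-Real.pi) = -1 := by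
    rw [cis_eq_neg_of_sub (φ := 0) (by ring), cis_zero]
  have hg₀ : g x₀ = 2 + cis (2 * b) := by
    change joint n (x₀ 0) (x₀ 1) 3 = _
    rw [v0, v1, joint_three_base hnb, cis_zero]
    ring
  have hD₀ : D x₀ = (2 : ℝ) * (2 + cis (2 * b)) := by
    change g x₀ - cis (2 * n * x₀ 1) * g x₀ = _
    rw [hg₀, v1, hnb, cisπ]
    push_cast
    ring
  have hT₀ : T x₀ = (4 : ℝ) * (2 + cis (2 * b)) := by
    change D x₀ - cis (-(2 * n * x₀ 0)) * D x₀ = _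
    rw [hD₀, v0, hnb, cisnπ]
    push_cast
    ring
  have im0 : ∀ r s : ℝ, ∀ S : ℂ, ((r * S) * conj (s * S)).im = 0 := by
    intro r s S
    simp
    ring
  have hDT₀ : (D x₀ * conj (T x₀)).im = 0 := by rw [hD₀, hT₀, im0]
  have hc₀ : c x₀ = 0 := by change (D x₀ * conj (T x₀)).im / 2 = 0; rw [hDT₀, zero_div]
  have hP₀ : cis (-(2 * n * x₀ 1)) = -1 := by rw [v1, hnb, cisnπ]
  have hQ₀ : cis (2 * n * x₀ 0) = -1 := by rw [v0, hnb, cisπ]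
  -- `H1` and `H3` are the lines for the two passages of the core; `H2` and `H4` are their images
  -- under the turn about `g`, which have to cross the first half of the core as well
  have H1 : LinesNear b (2 + cis (2 * b)) x₀ (fun x => x 0) (fun x => x 1) c T :=
    ⟨cα, cβ, cc, cT, v0, v1, hc₀, 4, by norm_num, hT₀⟩
  have H2 : LinesNear b (2 + cis (2 * b)) x₀ (fun x => x 0) (fun x => x 1)
      (fun x => -(c x - (D x * conj (T x)).im)) (fun x => -(cis (-(2 * n * x 1)) * T x)) :=
    ⟨cα, cβ, by fun_prop, by fun_prop, v0, v1, by rw [hc₀, hDT₀]; simp, 4, by norm_num,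
      by rw [hP₀, hT₀]; ring⟩
  have cT' : ContinuousAt (fun x => -(cis (2 * n * x 0) * T x)) x₀ := by fun_prop
  have hT'₀ : -(cis (2 * n * x₀ 0) * T x₀) = (4 : ℝ) * (2 + cis (2 * b)) := by
    rw [hQ₀, hT₀]; ring
  have H3 : LinesNear b (2 + cis (2 * b)) x₀ (fun x => x 0) (fun x => x 1)
      (fun x => -(c x)) (fun x => -(cis (2 * n * x 0) * T x)) :=
    ⟨cα, cβ, by fun_prop, cT', v0, v1, by rw [hc₀]; simp, 4, by norm_num, hT'₀⟩
  have cDT' : ContinuousAt (fun x => (D x * conj (-(cis (2 * n * x 0) * T x))).im) x₀ :=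
    continuous_im.continuousAt.comp (cD.mul (continuous_conj.continuousAt.comp cT'))
  have H4 : LinesNear b (2 + cis (2 * b)) x₀ (fun x => x 0) (fun x => x 1)
      (fun x => -(-(c x) - (D x * conj (-(cis (2 * n * x 0) * T x))).im))
      (fun x => -(cis (-(2 * n * x 1)) * -(cis (2 * n * x 0) * T x))) :=
    ⟨cα, cβ, by fun_prop, by fun_prop, v0, v1, by rw [hT'₀, hD₀, im0, hc₀]; simp, 4, by norm_num,
      by rw [hP₀, hT'₀]; ring⟩
  obtain ⟨g0, g1, g1', g2, g2', g3, g4⟩ := heights_two_add_cis b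
  have s1 := h.sin_pos one_pos (by norm_num)
  have s2 := h.sin_pos two_pos (by norm_num)
  have s3 := h.sin_pos three_pos (by norm_num)
  have hstar := H1.eventually_mem_orbitTile_pretzel h (by rw [g0]; linarith) (by rwa [g1])
    (by rw [g1']; linarith) (by rw [g2]; linarith) hn' (K := strandOne n)
    (θ := fun x => 2 * n * x 1) (D := D)
    (by fun_prop) cD (by rw [v1, hnb])
    (by
      rw [hD₀, height_zero_ofReal_mul, height_zero_add, g2,
        show height (2 + cis (2 * b)) 0 2 = 2 * height (2 + cis (2 * b)) 0 (cis 0) by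
          rw [← height_zero_ofReal_mul, cis_zero, mul_one]; simp, g0]
      ring)
    (Eventually.of_forall fun x =>
      run_append_fanOne_reverse (run_coreOne hn (x 0) (x 1)) (joint_succ _ _ _ 2) rfl)
    (fun x => rfl)
  have k1 : ∀ᶠ x in 𝓝 x₀, 0 < normSq (g x) := by
    have : ContinuousAt (fun x => normSq (g x)) x₀ := continuous_normSq.continuousAt.comp cg
    refine this.eventually (lt_mem_nhds ?_)
    beta_reduce
    rw [hg₀, normSq_pos]
    intro h0
    have := congrArg Complex.im h0
    rw [add_im, cis_im, zero_im, im_ofNat] at this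
    linarith
  have k2 : ∀ᶠ x in 𝓝 x₀, 0 < 1 - Real.cos (2 * n * x 0) := by
    have : ContinuousAt (fun x : EuclideanSpace ℝ (Fin 2) => 1 - Real.cos (2 * n * x 0)) x₀ := by
      fun_prop
    exact this.eventually (lt_mem_nhds (by beta_reduce; rw [v0, hnb]; norm_num))
  have k3 : ∀ᶠ x in 𝓝 x₀, 0 < 1 - Real.cos (2 * n * x 1) := by
    have : ContinuousAt (fun x : EuclideanSpace ℝ (Fin 2) => 1 - Real.cos (2 * n * x 1)) x₀ := by
      fun_prop
    exact this.eventually (lt_mem_nhds (by beta_reduce; rw [v1, hnb]; norm_num))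
  filter_upwards [hstar, H1.eventually_crosses_wordOne h, H2.eventually_crosses_wordOne h,
    H3.eventually_crosses_wordOne h, H4.eventually_crosses_wordOne h, k1, k2, k3,
    h.eventually H1] with x hx w1 w2 w3 w4 k1 k2 k3 ⟨hsin, i0, i1, _, _⟩ ha hb
  have hnpos : (0 : ℝ) < 2 * n := by
    have : (0 : ℝ) < n := by exact_mod_cast (by omega : 0 < n)
    positivity
  have hP : 0 < Real.sin (2 * n * x 1) :=
    Real.sin_pos_of_pos_of_lt_pi (by positivity) (by rw [← hnb]; gcongr)
  have hQ : 0 < Real.sin (2 * n * x 0) :=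
    Real.sin_pos_of_pos_of_lt_pi (by positivity) (by rw [← hnb]; gcongr)
  have hcx : c x < 0 := by
    change (D x * conj (T x)).im / 2 < 0
    rw [im_mul_conj_sub_cis_mul, normSq_sub_cis_mul]
    have : 0 < 2 * normSq (g x) * (1 - Real.cos (2 * n * x 1)) * Real.sin (2 * n * x 0) := by
      positivity
    linarith
  have hpos : 0 < normSq (g x) * (Real.sin (2 * n * x 1) * (1 - Real.cos (2 * n * x 0))) := by
    positivity
  have hcx' : (D x * conj (T x)).im / 2 < 0 := hcx
  refine hx hcx (by change _ < (D x * conj (T x)).im / 2; linarith) ?_ ?_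
  · exact crosses_append_fanOne_reverse hsin (run_coreOne hn _ _) (joint_succ _ _ _ 2) rfl
      w1.1 w2.1 (w1.2 (by rwa [height_pivot (g x) _ _ rfl rfl rfl]))
  · exact crosses_append_fanOne_reverse hsin (run_coreOne hn _ _) (joint_succ _ _ _ 2) rfl
      w3.1 w4.1 (w3.2 (by rwa [height_pivot' (g x) _ _ rfl rfl rfl]))

end WordOne

/-! ### The core of the second word -/

section StrandTwo

/-- The core of the second pretzel word. -/
def strandTwo (n : ℕ) : List (Fin 3) :=
  coreOne n ++ (fanOne n ++ (fanZero (n - 1) ++ (fanOne (n - 2) ++ (fanZero (n - 3) ++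
    (fanOne (n - 3) ++ (fanZero (n - 2) ++ (fanOne (n - 2) ++ [0])))))))

section Run

variable {n : ℕ} (α β : ℝ)

lemma run_fanOne_joint_two :
    (⟨-1, (2 * n - 2) * (α - β), joint n α β 2⟩ : Placement).run α β (fanOne n) =
      ⟨-1, (2 * n - 2) * α + 2 * β, joint n α β 4⟩ := by
  rw [Placement.run_fanOne, joint_succ _ _ _ 3, joint_succ _ _ _ 2]
  simp only [edge]
  ring_nf

lemma run_fanZero_joint_four (hn : 4 ≤ n) :
    (⟨-1, (2 * n - 2) * α + 2 * β, joint n α β 4⟩ : Placement).run α β (fanZero (n - 1)) =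
      ⟨-1, 2 * β, joint n α β 4⟩ := by
  have h1 : ((n - 1 : ℕ) : ℝ) = n - 1 := by rw [Nat.cast_sub (by omega)]; simp
  rw [Placement.run_fanZero, h1]
  ring_nf

lemma run_fanOne_joint_four (hn : 4 ≤ n) :
    (⟨-1, 2 * β, joint n α β 4⟩ : Placement).run α β (fanOne (n - 2)) =
      ⟨-1, (2 * n - 2) * β, joint n α β 6⟩ := by
  have h2 : ((n - 2 : ℕ) : ℝ) = n - 2 := by rw [Nat.cast_sub (by omega)]; simp
  rw [Placement.run_fanOne, joint_succ _ _ _ 5, joint_succ _ _ _ 4, h2]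
  simp only [edge]
  ring_nf

lemma run_fanZero_joint_six (hn : 4 ≤ n) :
    (⟨-1, (2 * n - 2) * β, joint n α β 6⟩ : Placement).run α β (fanZero (n - 3)) =
      ⟨-1, (2 * n - 2) * β - (2 * n - 6) * α, joint n α β 6⟩ := by
  have h3 : ((n - 3 : ℕ) : ℝ) = n - 3 := by rw [Nat.cast_sub (by omega)]; simp
  rw [Placement.run_fanZero, h3]
  ring_nf

lemma run_fanOne_joint_six (hn : 4 ≤ n) :
    (⟨-1, (2 * n - 2) * β - (2 * n - 6) * α, joint n α β 6⟩ : Placement).run α β (fanOne (n - 3)) =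
      ⟨-1, (4 * n - 8) * β - (2 * n - 6) * α, joint n α β 8⟩ := by
  have h3 : ((n - 3 : ℕ) : ℝ) = n - 3 := by rw [Nat.cast_sub (by omega)]; simp
  rw [Placement.run_fanOne, joint_succ _ _ _ 7, joint_succ _ _ _ 6, h3]
  simp only [edge]
  ring_nf

lemma run_fanZero_joint_eight (hn : 4 ≤ n) :
    (⟨-1, (4 * n - 8) * β - (2 * n - 6) * α, joint n α β 8⟩ : Placement).run α β (fanZero (n - 2)) =
      ⟨-1, (4 * n - 8) * β - (4 * n - 10) * α, joint n α β 8⟩ := by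
  have h2 : ((n - 2 : ℕ) : ℝ) = n - 2 := by rw [Nat.cast_sub (by omega)]; simp
  rw [Placement.run_fanZero, h2]
  ring_nf

lemma run_fanOne_joint_eight (hn : 4 ≤ n) :
    (⟨-1, (4 * n - 8) * β - (4 * n - 10) * α, joint n α β 8⟩ : Placement).run α β (fanOne (n - 2)) =
      ⟨-1, (6 * n - 12) * β - (4 * n - 10) * α,
        joint n α β 9 - cis ((6 * n - 12) * β - (4 * n - 10) * α)⟩ := by
  have h2 : ((n - 2 : ℕ) : ℝ) = n - 2 := by rw [Nat.cast_sub (by omega)]; simp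
  rw [Placement.run_fanOne, joint_succ _ _ _ 8, h2]
  simp only [edge]
  ring_nf

lemma run_strandTwo (hn : 4 ≤ n) :
    (⟨1, 0, 0⟩ : Placement).run α β (strandTwo n) =
      ⟨1, (6 * n - 10) * β - (4 * n - 10) * α, joint n α β 10⟩ := by
  simp only [strandTwo, Placement.run_append, run_coreOne hn, run_fanOne_joint_two,
    run_fanZero_joint_four _ _ hn, run_fanOne_joint_four _ _ hn, run_fanZero_joint_six _ _ hn,
    run_fanOne_joint_six _ _ hn, run_fanZero_joint_eight _ _ hn, run_fanOne_joint_eight _ _ hn]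
  simp only [Placement.run_cons, Placement.run_nil, Placement.step, sub_add_cancel, neg_neg]
  rw [joint_succ _ _ _ 9]
  simp only [edge]
  ring_nf

variable {α β} {τ : ℂ} {c : ℝ}

lemma crosses_strandTwo (hn : 4 ≤ n)
    (h₀ : Crosses α β τ c ⟨1, 0, 0⟩ (coreOne n))
    (h₁ : Crosses α β τ c ⟨-1, (2 * n - 2) * (α - β), joint n α β 2⟩ (fanOne n))
    (h₂ : Crosses α β τ c ⟨-1, (2 * n - 2) * α + 2 * β, joint n α β 4⟩ (fanZero (n - 1)))
    (h₃ : Crosses α β τ c ⟨-1, 2 * β, joint n α β 4⟩ (fanOne (n - 2)))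
    (h₄ : Crosses α β τ c ⟨-1, (2 * n - 2) * β, joint n α β 6⟩ (fanZero (n - 3)))
    (h₅ : Crosses α β τ c ⟨-1, (2 * n - 2) * β - (2 * n - 6) * α, joint n α β 6⟩ (fanOne (n - 3)))
    (h₆ : Crosses α β τ c ⟨-1, (4 * n - 8) * β - (2 * n - 6) * α, joint n α β 8⟩ (fanZero (n - 2)))
    (h₇ : Crosses α β τ c ⟨-1, (4 * n - 8) * β - (4 * n - 10) * α, joint n α β 8⟩ (fanOne (n - 2)))
    (h₈ : Crosses α β τ c ⟨-1, (6 * n - 12) * β - (4 * n - 10) * α,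
        joint n α β 9 - cis ((6 * n - 12) * β - (4 * n - 10) * α)⟩ [0]) :
    Crosses α β τ c ⟨1, 0, 0⟩ (strandTwo n) := by
  refine h₀.append ?_
  rw [run_coreOne hn]
  refine h₁.append ?_
  rw [run_fanOne_joint_two]
  refine h₂.append ?_
  rw [run_fanZero_joint_four _ _ hn]
  refine h₃.append ?_
  rw [run_fanOne_joint_four _ _ hn]
  refine h₄.append ?_
  rw [run_fanZero_joint_six _ _ hn]
  refine h₅.append ?_
  rw [run_fanOne_joint_six _ _ hn]
  refine h₆.append ?_
  rw [run_fanZero_joint_eight _ _ hn]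
  refine h₇.append ?_
  rwa [run_fanOne_joint_eight _ _ hn]

end Run

/-- The direction of the base line of the second word. -/
noncomputable def dirTwo (b : ℝ) : ℂ := cis (3 * b) + 2 * cis b + 2 * cis (-b)

lemma height_dirTwo (b θ : ℝ) : height (dirTwo b) 0 (cis θ) =
    Real.sin (θ - 3 * b) + 2 * Real.sin (θ - b) + 2 * Real.sin (θ + b) := by
  have h (φ : ℝ) : (cis θ * conj (cis φ)).im = Real.sin (θ - φ) := by
    rw [conj_cis, ← cis_add, cis_im, sub_eq_add_neg]
  have h2 (z : ℂ) : (cis θ * (2 * z)).im = 2 * (cis θ * z).im := by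
    rw [mul_left_comm, ← ofReal_ofNat, im_ofReal_mul]
  rw [height, dirTwo]
  simp only [map_add, map_mul, map_ofNat, mul_add, add_im, h, h2, sub_neg_eq_add, sub_zero]

/-- The values of the height over the base line of the second word, and of its products with the
length of the short sides, in terms of sines. -/
structure HeightsTwo (b ρ : ℝ) (S : ℂ) (s₁ s₃ s₅ s₇ : ℝ) : Prop where
  zero : height S 0 (cis 0) = -s₃
  two : height S 0 (cis (2 * b)) = s₁ + 2 * s₃
  neg_two : height S 0 (cis (-(2 * b))) = -s₅ - 2 * s₃ - 2 * s₁
  four : height S 0 (cis (4 * b)) = s₁ + 2 * s₃ + 2 * s₅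
  neg_four : height S 0 (cis (-(4 * b))) = -s₇ - 2 * s₅ - 2 * s₃
  six : height S 0 (cis (6 * b)) = s₃ + 2 * s₅ + 2 * s₇
  one : ρ * height S 0 (cis b) = s₁
  neg_one : ρ * height S 0 (cis (-b)) = -s₃ - s₁
  three : ρ * height S 0 (cis (3 * b)) = 2 * s₃
  neg_three : ρ * height S 0 (cis (-(3 * b))) = -s₅ - s₃ - s₁
  five : ρ * height S 0 (cis (5 * b)) = s₁ + 2 * s₅

variable {b : ℝ} {n : ℕ}

lemma SmallAngle.heightsTwo (h : SmallAngle n b) : HeightsTwo b (legLength b b) (dirTwo b)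
    (Real.sin (1 * b)) (Real.sin (3 * b)) (Real.sin (5 * b)) (Real.sin (7 * b)) := by
  have l1 := h.leg_mul_sin 1
  have l3 := h.leg_mul_sin 3
  have l5 := h.leg_mul_sin 5
  norm_num only [zero_mul, Real.sin_zero] at l1 l3 l5
  rw [one_mul] at l1
  have key : ∀ k : ℝ, height (dirTwo b) 0 (cis (k * b)) =
      Real.sin ((k - 3) * b) + 2 * Real.sin ((k - 1) * b) + 2 * Real.sin ((k + 1) * b) := by
    intro k
    rw [height_dirTwo]
    ring_nf
  have neg : ∀ k : ℝ, Real.sin (-k * b) = -Real.sin (k * b) := by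
    intro k
    rw [neg_mul, Real.sin_neg]
  have e0 := key 0
  have e1 := key 1
  have e1' := key (-1)
  have e2 := key 2
  have e2' := key (-2)
  have e3 := key 3
  have e3' := key (-3)
  have e4 := key 4
  have e4' := key (-4)
  have e5 := key 5
  have e6 := key 6
  norm_num only [zero_mul, Real.sin_zero, neg] at e0 e1 e1' e2 e2' e3 e3' e4 e4' e5 e6
  simp only [neg_mul, one_mul] at e0 e1 e1' e2 e2' e3 e3' e4 e4' e5 e6 l1 l3 l5
  rw [one_mul]
  refine ⟨?_, ?_, ?_, ?_, ?_, ?_, ?_, ?_, ?_, ?_, ?_⟩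
  · linear_combination e0
  · linear_combination e2
  · linear_combination e2'
  · linear_combination e4
  · linear_combination e4'
  · linear_combination e6
  · linear_combination legLength b b * e1 + l1
  · linear_combination legLength b b * e1' - l1 - l3
  · linear_combination legLength b b * e3 + 2 * l3
  · linear_combination legLength b b * e3' - l3 - l1 - l5
  · linear_combination legLength b b * e5 + 2 * l5 + l1

/-- The inequalities between the sines that decide on which side of the base line of the second word
the vertices of the unfolding are. -/
structure SineOrder (n : ℕ) (s₁ s₃ s₅ s₇ : ℝ) : Prop where
  pos_one : 0 < s₁
  pos_seven : 0 < s₇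
  two_lt : 2 * s₁ < s₃
  one_lt_five : s₁ < s₅
  three_le_five : s₃ ≤ s₅
  three_lt_five : 4 < n → s₃ < s₅

lemma SmallAngle.sineOrder (h : SmallAngle n b) :
    SineOrder n (Real.sin (1 * b)) (Real.sin (3 * b)) (Real.sin (5 * b)) (Real.sin (7 * b)) := by
  have hb := h.pos
  have hle := h.le
  have s1 := h.sin_pos one_pos (by norm_num)
  have s2 := h.sin_pos two_pos (by norm_num)
  have e31 : Real.sin (3 * b) - Real.sin (1 * b) = 2 * Real.sin (1 * b) * Real.cos (2 * b) := by
    rw [Real.sin_sub_sin]; ring_nf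
  have e51 : Real.sin (5 * b) - Real.sin (1 * b) = 2 * Real.sin (2 * b) * Real.cos (3 * b) := by
    rw [Real.sin_sub_sin]; ring_nf
  have e53 : Real.sin (5 * b) - Real.sin (3 * b) = 2 * Real.sin (1 * b) * Real.cos (4 * b) := by
    rw [Real.sin_sub_sin]; ring_nf
  have c2 : 1 / 2 < Real.cos (2 * b) := by
    rw [← Real.cos_pi_div_three]
    exact Real.cos_lt_cos_of_nonneg_of_le_pi (by positivity) (by linarith) (by linarith)
  have c3 : 0 < Real.cos (3 * b) := Real.cos_pos_of_mem_Ioo ⟨by linarith, by linarith⟩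
  have c4 : 0 ≤ Real.cos (4 * b) := Real.cos_nonneg_of_mem_Icc ⟨by linarith, by linarith⟩
  refine ⟨s1, h.sin_pos (by norm_num) le_rfl, ?_, ?_, ?_, ?_⟩
  · nlinarith
  · nlinarith [mul_pos s2 c3]
  · nlinarith [mul_nonneg s1.le c4]
  · intro hn
    have h5 : (5 : ℝ) ≤ n := by exact_mod_cast hn
    have c4 : 0 < Real.cos (4 * b) := by
      refine Real.cos_pos_of_mem_Ioo ⟨by linarith, ?_⟩
      have := h.mul_eq
      nlinarith
    nlinarith [mul_pos s1 c4]

variable {X : Type*} [TopologicalSpace X] {x₀ : X} {α β c : X → ℝ} {τ : X → ℂ} {S : ℂ}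

/-- Whether the line is on the left of a fan about a vertex `1` is decided at the base point, except
for the ends of the first and the last short rays. -/
lemma LinesNear.eventually_crosses_fanOne {n j : ℕ} (h : SmallAngle n b)
    (H : LinesNear b S x₀ α β c τ) {θ : X → ℝ} {B V : X → ℂ} (hθ : ContinuousAt θ x₀)
    (hV : ContinuousAt V x₀) (hBV : ∀ x, V x = B x + cis (θ x)) {φ ψ : ℝ}
    (hφ : θ x₀ + 2 * b = φ) (hψ : θ x₀ + 2 * j * b = ψ + Real.pi) (hjn : j ≤ n)
    (h₀ : 0 < height S 0 (V x₀)) (h₁ : height S 0 (V x₀) - height S 0 (cis φ) < 0)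
    (h₂ : height S 0 (V x₀) + height S 0 (cis ψ) < 0) :
    ∀ᶠ x in 𝓝 x₀,
      height (τ x) (c x) (V x - legLength (β x) (α x) * cis (θ x + β x)) < 0 →
      height (τ x) (c x) (V x - legLength (β x) (α x) * cis (θ x + (2 * j - 1) * β x)) < 0 →
      Crosses (α x) (β x) (τ x) (c x) ⟨-1, θ x, B x⟩ (fanOne j) := by
  have hβ := H.contβ
  have hj : (j : ℝ) ≤ n := by exact_mod_cast hjn
  have e0 := H.pos hV h₀
  have e1 := H.neg (z := fun x => V x - cis (θ x + 2 * β x)) (by fun_prop) (by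
    rwa [H.β₀, hφ, height_zero_sub])
  have e2 := H.neg (z := fun x => V x - cis (θ x + 2 * j * β x)) (by fun_prop) (by
    rwa [H.β₀, cis_eq_neg_of_add hψ, height_zero_sub, height_zero_neg, sub_neg_eq_add])
  filter_upwards [e0, e1, e2, h.eventually H] with x e0 e1 e2 ⟨i1, i2, i3, i4, i5⟩ k1 k2
  exact crosses_fanOne_of_above i1 i3 (2 * j - 1) (2 * j) le_rfl (by nlinarith) le_rfl
    (by nlinarith) (hBV x) e0 k1 k2 e1 e2

/-- The end of a short ray about a vertex `1` is on the right of the line near the base point. -/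
lemma LinesNear.eventually_short_neg {n : ℕ} (h : SmallAngle n b)
    (H : LinesNear b S x₀ α β c τ) {φ : X → ℝ} {V : X → ℂ} (hφ : ContinuousAt φ x₀)
    (hV : ContinuousAt V x₀) {z : ℂ} (hz : cis (φ x₀) = z)
    (h₁ : height S 0 (V x₀) - legLength b b * height S 0 z < 0) :
    ∀ᶠ x in 𝓝 x₀, height (τ x) (c x) (V x - legLength (β x) (α x) * cis (φ x)) < 0 := by
  have hr := H.contLeg' h.sin_add_ne
  refine H.neg (by fun_prop) ?_
  rwa [H.α₀, H.β₀, hz, height_zero_sub, height_zero_ofReal_mul]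

/-- Whether the line is on the right of a fan about a vertex `0` is decided at the base point. -/
lemma LinesNear.eventually_crosses_fanZero {n j : ℕ} (h : SmallAngle n b)
    (H : LinesNear b S x₀ α β c τ) {θ : X → ℝ} {V : X → ℂ} (hθ : ContinuousAt θ x₀)
    (hV : ContinuousAt V x₀) {φ φ' ψ ψ' : ℝ}
    (hφ : θ x₀ - b = φ + Real.pi) (hφ' : θ x₀ - (2 * j - 1) * b = φ')
    (hψ : θ x₀ - 2 * b = ψ + Real.pi) (hψ' : θ x₀ - 2 * j * b = ψ') (hjn : j ≤ n)
    (h₀ : height S 0 (V x₀) < 0)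
    (h₁ : 0 < height S 0 (V x₀) - legLength b b * height S 0 (cis φ))
    (h₁' : 0 < height S 0 (V x₀) + legLength b b * height S 0 (cis φ'))
    (h₂ : 0 < height S 0 (V x₀) - height S 0 (cis ψ))
    (h₂' : 0 < height S 0 (V x₀) + height S 0 (cis ψ')) :
    ∀ᶠ x in 𝓝 x₀, Crosses (α x) (β x) (τ x) (c x) ⟨-1, θ x, V x⟩ (fanZero j) := by
  have hα := H.contα
  have hr := H.contLeg h.sin_add_ne
  have hj : (j : ℝ) ≤ n := by exact_mod_cast hjn
  have e0 := H.neg hV h₀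
  have e1 := H.pos (z := fun x => V x + legLength (α x) (β x) * cis (θ x - α x)) (by fun_prop) (by
    rwa [H.α₀, H.β₀, height_zero_add, height_zero_ofReal_mul, cis_eq_neg_of_add hφ,
      height_zero_neg, mul_neg, ← sub_eq_add_neg])
  have e2 := H.pos (z := fun x => V x + legLength (α x) (β x) * cis (θ x - (2 * j - 1) * α x))
    (by fun_prop) (by
    rwa [H.α₀, H.β₀, height_zero_add, height_zero_ofReal_mul, hφ'])
  have e3 := H.pos (z := fun x => V x + cis (θ x - 2 * α x)) (by fun_prop) (by
    rwa [H.α₀, height_zero_add, cis_eq_neg_of_add hψ, height_zero_neg, ← sub_eq_add_neg])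
  have e4 := H.pos (z := fun x => V x + cis (θ x - 2 * j * α x)) (by fun_prop) (by
    rwa [H.α₀, height_zero_add, hψ'])
  filter_upwards [e0, e1, e2, e3, e4, h.eventually H] with x e0 e1 e2 e3 e4 ⟨i1, i2, i3, i4, i5⟩
  exact crosses_fanZero_of_below i2 (2 * j - 1) (2 * j) le_rfl (by nlinarith) le_rfl
    (by nlinarith) e0 e1 e2 e3 e4

/-- The obtuse vertex at the end of the last short ray about the pivot `joint 7`. -/
noncomputable def apexTwo (n α β : ℝ) : ℂ :=
  joint n α β 7 - legLength β α * cis ((4 * n - 9) * β - (2 * n - 6) * α)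

/-- The heights of the pivots of the second word at the base point. -/
lemma HeightsTwo.joints {ρ s₁ s₃ s₅ s₇ : ℝ} (T : HeightsTwo b ρ S s₁ s₃ s₅ s₇) {n : ℝ}
    (hn : 2 * n * b = Real.pi) :
    height S 0 (joint n b b 3) = s₁ ∧ height S 0 (joint n b b 4) = s₁ - s₃ ∧
    height S 0 (joint n b b 5) = 2 * s₁ + s₃ ∧ height S 0 (joint n b b 6) = -s₅ - s₃ ∧
    height S 0 (joint n b b 7) = s₁ + s₃ + s₅ ∧ height S 0 (joint n b b 8) = -s₁ - s₃ ∧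
    height S 0 (joint n b b 9) = s₃ ∧ height S 0 (joint n b b 10) = 0 := by
  have e3 : height S 0 (joint n b b 3) = s₁ := by
    simp only [joint_three_base hn, height_zero_add, T.zero, T.two]
    ring
  have e4 : height S 0 (joint n b b 4) = s₁ - s₃ := by
    rw [joint_succ, height_zero_add, edge_three hn, e3, T.zero]
    ring
  have e5 : height S 0 (joint n b b 5) = 2 * s₁ + s₃ := by
    rw [joint_succ, height_zero_add, edge_four, e4, T.two]
    ring
  have e6 : height S 0 (joint n b b 6) = -s₅ - s₃ := by
    rw [joint_succ, height_zero_add, edge_five hn, e5, T.neg_two]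
    ring
  have e7 : height S 0 (joint n b b 7) = s₁ + s₃ + s₅ := by
    rw [joint_succ, height_zero_add, edge_six, e6, T.four]
    ring
  have e8 : height S 0 (joint n b b 8) = -s₁ - s₃ := by
    rw [joint_succ, height_zero_add, edge_seven hn, e7, T.neg_two]
    ring
  have e9 : height S 0 (joint n b b 9) = s₃ := by
    rw [joint_succ, height_zero_add, edge_eight, e8, T.two]
    ring
  have e10 : height S 0 (joint n b b 10) = 0 := by
    rw [joint_succ, height_zero_add, edge_nine hn, e9, T.zero]
    ring
  exact ⟨e3, e4, e5, e6, e7, e8, e9, e10⟩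

/-- A line near the base line crosses the core of the second word, if two obtuse vertices, which
are on the base line at the base point, are on its right. -/
theorem LinesNear.eventually_crosses_strandTwo {n : ℕ} (h : SmallAngle n b)
    (H : LinesNear b (dirTwo b) x₀ α β c τ) :
    ∀ᶠ x in 𝓝 x₀, height (τ x) (c x) (apexOne n (α x) (β x)) < 0 →
      height (τ x) (c x) (apexTwo n (α x) (β x)) < 0 →
      Crosses (α x) (β x) (τ x) (c x) ⟨1, 0, 0⟩ (strandTwo n) := by
  have hα := H.contα
  have hβ := H.contβ
  have hα₀ := H.α₀
  have hβ₀ := H.β₀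
  have hn := h.mul_eq
  have h4 := h.four_le
  have n1 : ((n - 1 : ℕ) : ℝ) = n - 1 := by rw [Nat.cast_sub (by omega)]; simp
  have n2 : ((n - 2 : ℕ) : ℝ) = n - 2 := by rw [Nat.cast_sub (by omega)]; simp
  have n3 : ((n - 3 : ℕ) : ℝ) = n - 3 := by rw [Nat.cast_sub (by omega)]; simp
  have T := h.heightsTwo
  obtain ⟨j3, j4, j5, j6, j7, j8, j9, j10⟩ := T.joints hn
  obtain ⟨o1, o7, o31, o51, o53, o53'⟩ := h.sineOrder
  generalize Real.sin (1 * b) = s₁, Real.sin (3 * b) = s₃, Real.sin (5 * b) = s₅,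
    Real.sin (7 * b) = s₇ at *
  obtain ⟨t0, t2, t2', t4, t4', t6, r1, r1', r3, r3', r5⟩ := T
  have hJ (k : ℕ) : ContinuousAt (fun x => joint n (α x) (β x) k) x₀ := by fun_prop
  have q0 := H.eventually_crosses_coreOne h (by linarith) (by linarith) (by linarith)
    (by linarith) (by linarith) (by linarith) (by linarith) (by linarith)
  have q1 := H.eventually_crosses_fanOne (j := n) h (θ := fun x => (2 * n - 2) * (α x - β x))
    (B := fun x => joint n (α x) (β x) 2) (by fun_prop) (hJ 3) (fun x => joint_succ _ _ _ _)
    (φ := 2 * b) (ψ := 0) (by rw [hα₀, hβ₀]; ring) (by rw [hα₀, hβ₀]; linear_combination hn) le_rfl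
    (by rw [hα₀, hβ₀]; linarith) (by rw [hα₀, hβ₀]; linarith) (by rw [hα₀, hβ₀]; linarith)
  have q1' := H.eventually_short_neg h
    (φ := fun x => (2 * n - 2) * (α x - β x) + (2 * n - 1) * β x) (by fun_prop) (hJ 3)
    (cis_eq_neg_of_add (φ := -b) (by rw [hα₀, hβ₀]; linear_combination hn))
    (by rw [hα₀, hβ₀, height_zero_neg]; linarith)
  have q2 := H.eventually_crosses_fanZero (j := n - 1) h
    (θ := fun x => (2 * n - 2) * α x + 2 * β x) (by fun_prop) (hJ 4)
    (φ := -b) (φ' := 3 * b) (ψ := -(2 * b)) (ψ' := 2 * b)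
    (by rw [hα₀, hβ₀]; linear_combination hn) (by rw [hα₀, hβ₀, n1]; ring)
    (by rw [hα₀, hβ₀]; linear_combination hn) (by rw [hα₀, hβ₀, n1]; ring) (by omega)
    (by rw [hα₀, hβ₀]; linarith) (by rw [hα₀, hβ₀]; linarith) (by rw [hα₀, hβ₀]; linarith)
    (by rw [hα₀, hβ₀]; linarith) (by rw [hα₀, hβ₀]; linarith)
  have q3 := H.eventually_crosses_fanOne (j := n - 2) h (θ := fun x => 2 * β x)
    (B := fun x => joint n (α x) (β x) 4) (by fun_prop) (hJ 5) (fun x => joint_succ _ _ _ _)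
    (φ := 4 * b) (ψ := -(2 * b)) (by rw [hβ₀]; ring) (by rw [hβ₀, n2]; linear_combination hn)
    (by omega)
    (by rw [hα₀, hβ₀]; linarith) (by rw [hα₀, hβ₀]; linarith) (by rw [hα₀, hβ₀]; linarith)
  have q3a := H.eventually_short_neg h
    (φ := fun x => 2 * β x + β x) (z := cis (3 * b)) (by fun_prop) (hJ 5)
    (by rw [hβ₀]; ring_nf) (by rw [hα₀, hβ₀]; linarith)
  have q3b := H.eventually_short_neg h
    (φ := fun x => 2 * β x + (2 * (n - 2) - 1) * β x) (by fun_prop) (hJ 5)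
    (cis_eq_neg_of_add (φ := -(3 * b)) (by rw [hβ₀]; linear_combination hn))
    (by rw [hα₀, hβ₀, height_zero_neg]; linarith)
  have q4 := H.eventually_crosses_fanZero (j := n - 3) h
    (θ := fun x => (2 * n - 2) * β x) (by fun_prop) (hJ 6)
    (φ := -(3 * b)) (φ' := 5 * b) (ψ := -(4 * b)) (ψ' := 4 * b)
    (by rw [hβ₀]; linear_combination hn) (by rw [hβ₀, n3]; ring)
    (by rw [hβ₀]; linear_combination hn) (by rw [hβ₀, n3]; ring) (by omega)
    (by rw [hα₀, hβ₀]; linarith) (by rw [hα₀, hβ₀]; linarith) (by rw [hα₀, hβ₀]; linarith)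
    (by rw [hα₀, hβ₀]; linarith) (by rw [hα₀, hβ₀]; linarith)
  have q5 := H.eventually_crosses_fanOne (j := n - 3) h
    (θ := fun x => (2 * n - 2) * β x - (2 * n - 6) * α x)
    (B := fun x => joint n (α x) (β x) 6) (by fun_prop) (hJ 7) (fun x => joint_succ _ _ _ _)
    (φ := 6 * b) (ψ := -(2 * b)) (by rw [hα₀, hβ₀]; ring)
    (by rw [hα₀, hβ₀, n3]; linear_combination hn) (by omega)
    (by rw [hα₀, hβ₀]; linarith) (by rw [hα₀, hβ₀]; linarith) (by rw [hα₀, hβ₀]; linarith)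
  have q5' : ∀ᶠ x in 𝓝 x₀, height (τ x) (c x) (apexTwo n (α x) (β x)) < 0 →
      height (τ x) (c x) (joint n (α x) (β x) 7 - legLength (β x) (α x) *
        cis ((2 * n - 2) * β x - (2 * n - 6) * α x + β x)) < 0 := by
    rcases h4.lt_or_eq with h5 | h5
    · have := o53' h5
      filter_upwards [H.eventually_short_neg h
        (φ := fun x => (2 * n - 2) * β x - (2 * n - 6) * α x + β x) (z := cis (5 * b))
        (by fun_prop) (hJ 7) (by rw [hα₀, hβ₀]; ring_nf) (by rw [hα₀, hβ₀]; linarith)] with x hx _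
      exact hx
    · -- for `n = 4` the fan has only one short ray
      refine Eventually.of_forall fun x hx => ?_
      rw [apexTwo] at hx
      subst h5
      rwa [Nat.cast_ofNat, show (2 * 4 - 2) * β x - (2 * 4 - 6) * α x + β x =
        (4 * 4 - 9) * β x - (2 * 4 - 6) * α x by ring]
  have q6 := H.eventually_crosses_fanZero (j := n - 2) h
    (θ := fun x => (4 * n - 8) * β x - (2 * n - 6) * α x) (by fun_prop) (hJ 8)
    (φ := -(3 * b)) (φ' := 3 * b) (ψ := -(4 * b)) (ψ' := 2 * b)
    (by rw [hα₀, hβ₀]; linear_combination hn) (by rw [hα₀, hβ₀, n2]; ring)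
    (by rw [hα₀, hβ₀]; linear_combination hn) (by rw [hα₀, hβ₀, n2]; ring) (by omega)
    (by rw [hα₀, hβ₀]; linarith) (by rw [hα₀, hβ₀]; linarith) (by rw [hα₀, hβ₀]; linarith)
    (by rw [hα₀, hβ₀]; linarith) (by rw [hα₀, hβ₀]; linarith)
  have q7 := H.eventually_crosses_fanOne (j := n - 2) h
    (θ := fun x => (4 * n - 8) * β x - (4 * n - 10) * α x)
    (B := fun x => joint n (α x) (β x) 8) (by fun_prop) (hJ 9) (fun x => joint_succ _ _ _ _)
    (φ := 4 * b) (ψ := -(2 * b)) (by rw [hα₀, hβ₀]; ring)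
    (by rw [hα₀, hβ₀, n2]; linear_combination hn) (by omega)
    (by rw [hα₀, hβ₀]; linarith) (by rw [hα₀, hβ₀]; linarith) (by rw [hα₀, hβ₀]; linarith)
  have q7a := H.eventually_short_neg h
    (φ := fun x => (4 * n - 8) * β x - (4 * n - 10) * α x + β x) (z := cis (3 * b))
    (by fun_prop) (hJ 9) (by rw [hα₀, hβ₀]; ring_nf) (by rw [hα₀, hβ₀]; linarith)
  have q7b := H.eventually_short_neg h
    (φ := fun x => (4 * n - 8) * β x - (4 * n - 10) * α x + (2 * (n - 2) - 1) * β x)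
    (by fun_prop) (hJ 9)
    (cis_eq_neg_of_add (φ := -(3 * b)) (by rw [hα₀, hβ₀]; linear_combination hn))
    (by rw [hα₀, hβ₀, height_zero_neg]; linarith)
  have q8 := H.pos (hJ 9) (by rw [hα₀, hβ₀]; linarith)
  have q8' := H.eventually_short_neg h
    (φ := fun x => (6 * n - 12) * β x - (4 * n - 10) * α x + β x)
    (by fun_prop) (hJ 9)
    (cis_eq_neg_of_add (φ := -b) (by rw [hα₀, hβ₀]; linear_combination hn))
    (by rw [hα₀, hβ₀, height_zero_neg]; linarith)
  filter_upwards [q0, q1, q1', q2, q3, q3a, q3b, q4, q5, q5', q6, q7, q7a, q7b, q8, q8',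
    h.eventually H] with x q0 q1 q1' q2 q3 q3a q3b q4 q5 q5' q6 q7 q7a q7b q8 q8' i a1 a2
  refine crosses_strandTwo h4 (q0 a1) (q1 ?_ q1') q2 (q3 q3a ?_) q4 (q5 (q5' a2) ?_) q6
    (q7 q7a ?_) ⟨⟨?_, ?_⟩, trivial⟩
  · rwa [← apexOne_eq _ i.1]
  · rwa [n2]
  · rwa [n3, show (2 * n - 2) * β x - (2 * n - 6) * α x + (2 * (n - 3) - 1) * β x =
      (4 * n - 9) * β x - (2 * n - 6) * α x by ring]
  · rwa [n2]
  · change 0 < _ at q8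
    change -1 * height _ _ (joint n (α x) (β x) 9 - _ + _) < 0
    rw [sub_add_cancel]
    linarith
  · change 0 < -1 * height _ _ (Placement.vertex _ _ _ 2)
    rw [Placement.vertex_two_eq i.1 (by norm_num)]
    simp only [neg_one_mul, sub_neg_eq_add, sub_add_cancel]
    linarith

end StrandTwo

/-! ### First-order expansions at a point -/

section Jets

/-- The plane of parameters. -/
abbrev Plane := EuclideanSpace ℝ (Fin 2)

/-- The real-linear map with partial derivatives `A` and `B`. -/
noncomputable def jet (A B : ℂ) : Plane →L[ℝ] ℂ :=
  (EuclideanSpace.proj (𝕜 := ℝ) (0 : Fin 2)).smulRight A +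
    (EuclideanSpace.proj (𝕜 := ℝ) (1 : Fin 2)).smulRight B

lemma jet_apply (A B : ℂ) (v : Plane) : jet A B v = v 0 * A + v 1 * B := by
  simp [jet]

/-- The function `f` has the value `z` and the partial derivatives `A`, `B` at `x₀`. -/
structure HasJet (f : Plane → ℂ) (x₀ : Plane) (z A B : ℂ) : Prop where
  value : f x₀ = z
  deriv : HasFDerivAt f (jet A B) x₀

variable {f g : Plane → ℂ} {x₀ : Plane} {z w A B A' B' : ℂ}

lemma HasJet.congr_jet (h : HasJet f x₀ z A B) (hz : z = w) (hA : A = A') (hB : B = B') :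
    HasJet f x₀ w A' B' := by
  subst hz hA hB
  exact h

lemma HasJet.continuousAt (h : HasJet f x₀ z A B) : ContinuousAt f x₀ := h.deriv.continuousAt

lemma HasJet.const (z : ℂ) : HasJet (fun _ => z) x₀ z 0 0 := by
  refine ⟨rfl, ?_⟩
  refine (hasFDerivAt_const z x₀).congr_fderiv (ContinuousLinearMap.ext fun v => ?_)
  simp [jet_apply]

lemma HasJet.add (hf : HasJet f x₀ z A B) (hg : HasJet g x₀ w A' B') :
    HasJet (fun x => f x + g x) x₀ (z + w) (A + A') (B + B') := by
  refine ⟨by rw [hf.value, hg.value], ?_⟩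
  refine (hf.deriv.add hg.deriv).congr_fderiv (ContinuousLinearMap.ext fun v => ?_)
  simp only [add_apply, jet_apply]
  ring

lemma HasJet.neg (hf : HasJet f x₀ z A B) : HasJet (fun x => -f x) x₀ (-z) (-A) (-B) := by
  refine ⟨by rw [hf.value], ?_⟩
  refine (hf.deriv.neg).congr_fderiv (ContinuousLinearMap.ext fun v => ?_)
  simp only [neg_apply, jet_apply]
  ring

lemma HasJet.sub (hf : HasJet f x₀ z A B) (hg : HasJet g x₀ w A' B') :
    HasJet (fun x => f x - g x) x₀ (z - w) (A - A') (B - B') := by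
  simpa only [sub_eq_add_neg] using hf.add hg.neg

lemma HasJet.mul (hf : HasJet f x₀ z A B) (hg : HasJet g x₀ w A' B') :
    HasJet (fun x => f x * g x) x₀ (z * w) (A * w + z * A') (B * w + z * B') := by
  refine ⟨by rw [hf.value, hg.value], ?_⟩
  refine (hf.deriv.mul hg.deriv).congr_fderiv (ContinuousLinearMap.ext fun v => ?_)
  simp only [add_apply, smul_apply, jet_apply, hf.value,
    hg.value, smul_eq_mul]
  ring

lemma HasJet.conj (hf : HasJet f x₀ z A B) :
    HasJet (fun x => conj (f x)) x₀ (conj z) (conj A) (conj B) := by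
  refine ⟨by rw [hf.value], ?_⟩
  refine ((conjCLE.toContinuousLinearMap.hasFDerivAt (x := f x₀)).comp x₀
    hf.deriv).congr_fderiv (ContinuousLinearMap.ext fun v => ?_)
  simp [jet_apply]

lemma hasFDerivAt_coord (x₀ : Plane) (i : Fin 2) :
    HasFDerivAt (fun x : Plane => x i) (EuclideanSpace.proj (𝕜 := ℝ) i) x₀ :=
  (EuclideanSpace.proj (𝕜 := ℝ) i).hasFDerivAt

lemma HasJet.cis (k l : ℝ) : HasJet (fun x => cis (k * x 0 + l * x 1)) x₀
    (cis (k * x₀ 0 + l * x₀ 1)) (k * (I * _root_.cis (k * x₀ 0 + l * x₀ 1)))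
    (l * (I * _root_.cis (k * x₀ 0 + l * x₀ 1))) := by
  refine ⟨rfl, ?_⟩
  have h1 : HasFDerivAt (fun x : Plane => k * x 0 + l * x 1) _ x₀ :=
    ((hasFDerivAt_coord x₀ 0).const_mul k).add ((hasFDerivAt_coord x₀ 1).const_mul l)
  have h2 : HasDerivAt _root_.cis (I * _root_.cis (k * x₀ 0 + l * x₀ 1)) (k * x₀ 0 + l * x₀ 1) := by
    have h3 := ((hasDerivAt_id (k * x₀ 0 + l * x₀ 1)).ofReal_comp.mul_const I).cexp
    simp only [id_eq, ofReal_one, one_mul] at h3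
    rw [mul_comm] at h3
    exact h3
  refine (h2.hasFDerivAt.comp x₀ h1).congr_fderiv (ContinuousLinearMap.ext fun v => ?_)
  simp [jet_apply]
  ring

lemma hasFDerivAt_legLength (i j : Fin 2) (hs : Real.sin (x₀ i + x₀ j) ≠ 0) :
    HasFDerivAt (fun x : Plane => legLength (x i) (x j))
      ((-(Real.sin (x₀ j) * Real.cos (x₀ i + x₀ j)) / Real.sin (x₀ i + x₀ j) ^ 2) •
          EuclideanSpace.proj (𝕜 := ℝ) i +
        (Real.sin (x₀ i) / Real.sin (x₀ i + x₀ j) ^ 2) • EuclideanSpace.proj (𝕜 := ℝ) j) x₀ := by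
  have h1 : HasFDerivAt (fun x : Plane => Real.sin (x j)) _ x₀ := (hasFDerivAt_coord x₀ j).sin
  have h2 : HasFDerivAt (fun x : Plane => Real.sin (x i + x j)) _ x₀ :=
    ((hasFDerivAt_coord x₀ i).add (hasFDerivAt_coord x₀ j)).sin
  have h3 : HasFDerivAt (fun x : Plane => (Real.sin (x i + x j))⁻¹) _ x₀ :=
    (hasDerivAt_inv hs).comp_hasFDerivAt x₀ h2
  refine (h1.mul h3).congr_fderiv (ContinuousLinearMap.ext fun v => ?_)
  have h5 : Real.sin (x₀ i) = Real.sin (x₀ i + x₀ j) * Real.cos (x₀ j) -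
      Real.cos (x₀ i + x₀ j) * Real.sin (x₀ j) := by
    rw [← Real.sin_sub, add_sub_cancel_right]
  rw [h5]
  simp only [Pi.add_apply, add_apply, smul_apply, PiLp.proj_apply, smul_eq_mul]
  field_simp
  ring

lemma HasJet.ofReal {r : Plane → ℝ} {p q : ℝ}
    (h : HasFDerivAt r (p • EuclideanSpace.proj (𝕜 := ℝ) 0 + q • EuclideanSpace.proj (𝕜 := ℝ) 1)
      x₀) : HasJet (fun x => (r x : ℂ)) x₀ (r x₀ : ℝ) p q := by
  refine ⟨rfl, (ofRealCLM.hasFDerivAt.comp x₀ h).congr_fderiv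
    (ContinuousLinearMap.ext fun v => ?_)⟩
  simp [jet_apply]
  ring

/-- A function with a real value at the base point has positive imaginary part in a quadrant on
which the imaginary part of the differential is positive. -/
lemma HasJet.eventually_im_pos (hf : HasJet f x₀ z A B) (hz : z.im = 0) (hA : A.im < 0)
    (hB : 0 < B.im) : ∀ᶠ x in 𝓝 x₀, x 0 < x₀ 0 → x₀ 1 ≤ x 1 → 0 < (f x).im := by
  obtain ⟨m, hm, hmA, hmB⟩ : ∃ m > 0, m ≤ -A.im ∧ m ≤ B.im :=
    ⟨min (-A.im) B.im, lt_min (by linarith) hB, min_le_left _ _, min_le_right _ _⟩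
  filter_upwards [hf.deriv.isLittleO.def (half_pos hm)] with x hx h0 h1
  rw [jet_apply, hf.value] at hx
  have h2 := (abs_im_le_norm _).trans hx
  have h3 : ‖x - x₀‖ ≤ (x₀ 0 - x 0) + (x 1 - x₀ 1) := by
    rw [EuclideanSpace.norm_eq]
    refine Real.sqrt_le_iff.2 ⟨by linarith, ?_⟩
    simp only [Fin.sum_univ_two, PiLp.sub_apply, Real.norm_eq_abs, sq_abs]
    nlinarith
  have h4 := (abs_le.1 h2).1
  simp only [sub_im, add_im, im_ofReal_mul, PiLp.sub_apply, hz] at h4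
  nlinarith

end Jets

section FirstOrder

variable {n : ℕ} {b : ℝ} {x₀ : Plane}

lemma HasJet.cis_of_eq {f : Plane → ℂ} {k l φ : ℝ} (hf : ∀ x, f x = _root_.cis (k * x 0 + l * x 1))
    (hφ : k * x₀ 0 + l * x₀ 1 = φ) :
    HasJet f x₀ (_root_.cis φ) (k * (I * _root_.cis φ)) (l * (I * _root_.cis φ)) := by
  rw [funext hf, ← hφ]
  exact HasJet.cis k l

lemma HasJet.cis_of_eq_neg {f : Plane → ℂ} {k l φ : ℝ}
    (hf : ∀ x, f x = -_root_.cis (k * x 0 + l * x 1))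
    (hφ : _root_.cis (k * x₀ 0 + l * x₀ 1) = -_root_.cis φ) :
    HasJet f x₀ (_root_.cis φ) (k * (I * _root_.cis φ)) (l * (I * _root_.cis φ)) := by
  rw [funext hf]
  refine (HasJet.cis k l).neg.congr_jet ?_ ?_ ?_ <;> rw [hφ] <;> ring

/-- The jets of the edges: they turn at the rate that the coefficients of `α` and `β` give. -/
lemma hasJet_edge (h : SmallAngle n b) (h0 : x₀ 0 = b) (h1 : x₀ 1 = b) :
    HasJet (fun x => edge n (x 0) (x 1) 0) x₀ (cis 0) ((0 : ℝ) * (I * cis 0))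
      ((0 : ℝ) * (I * cis 0)) ∧
    HasJet (fun x => edge n (x 0) (x 1) 1) x₀ (cis (2 * b)) ((0 : ℝ) * (I * cis (2 * b)))
      ((-(2 * n - 2) : ℝ) * (I * cis (2 * b))) ∧
    HasJet (fun x => edge n (x 0) (x 1) 2) x₀ (cis 0) ((2 * n - 2 : ℝ) * (I * cis 0))
      ((-(2 * n - 2) : ℝ) * (I * cis 0)) ∧
    HasJet (fun x => edge n (x 0) (x 1) 3) x₀ (cis 0) ((2 * n - 2 : ℝ) * (I * cis 0))
      ((2 : ℝ) * (I * cis 0)) ∧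
    HasJet (fun x => edge n (x 0) (x 1) 4) x₀ (cis (2 * b)) ((0 : ℝ) * (I * cis (2 * b)))
      ((2 : ℝ) * (I * cis (2 * b))) ∧
    HasJet (fun x => edge n (x 0) (x 1) 5) x₀ (cis (-(2 * b))) ((0 : ℝ) * (I * cis (-(2 * b))))
      ((2 * n - 2 : ℝ) * (I * cis (-(2 * b)))) ∧
    HasJet (fun x => edge n (x 0) (x 1) 6) x₀ (cis (4 * b)) ((-(2 * n - 6) : ℝ) * (I * cis (4 * b)))
      ((2 * n - 2 : ℝ) * (I * cis (4 * b))) ∧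
    HasJet (fun x => edge n (x 0) (x 1) 7) x₀ (cis (-(2 * b)))
      ((-(2 * n - 6) : ℝ) * (I * cis (-(2 * b)))) ((4 * n - 8 : ℝ) * (I * cis (-(2 * b)))) ∧
    HasJet (fun x => edge n (x 0) (x 1) 8) x₀ (cis (2 * b))
      ((-(4 * n - 10) : ℝ) * (I * cis (2 * b))) ((4 * n - 8 : ℝ) * (I * cis (2 * b))) ∧
    HasJet (fun x => edge n (x 0) (x 1) 9) x₀ (cis 0)
      ((-(4 * n - 10) : ℝ) * (I * cis 0)) ((6 * n - 10 : ℝ) * (I * cis 0)) := by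
  have hn := h.mul_eq
  refine ⟨?_, ?_, ?_, ?_, ?_, ?_, ?_, ?_, ?_, ?_⟩
  · refine HasJet.cis_of_eq (fun x => ?_) (by ring)
    rw [edge]; simp [cis_zero]
  · refine HasJet.cis_of_eq_neg (fun x => ?_) (cis_eq_neg_of_sub ?_)
    · rw [edge]; ring_nf
    · rw [h0, h1]; linear_combination -hn
  · refine HasJet.cis_of_eq (fun x => ?_) (by rw [h0, h1]; ring)
    rw [edge]; ring_nf
  · refine HasJet.cis_of_eq_neg (fun x => ?_) (cis_eq_neg_of_add ?_)
    · rw [edge]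
    · rw [h0, h1]; linear_combination hn
  · refine HasJet.cis_of_eq (fun x => ?_) (by rw [h0, h1]; ring)
    rw [edge]; ring_nf
  · refine HasJet.cis_of_eq_neg (fun x => ?_) (cis_eq_neg_of_add ?_)
    · rw [edge]; ring_nf
    · rw [h0, h1]; linear_combination hn
  · refine HasJet.cis_of_eq (fun x => ?_) (by rw [h0, h1]; ring)
    rw [edge]; ring_nf
  · refine HasJet.cis_of_eq_neg (fun x => ?_) (cis_eq_neg_of_add ?_)
    · rw [edge]; ring_nf
    · rw [h0, h1]; linear_combination hn
  · refine HasJet.cis_of_eq (fun x => ?_) (by rw [h0, h1]; ring)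
    rw [edge]; ring_nf
  · refine HasJet.cis_of_eq_neg (fun x => ?_) (cis_eq_neg_of_add ?_)
    · rw [edge]; ring_nf
    · rw [h0, h1]; linear_combination hn

lemma height_I_mul (S z : ℂ) : height S 0 (I * z) = (z * conj S).re := by
  rw [height, mul_assoc, sub_zero, mul_comm, mul_I_im]

/-- The rates at which the heights over the base line of the second word change under turns. -/
lemma re_mul_conj_dirTwo (b θ : ℝ) : (cis θ * conj (dirTwo b)).re =
    Real.cos (θ - 3 * b) + 2 * Real.cos (θ - b) + 2 * Real.cos (θ + b) := by
  have h (φ : ℝ) : (cis θ * conj (cis φ)).re = Real.cos (θ - φ) := by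
    rw [conj_cis, ← cis_add, cis_re, sub_eq_add_neg]
  have h2 (z : ℂ) : (cis θ * (2 * z)).re = 2 * (cis θ * z).re := by
    rw [mul_left_comm, ← ofReal_ofNat, re_ofReal_mul]
  rw [dirTwo]
  simp only [map_add, map_mul, map_ofNat, mul_add, add_re, h, h2, sub_neg_eq_add]

lemma cos_multiples (b : ℝ) : Real.cos (2 * b) = 2 * Real.cos b ^ 2 - 1 ∧
    Real.cos (3 * b) = 4 * Real.cos b ^ 3 - 3 * Real.cos b ∧
    Real.cos (4 * b) = 8 * Real.cos b ^ 4 - 8 * Real.cos b ^ 2 + 1 ∧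
    Real.cos (5 * b) = 16 * Real.cos b ^ 5 - 20 * Real.cos b ^ 3 + 5 * Real.cos b ∧
    Real.cos (6 * b) = 32 * Real.cos b ^ 6 - 48 * Real.cos b ^ 4 + 18 * Real.cos b ^ 2 - 1 ∧
    Real.cos (7 * b) =
      64 * Real.cos b ^ 7 - 112 * Real.cos b ^ 5 + 56 * Real.cos b ^ 3 - 7 * Real.cos b := by
  have key : ∀ k : ℝ, Real.cos ((k + 1) * b) =
      2 * Real.cos b * Real.cos (k * b) - Real.cos ((k - 1) * b) := by
    intro k
    rw [show (k + 1) * b = k * b + b by ring, show (k - 1) * b = k * b - b by ring,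
      Real.cos_add, Real.cos_sub]
    ring
  have e2 := Real.cos_two_mul b
  have e3 := Real.cos_three_mul b
  have e4 := key 3
  have e5 := key 4
  have e6 := key 5
  have e7 := key 6
  norm_num only at e4 e5 e6 e7
  rw [e2, e3] at e4
  rw [e4, e3] at e5
  rw [e5, e4] at e6
  rw [e6, e5] at e7
  refine ⟨e2, e3, ?_, ?_, ?_, ?_⟩
  · rw [e4]; ring
  · rw [e5]; ring
  · rw [e6]; ring
  · rw [e7]; ring

/-- The rates `re_mul_conj_dirTwo` in the directions that occur, as polynomials in `cos b`. -/
lemma re_mul_conj_dirTwo_multiples (b : ℝ) :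
    (cis 0 * conj (dirTwo b)).re = 4 * Real.cos b ^ 3 + Real.cos b ∧
    (cis (2 * b) * conj (dirTwo b)).re = 8 * Real.cos b ^ 3 - 3 * Real.cos b ∧
    (cis (-(2 * b)) * conj (dirTwo b)).re =
      16 * Real.cos b ^ 5 - 12 * Real.cos b ^ 3 + Real.cos b ∧
    (cis (4 * b) * conj (dirTwo b)).re =
      32 * Real.cos b ^ 5 - 32 * Real.cos b ^ 3 + 5 * Real.cos b ∧
    (cis (-b) * conj (dirTwo b)).re = 8 * Real.cos b ^ 4 - 4 * Real.cos b ^ 2 + 1 ∧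
    (cis (-(3 * b)) * conj (dirTwo b)).re =
      32 * Real.cos b ^ 6 - 32 * Real.cos b ^ 4 + 6 * Real.cos b ^ 2 - 1 := by
  obtain ⟨e2, e3, e4, e5, e6, -⟩ := cos_multiples b
  simp only [re_mul_conj_dirTwo]
  refine ⟨?_, ?_, ?_, ?_, ?_, ?_⟩
  · rw [zero_sub, zero_sub, Real.cos_neg, Real.cos_neg, zero_add, e3]
    ring
  · rw [show 2 * b - 3 * b = -b by ring, show 2 * b - b = b by ring, show 2 * b + b = 3 * b by ring,
      Real.cos_neg, e3]
    ring
  · rw [show -(2 * b) - 3 * b = -(5 * b) by ring, show -(2 * b) - b = -(3 * b) by ring,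
      show -(2 * b) + b = -b by ring, Real.cos_neg, Real.cos_neg, Real.cos_neg, e3, e5]
    ring
  · rw [show 4 * b - 3 * b = b by ring, show 4 * b - b = 3 * b by ring,
      show 4 * b + b = 5 * b by ring, e3, e5]
    ring
  · rw [show -b - 3 * b = -(4 * b) by ring, show -b - b = -(2 * b) by ring, neg_add_cancel,
      Real.cos_neg, Real.cos_neg, Real.cos_zero, e2, e4]
    ring
  · rw [show -(3 * b) - 3 * b = -(6 * b) by ring, show -(3 * b) - b = -(4 * b) by ring,
      show -(3 * b) + b = -(2 * b) by ring, Real.cos_neg, Real.cos_neg, Real.cos_neg, e2, e4, e6]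
    ring

end FirstOrder

/-! ### First-order expansions of the pivots -/

section FirstOrder

variable {n : ℕ} {b : ℝ} {x₀ : Plane}

lemma two_cos_mul_cis (b θ : ℝ) :
    (2 * Real.cos b : ℝ) * cis θ = cis (θ + b) + cis (θ - b) := by
  apply Complex.ext <;>
    simp only [re_ofReal_mul, im_ofReal_mul, add_re, add_im, cis_re, cis_im, Real.cos_add,
      Real.cos_sub, Real.sin_add, Real.sin_sub] <;> ring

lemma SmallAngle.mul_sq_pos (h : SmallAngle n b) : 0 < 4 * (Real.sin b * Real.cos b ^ 2) := by
  have h1 := h.sin_pos one_pos (by norm_num)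
  have h2 := h.cos_pos
  rw [one_mul] at h1
  positivity

/-- The derivatives of the lengths of the short sides at the base point are `1 / (4 sin b cos² b)`
and `-cos (2 b) / (4 sin b cos² b)`. -/
lemma hasJet_legLength (h : SmallAngle n b) (h0 : x₀ 0 = b) (h1 : x₀ 1 = b) :
    ∃ r : ℝ, r * (4 * (Real.sin b * Real.cos b ^ 2)) = 1 ∧
      HasJet (fun x => (legLength (x 0) (x 1) : ℂ)) x₀ (legLength b b : ℝ)
        (-(r * Real.cos (2 * b)) : ℝ) (r : ℝ) ∧
      HasJet (fun x => (legLength (x 1) (x 0) : ℂ)) x₀ (legLength b b : ℝ)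
        (r : ℝ) (-(r * Real.cos (2 * b)) : ℝ) := by
  have hs := h.sin_add_ne
  have hne := h.mul_sq_pos.ne'
  have j1 := hasFDerivAt_legLength (x₀ := x₀) 0 1 (by rwa [h0, h1])
  have j2 := hasFDerivAt_legLength (x₀ := x₀) 1 0 (by rwa [h0, h1])
  rw [add_comm] at j2
  have j1 := HasJet.ofReal j1
  have j2 := HasJet.ofReal j2
  rw [h0, h1] at j1 j2
  refine ⟨Real.sin b / Real.sin (b + b) ^ 2, ?_, ?_, ?_⟩
  · rw [← two_mul, Real.sin_two_mul]
    have hs1 : Real.sin b ≠ 0 := left_ne_zero_of_mul (right_ne_zero_of_mul hne)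
    have hc1 := h.cos_pos.ne'
    field_simp
    norm_num
  · refine j1.congr_jet rfl ?_ rfl
    rw [← two_mul]
    congr 1
    ring
  · refine j2.congr_jet rfl rfl ?_
    rw [← two_mul]
    congr 1
    ring

lemma height_dirTwo_neg (b : ℝ) :
    height (dirTwo b) 0 (cis (-b)) = -(8 * Real.sin b * Real.cos b ^ 3) ∧
    height (dirTwo b) 0 (cis (-(3 * b))) = -(2 * Real.sin b * (16 * Real.cos b ^ 5 -
      8 * Real.cos b ^ 3 + Real.cos b)) := by
  have s2 := Real.sin_two_mul b
  have s4 : Real.sin (4 * b) = 4 * Real.sin b * Real.cos b * Real.cos (2 * b) := by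
    rw [show 4 * b = 2 * (2 * b) by ring, Real.sin_two_mul, s2]; ring
  have s6 : Real.sin (6 * b) = 2 * Real.sin (3 * b) * Real.cos (3 * b) := by
    rw [show 6 * b = 2 * (3 * b) by ring, Real.sin_two_mul]
  have s3 : Real.sin (3 * b) = Real.sin b * (4 * Real.cos b ^ 2 - 1) := by
    rw [Real.sin_three_mul, Real.cos_sq']; ring
  obtain ⟨e2, e3, -⟩ := cos_multiples b
  simp only [height_dirTwo]
  constructor
  · rw [show -b - 3 * b = -(4 * b) by ring, show -b - b = -(2 * b) by ring, neg_add_cancel,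
      Real.sin_neg, Real.sin_neg, Real.sin_zero, s4, s2, e2]
    ring
  · rw [show -(3 * b) - 3 * b = -(6 * b) by ring, show -(3 * b) - b = -(4 * b) by ring,
      show -(3 * b) + b = -(2 * b) by ring, Real.sin_neg, Real.sin_neg, Real.sin_neg, s6, s4, s2,
      s3, e2, e3]
    ring

/-- The first-order behaviour of the last pivot. -/
lemma hasJet_joint_ten (h : SmallAngle n b) (h0 : x₀ 0 = b) (h1 : x₀ 1 = b) :
    ∃ A B : ℂ, HasJet (fun x => joint n (x 0) (x 1) 10) x₀
      ((2 * Real.cos b : ℝ) * dirTwo b) A B ∧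
      height (dirTwo b) 0 A = (72 - 18 * n) * Real.cos b + (50 - 16 * n) * Real.cos (3 * b) +
        (18 - 6 * n) * Real.cos (5 * b) ∧
      height (dirTwo b) 0 B = (36 * n - 58) * Real.cos b + (24 * n - 38) * Real.cos (3 * b) +
        (10 * n - 14) * Real.cos (5 * b) := by
  obtain ⟨e0, e1, e2, e3, e4, e5, e6, e7, e8, e9⟩ := hasJet_edge h h0 h1
  obtain ⟨r0, r2, r2', r4, -, -⟩ := re_mul_conj_dirTwo_multiples b
  obtain ⟨c2, c3, c4, c5, -⟩ := cos_multiples b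
  have key := ((((((((e0.add e1).add e2).add e3).add e4).add e5).add e6).add e7).add e8).add e9
  have hf : (fun x : Plane => joint n (x 0) (x 1) 10) = fun x => edge n (x 0) (x 1) 0 +
      edge n (x 0) (x 1) 1 + edge n (x 0) (x 1) 2 + edge n (x 0) (x 1) 3 + edge n (x 0) (x 1) 4 +
      edge n (x 0) (x 1) 5 + edge n (x 0) (x 1) 6 + edge n (x 0) (x 1) 7 + edge n (x 0) (x 1) 8 +
      edge n (x 0) (x 1) 9 := by
    funext x
    simp only [joint, Finset.sum_range_succ, Finset.sum_range_zero, zero_add]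
  rw [← hf] at key
  refine ⟨_, _, key.congr_jet ?_ rfl rfl, ?_, ?_⟩
  · rw [dirTwo, mul_add, mul_add, mul_left_comm _ 2, mul_left_comm _ 2, two_cos_mul_cis,
      two_cos_mul_cis, two_cos_mul_cis]
    ring_nf
  · simp only [height_zero_add, height_zero_ofReal_mul, height_I_mul, r0, r2, r2', r4, c3, c5]
    ring
  · simp only [height_zero_add, height_zero_ofReal_mul, height_I_mul, r0, r2, r2', r4, c3, c5]
    ring

/-- The first-order behaviour of the first of the two obtuse vertices on the base line. -/
lemma hasJet_apexOne (h : SmallAngle n b) (h0 : x₀ 0 = b) (h1 : x₀ 1 = b) :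
    ∃ A B : ℂ, HasJet (fun x => apexOne n (x 0) (x 1)) x₀ (legLength b b * dirTwo b) A B ∧
      4 * Real.cos b ^ 2 * height (dirTwo b) 0 A = (12 * n - 14) * Real.cos b +
        (6 * n - 6) * Real.cos (3 * b) + (2 * n - 2) * Real.cos (5 * b) ∧
      4 * Real.cos b ^ 2 * height (dirTwo b) 0 B = (28 - 34 * n) * Real.cos b +
        (18 - 20 * n) * Real.cos (3 * b) + (6 - 6 * n) * Real.cos (5 * b) := by
  obtain ⟨e0, e1, -⟩ := hasJet_edge h h0 h1
  obtain ⟨r0, r2, r2', r4, r1', -⟩ := re_mul_conj_dirTwo_multiples b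
  obtain ⟨c2, c3, c4, c5, -⟩ := cos_multiples b
  obtain ⟨g1, -⟩ := height_dirTwo_neg b
  obtain ⟨r, hr, l1, -⟩ := hasJet_legLength h h0 h1
  have hl := h.leg_mul
  have hc : HasJet (fun x => cis ((2 * n - 3) * x 0 - (2 * n - 2) * x 1)) x₀ _ _ _ :=
    HasJet.cis_of_eq (k := 2 * n - 3) (l := -(2 * n - 2)) (φ := -b) (fun x => by ring_nf)
      (by rw [h0, h1]; ring)
  have key := (e0.add e1).add (l1.mul hc)
  have hf : (fun x : Plane => apexOne n (x 0) (x 1)) = fun x => edge n (x 0) (x 1) 0 +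
      edge n (x 0) (x 1) 1 + legLength (x 0) (x 1) *
        cis ((2 * n - 3) * x 0 - (2 * n - 2) * x 1) := by
    funext x
    simp only [apexOne, joint, Finset.sum_range_succ, Finset.sum_range_zero, zero_add]
  rw [← hf] at key
  refine ⟨_, _, key.congr_jet ?_ rfl rfl, ?_, ?_⟩
  · have hl' : (legLength b b : ℂ) * (2 * Real.cos b : ℝ) = 1 := by exact_mod_cast hl
    have t0 := two_cos_mul_cis b 0
    have t2 := two_cos_mul_cis b (2 * b)
    rw [show 0 + b = b by ring, show 0 - b = -b by ring] at t0
    rw [show 2 * b + b = 3 * b by ring, show 2 * b - b = b by ring] at t2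
    rw [dirTwo]
    linear_combination -(cis 0 + cis (2 * b)) * hl' + (legLength b b : ℂ) * (t0 + t2)
  · simp only [height_zero_add, height_zero_ofReal_mul, height_I_mul, r0, r2, r1', g1, c2, c3, c5]
    linear_combination 8 * Real.cos b ^ 3 * (2 * Real.cos b ^ 2 - 1) * hr +
      2 * Real.cos b * (2 * n - 3) * (8 * Real.cos b ^ 4 - 4 * Real.cos b ^ 2 + 1) * hl
  · simp only [height_zero_add, height_zero_ofReal_mul, height_I_mul, r0, r2, r1', g1, c3, c5]
    linear_combination -8 * Real.cos b ^ 3 * hr -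
      2 * Real.cos b * (2 * n - 2) * (8 * Real.cos b ^ 4 - 4 * Real.cos b ^ 2 + 1) * hl

/-- The first-order behaviour of the second of the two obtuse vertices on the base line. -/
lemma hasJet_joint_ten_sub_apexTwo (h : SmallAngle n b) (h0 : x₀ 0 = b) (h1 : x₀ 1 = b) :
    ∃ A B : ℂ, HasJet (fun x => joint n (x 0) (x 1) 10 - apexTwo n (x 0) (x 1)) x₀
      (legLength b b * dirTwo b) A B ∧
      4 * Real.cos b ^ 2 * height (dirTwo b) 0 A = (286 - 108 * n) * Real.cos b +
        (154 - 58 * n) * Real.cos (3 * b) + (38 - 14 * n) * Real.cos (5 * b) ∧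
      4 * Real.cos b ^ 2 * height (dirTwo b) 0 B = (146 * n - 272) * Real.cos b +
        (76 * n - 142) * Real.cos (3 * b) + (18 * n - 34) * Real.cos (5 * b) := by
  obtain ⟨-, -, -, -, -, -, -, e7, e8, e9⟩ := hasJet_edge h h0 h1
  obtain ⟨r0, r2, r2', -, -, r3'⟩ := re_mul_conj_dirTwo_multiples b
  obtain ⟨c2, c3, c4, c5, -⟩ := cos_multiples b
  obtain ⟨-, g3⟩ := height_dirTwo_neg b
  obtain ⟨r, hr, -, l2⟩ := hasJet_legLength h h0 h1
  have hl := h.leg_mul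
  have hn := h.mul_eq
  have hc : HasJet (fun x => -cis ((4 * n - 9) * x 1 - (2 * n - 6) * x 0)) x₀ _ _ _ :=
    HasJet.cis_of_eq_neg (k := -(2 * n - 6)) (l := 4 * n - 9) (φ := -(3 * b))
      (fun x => by ring_nf) (cis_eq_neg_of_add (by rw [h0, h1]; linear_combination hn))
  have key := ((e7.add e8).add e9).sub (l2.mul hc)
  have hf : (fun x : Plane => joint n (x 0) (x 1) 10 - apexTwo n (x 0) (x 1)) =
      fun x => edge n (x 0) (x 1) 7 + edge n (x 0) (x 1) 8 + edge n (x 0) (x 1) 9 -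
        legLength (x 1) (x 0) * -cis ((4 * n - 9) * x 1 - (2 * n - 6) * x 0) := by
    funext x
    rw [apexTwo, joint_succ _ _ _ 9, joint_succ _ _ _ 8, joint_succ _ _ _ 7]
    ring
  rw [← hf] at key
  refine ⟨_, _, key.congr_jet ?_ rfl rfl, ?_, ?_⟩
  · have hl' : (legLength b b : ℂ) * (2 * Real.cos b : ℝ) = 1 := by exact_mod_cast hl
    have t0 := two_cos_mul_cis b 0
    have t2 := two_cos_mul_cis b (2 * b)
    have t2' := two_cos_mul_cis b (-(2 * b))
    rw [show 0 + b = b by ring, show 0 - b = -b by ring] at t0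
    rw [show 2 * b + b = 3 * b by ring, show 2 * b - b = b by ring] at t2
    rw [show -(2 * b) + b = -b by ring, show -(2 * b) - b = -(3 * b) by ring] at t2'
    rw [dirTwo]
    linear_combination -(cis (-(2 * b)) + cis (2 * b) + cis 0) * hl' +
      (legLength b b : ℂ) * (t0 + t2 + t2')
  · simp only [height_zero_add, height_zero_sub, height_zero_ofReal_mul, height_I_mul, r0, r2, r2',
      r3', g3, c3, c5]
    linear_combination 2 * (16 * Real.cos b ^ 5 - 8 * Real.cos b ^ 3 + Real.cos b) * hr +
      2 * Real.cos b * (2 * n - 6) *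
        (32 * Real.cos b ^ 6 - 32 * Real.cos b ^ 4 + 6 * Real.cos b ^ 2 - 1) * hl
  · simp only [height_zero_add, height_zero_sub, height_zero_ofReal_mul, height_I_mul, r0, r2, r2',
      r3', g3, c2, c3, c5]
    linear_combination -2 * (2 * Real.cos b ^ 2 - 1) *
      (16 * Real.cos b ^ 5 - 8 * Real.cos b ^ 3 + Real.cos b) * hr -
      2 * Real.cos b * (4 * n - 9) *
        (32 * Real.cos b ^ 6 - 32 * Real.cos b ^ 4 + 6 * Real.cos b ^ 2 - 1) * hl

end FirstOrder

/-! ### The second word -/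

section WordTwo

variable {n : ℕ} {b : ℝ} {x₀ : Plane} {f g : Plane → ℂ} {S A B A' B' : ℂ} {u v : ℝ}

lemma HasJet.mul_conj_of_parallel (hf : HasJet f x₀ (u * S) A B) (hg : HasJet g x₀ (v * S) A' B') :
    ∃ A'' B'' : ℂ, HasJet (fun x => f x * conj (g x)) x₀ (u * v * normSq S : ℝ) A'' B'' ∧
      A''.im = v * height S 0 A - u * height S 0 A' ∧
      B''.im = v * height S 0 B - u * height S 0 B' := by
  have h1 (w : ℂ) (r : ℝ) : (w * conj (r * S)).im = r * height S 0 w := by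
    rw [map_mul, conj_ofReal, mul_left_comm, im_ofReal_mul, height, sub_zero]
  have h2 (w : ℂ) (r : ℝ) : (r * S * conj w).im = -(r * height S 0 w) := by
    rw [← h1, ← conj_im, map_mul, conj_conj, mul_comm]
  refine ⟨_, _, (hf.mul hg.conj).congr_jet ?_ rfl rfl, ?_, ?_⟩
  · rw [map_mul, conj_ofReal, mul_mul_mul_comm, mul_conj]
    push_cast
    ring
  · rw [add_im, h1, h2, sub_eq_add_neg]
  · rw [add_im, h1, h2, sub_eq_add_neg]

lemma SmallAngle.half_lt_cos_sq (h : SmallAngle n b) : 1 / 2 < Real.cos b ^ 2 := by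
  have h1 := h.le
  have h2 := h.pos
  have : 0 < Real.cos (2 * b) := Real.cos_pos_of_mem_Ioo ⟨by linarith, by linarith⟩
  rw [Real.cos_two_mul] at this
  linarith

lemma normSq_dirTwo (b : ℝ) :
    normSq (dirTwo b) = 32 * Real.cos b ^ 4 - 8 * Real.cos b ^ 2 + 1 := by
  have h1 : dirTwo b = ⟨Real.cos (3 * b) + 4 * Real.cos b, Real.sin (3 * b)⟩ := by
    apply Complex.ext
    · simp only [dirTwo, add_re, mul_re, re_ofNat, im_ofNat, cis_re, Real.cos_neg]
      ring
    · simp only [dirTwo, add_im, mul_im, re_ofNat, im_ofNat, cis_im, Real.sin_neg]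
      ring
  rw [h1, normSq_mk]
  linear_combination Real.sin_sq_add_cos_sq (3 * b) + 8 * Real.cos b * Real.cos_three_mul b

lemma SmallAngle.cos_facts (h : SmallAngle n b) : 0 < Real.cos (3 * b) ∧
    0 < Real.cos b + Real.cos (5 * b) ∧ Real.cos (5 * b) ≤ Real.cos b ∧
    Real.cos (7 * b) ≤ Real.cos b := by
  have hle := h.le
  have hbpos := h.pos
  have c3 : 0 < Real.cos (3 * b) := Real.cos_pos_of_mem_Ioo ⟨by linarith, by linarith⟩
  refine ⟨c3, ?_, ?_, ?_⟩
  · have c2 : 0 < Real.cos (2 * b) := Real.cos_pos_of_mem_Ioo ⟨by linarith, by linarith⟩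
    have : Real.cos b + Real.cos (5 * b) = 2 * Real.cos (3 * b) * Real.cos (2 * b) := by
      rw [add_comm, Real.cos_add_cos]; ring_nf
    rw [this]
    positivity
  · exact Real.cos_le_cos_of_nonneg_of_le_pi hbpos.le (by linarith) (by linarith)
  · exact Real.cos_le_cos_of_nonneg_of_le_pi hbpos.le (by linarith) (by linarith)

lemma SmallAngle.comb_pos (h : SmallAngle n b) {p q r : ℝ} (hr : 0 < r) (hpr : r ≤ p)
    (hq : 0 ≤ q) : 0 < p * Real.cos b + q * Real.cos (3 * b) + r * Real.cos (5 * b) := by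
  obtain ⟨c3, c15, -, -⟩ := h.cos_facts
  have h1 := mul_pos hr c15
  have h2 := mul_nonneg (sub_nonneg.2 hpr) h.cos_pos.le
  have h3 := mul_nonneg hq c3.le
  linarith

/-- The sign that makes room for the line when the first angle decreases. -/
lemma SmallAngle.comb_neg (h : SmallAngle n b) : (300 - 74 * n) * Real.cos b +
    (160 - 30 * n) * Real.cos (3 * b) + 40 * Real.cos (5 * b) + 4 * n * Real.cos (7 * b) < 0 := by
  obtain ⟨c3, c15, c51, c71⟩ := h.cos_facts
  have hc := h.cos_pos
  have hn := h.mul_eq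
  have h4 := h.four_le
  rcases h4.lt_or_eq with h5 | rfl
  · rcases (Nat.succ_le_of_lt h5).lt_or_eq with h6 | rfl
    · have h6' : (6 : ℝ) ≤ n := by exact_mod_cast h6
      have i1 := mul_nonneg (sub_nonneg.2 h6') hc.le
      have i2 := mul_nonneg (sub_nonneg.2 h6') c3.le
      have i3 := mul_nonneg (sub_nonneg.2 h6') (sub_nonneg.2 c71)
      linarith
    · -- here `10 b = π`
      have e5 : Real.cos (5 * b) = 0 := by
        rw [show 5 * b = Real.pi / 2 by push_cast at hn; linarith, Real.cos_pi_div_two]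
      have e7 : Real.cos (7 * b) = -Real.cos (3 * b) := by
        rw [← Real.cos_pi_sub]
        congr 1
        push_cast at hn
        linarith
      rw [e5, e7]
      push_cast
      linarith
  · -- here `8 b = π`
    have e5 : Real.cos (5 * b) = -Real.cos (3 * b) := by
      rw [← Real.cos_pi_sub]
      congr 1
      push_cast at hn
      linarith
    have e7 : Real.cos (7 * b) = -Real.cos b := by
      rw [← Real.cos_pi_sub]
      congr 1
      push_cast at hn
      linarith
    rw [e5, e7]
    push_cast
    linarith

lemma im_mul_one_sub_cis (z : ℂ) (Q : ℝ) :
    (z * (1 - cis Q)).im = z.im * (1 - Real.cos Q) - z.re * Real.sin Q := by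
  simp only [mul_im, sub_re, sub_im, one_re, one_im, cis_re, cis_im]
  ring

/-- When the first angle decreases and the second one does not, the two obtuse vertices move to the
right of the line from the origin to the last pivot, and far enough to leave room for a line that
has them on its right on both passages of the core. -/
lemma eventually_im_signs (h : SmallAngle n b) (h0 : x₀ 0 = b) (h1 : x₀ 1 = b) :
    ∀ᶠ x in 𝓝 x₀, x 0 < b → b ≤ x 1 →
      (apexOne n (x 0) (x 1) * conj (joint n (x 0) (x 1) 10)).im < 0 ∧
      0 < ((joint n (x 0) (x 1) 10 - apexTwo n (x 0) (x 1)) * conj (joint n (x 0) (x 1) 10)).im ∧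
      0 < ((joint n (x 0) (x 1) 10 * conj (joint n (x 0) (x 1) 10) -
        conj ((joint n (x 0) (x 1) 10 - apexTwo n (x 0) (x 1)) * conj (joint n (x 0) (x 1) 10)) -
        apexOne n (x 0) (x 1) * conj (joint n (x 0) (x 1) 10)) * (1 - cis (2 * n * x 0))).im := by
  obtain ⟨A, B, jD, hA, hB⟩ := hasJet_joint_ten h h0 h1
  obtain ⟨A₁, B₁, j₁, hA₁, hB₁⟩ := hasJet_apexOne h h0 h1
  obtain ⟨A₂, B₂, j₂, hA₂, hB₂⟩ := hasJet_joint_ten_sub_apexTwo h h0 h1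
  obtain ⟨a₁, b₁, p₁, ha₁, hb₁⟩ := j₁.mul_conj_of_parallel jD
  obtain ⟨a₂, b₂, p₂, ha₂, hb₂⟩ := j₂.mul_conj_of_parallel jD
  obtain ⟨a, b', p, ha, hb⟩ := jD.mul_conj_of_parallel jD
  have hn := h.mul_eq
  have hc := h.cos_pos
  have hl := h.leg_mul
  have h4 : (4 : ℝ) ≤ n := by exact_mod_cast h.four_le
  -- the partial derivatives of the imaginary parts, multiplied by `2 cos b`
  have ea₁ : 2 * Real.cos b * a₁.im = (30 * n - 86) * Real.cos b +
      (22 * n - 56) * Real.cos (3 * b) + (8 * n - 20) * Real.cos (5 * b) := by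
    linear_combination 2 * Real.cos b * ha₁ + hA₁ - hA - height (dirTwo b) 0 A * hl
  have eb₁ : 2 * Real.cos b * b₁.im = -((70 * n - 86) * Real.cos b +
      (44 * n - 56) * Real.cos (3 * b) + (16 * n - 20) * Real.cos (5 * b)) := by
    linear_combination 2 * Real.cos b * hb₁ + hB₁ - hB - height (dirTwo b) 0 B * hl
  have ea₂ : 2 * Real.cos b * a₂.im = -((90 * n - 214) * Real.cos b +
      (42 * n - 104) * Real.cos (3 * b) + (8 * n - 20) * Real.cos (5 * b)) := by
    linear_combination 2 * Real.cos b * ha₂ + hA₂ - hA - height (dirTwo b) 0 A * hl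
  have eb₂ : 2 * Real.cos b * b₂.im = (110 * n - 214) * Real.cos b +
      (52 * n - 104) * Real.cos (3 * b) + (8 * n - 20) * Real.cos (5 * b) := by
    linear_combination 2 * Real.cos b * hb₂ + hB₂ - hB - height (dirTwo b) 0 B * hl
  have pos_of (y : ℝ) (hy : 0 < 2 * Real.cos b * y) : 0 < y :=
    pos_of_mul_pos_right hy (by positivity)
  have na₁ : 0 < a₁.im := pos_of _ (by
    rw [ea₁]; exact h.comb_pos (by linarith) (by linarith) (by linarith))
  have nb₁ : 0 < -b₁.im := pos_of _ (by
    rw [mul_neg, eb₁, neg_neg]; exact h.comb_pos (by linarith) (by linarith) (by linarith))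
  have na₂ : 0 < -a₂.im := pos_of _ (by
    rw [mul_neg, ea₂, neg_neg]; exact h.comb_pos (by linarith) (by linarith) (by linarith))
  have nb₂ : 0 < b₂.im := pos_of _ (by
    rw [eb₂]; exact h.comb_pos (by linarith) (by linarith) (by linarith))
  have hcis : HasJet (fun x => cis (2 * n * x 0)) x₀ (-1) ((2 * n : ℝ) * (I * (-1)))
      ((0 : ℝ) * (I * (-1))) := by
    have e : cis Real.pi = -1 := by rw [cis_eq_neg_of_add (φ := 0) (by ring), cis_zero]
    rw [← e]
    exact HasJet.cis_of_eq (fun x => by ring_nf) (by rw [h0, h1]; linear_combination hn)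
  have key := ((p.sub p₂.conj).sub p₁).mul ((HasJet.const 1).sub hcis)
  have k₁ := p₁.neg.eventually_im_pos (by rw [neg_im, ofReal_im, neg_zero])
    (by rw [neg_im]; linarith) (by rw [neg_im]; linarith)
  have k₂ := p₂.eventually_im_pos (ofReal_im _) (by linarith) nb₂
  have two : (1 : ℂ) - -1 = (2 : ℝ) := by norm_num
  have z₀ : (((2 * Real.cos b * (2 * Real.cos b) * normSq (dirTwo b) : ℝ) : ℂ) -
      conj ((legLength b b * (2 * Real.cos b) * normSq (dirTwo b) : ℝ) : ℂ) -
      (legLength b b * (2 * Real.cos b) * normSq (dirTwo b) : ℝ)) =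
      ((4 * Real.cos b ^ 2 - 2) * normSq (dirTwo b) : ℝ) := by
    rw [conj_ofReal, hl]
    push_cast
    ring
  have im_mul_two (w : ℂ) : (w * (2 : ℝ)).im = 2 * w.im := by rw [mul_comm, im_ofReal_mul]
  have k₃ := key.eventually_im_pos
    (by rw [z₀, two, ← ofReal_mul, ofReal_im])
    (by
      have e : ((0 : ℂ) - (2 * n : ℝ) * (I * -1)) = (2 * n : ℝ) * I := by ring
      rw [z₀, two, e, add_im, im_mul_two, im_ofReal_mul, im_ofReal_mul, I_im, sub_im, sub_im,
        conj_im, ha, sub_self]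
      have e' := h.comb_neg
      rw [normSq_dirTwo]
      obtain ⟨c2, c3, -, c5, -, c7⟩ := cos_multiples b
      have : Real.cos b * (2 * (0 - -a₂.im - a₁.im) + (4 * Real.cos b ^ 2 - 2) *
          (32 * Real.cos b ^ 4 - 8 * Real.cos b ^ 2 + 1) * (2 * n * 1)) =
          (300 - 74 * n) * Real.cos b + (160 - 30 * n) * Real.cos (3 * b) +
          40 * Real.cos (5 * b) + 4 * n * Real.cos (7 * b) := by
        rw [c3, c5] at ea₁ ea₂
        rw [c3, c5, c7]
        linear_combination ea₂ - ea₁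
      rw [← this] at e'
      exact neg_of_mul_neg_right e' hc.le)
    (by
      rw [z₀, two, add_im, im_mul_two, im_ofReal_mul, sub_im, sub_im, conj_im, hb, sub_self]
      norm_num
      linarith)
  rw [h0, h1] at k₁ k₂ k₃
  filter_upwards [k₁, k₂, k₃] with x k₁ k₂ k₃ i0 i1
  have k₁ := k₁ i0 i1
  rw [neg_im] at k₁
  exact ⟨by linarith, k₂ i0 i1, k₃ i0 i1⟩

end WordTwo

section WordTwo

/-- The signs of the products that compare the two obtuse vertices with the last pivot leave room
for a line; `κ` and `σ` are `1 - cos Q` and `sin Q` for the angle `Q` of the turn. -/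
lemma exists_room {p q N κ σ c : ℝ} {p' q' : ℝ} (hκ : 0 < κ) (hσ : 0 < σ) (hp : 0 < p) (hq : 0 < q)
    (hpq : p + q < N) (hp' : p' < 0) (hq' : 0 < q')
    (hroom : 0 < (q' - p') * κ - (N - q - p) * σ)
    (hc : c = (max (-(N * σ)) (max (p' * κ - p * σ) (-q' * κ - (N - q) * σ)) +
      min 0 (min (-(p' * κ + p * σ)) (-(-q' * κ + (N - q) * σ)))) / 2) :
    -(N * σ) < c ∧ p' * κ - p * σ < c ∧ -q' * κ - (N - q) * σ < c ∧ c < 0 ∧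
      c < -(p' * κ + p * σ) ∧ c < -(-q' * κ + (N - q) * σ) := by
  have h1 := mul_pos (neg_pos.2 hp') hκ
  have h2 := mul_pos hq' hκ
  have h3 := mul_pos hp hσ
  have h4 := mul_pos hq hσ
  have h5 := mul_pos (sub_pos.2 hpq) hσ
  have hlt : max (-(N * σ)) (max (p' * κ - p * σ) (-q' * κ - (N - q) * σ)) <
      min 0 (min (-(p' * κ + p * σ)) (-(-q' * κ + (N - q) * σ))) := by
    refine max_lt ?_ (max_lt ?_ ?_) <;> refine lt_min ?_ (lt_min ?_ ?_) <;> linarith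
  set l := max (-(N * σ)) (max (p' * κ - p * σ) (-q' * κ - (N - q) * σ))
  set u := min 0 (min (-(p' * κ + p * σ)) (-(-q' * κ + (N - q) * σ)))
  have hl : l < c := by rw [hc]; linarith
  have hu : c < u := by rw [hc]; linarith
  have hl' := max_lt_iff.1 hl
  have hl'' := max_lt_iff.1 hl'.2
  have hu' := lt_min_iff.1 hu
  have hu'' := lt_min_iff.1 hu'.2
  exact ⟨hl'.1, hl''.1, hl''.2, hu'.1, hu''.1, hu''.2⟩

/-- The second word is realized near the Veech point where the first angle is smaller than
`π / (2 n)` and the second one is not. -/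
theorem eventually_mem_orbitTile_strandTwo {n : ℕ} (hn : 4 ≤ n) (hn' : n ≠ 0) :
    ∀ᶠ x in 𝓝 (veechPoint n), x 0 < Real.pi / (2 * n) → Real.pi / (2 * n) ≤ x 1 →
      x ∈ orbitTile (PeriodicWord.ofList (pretzel n (strandTwo n)) (pretzel_ne_nil hn' _)) := by
  have h := smallAngle_pi_div hn
  have v0 := veechPoint_zero n
  have v1 := veechPoint_one n
  set b := Real.pi / (2 * n)
  set x₀ := veechPoint n
  have hnb := h.mul_eq
  have hcos := h.cos_pos
  have hl := h.leg_mul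
  obtain ⟨_, _, jD, -, -⟩ := hasJet_joint_ten h v0 v1
  obtain ⟨_, _, jP, -, -⟩ := hasJet_apexOne h v0 v1
  obtain ⟨_, _, jR, -, -⟩ := hasJet_joint_ten_sub_apexTwo h v0 v1
  set S := dirTwo b
  set ρ := legLength b b
  let D : Plane → ℂ := fun x => joint n (x 0) (x 1) 10
  let P : Plane → ℂ := fun x => apexOne n (x 0) (x 1)
  let R : Plane → ℂ := fun x => D x - apexTwo n (x 0) (x 1)
  let p : Plane → ℂ := fun x => P x * conj (D x)
  let q : Plane → ℂ := fun x => R x * conj (D x)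
  let σ : Plane → ℝ := fun x => Real.sin (2 * n * x 0)
  let κ : Plane → ℝ := fun x => 1 - Real.cos (2 * n * x 0)
  let T : Plane → ℂ := fun x => D x - cis (-(2 * n * x 0)) * D x
  -- the offset is the mean of the largest lower bound and the least upper bound in `exists_room`
  let c : Plane → ℝ := fun x => (max (-(normSq (D x) * σ x)) (max ((p x).im * κ x - (p x).re * σ x)
      (-(q x).im * κ x - (normSq (D x) - (q x).re) * σ x)) +
      min 0 (min (-((p x).im * κ x + (p x).re * σ x))
        (-(-(q x).im * κ x + (normSq (D x) - (q x).re) * σ x)))) / 2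
  have cα : ContinuousAt (fun x : Plane => x 0) x₀ := by fun_prop
  have cβ : ContinuousAt (fun x : Plane => x 1) x₀ := by fun_prop
  have cD : ContinuousAt D x₀ := jD.continuousAt
  have cp : ContinuousAt p x₀ := (jP.mul jD.conj).continuousAt
  have cq : ContinuousAt q x₀ := (jR.mul jD.conj).continuousAt
  have cT : ContinuousAt T x₀ := by fun_prop
  have cN : ContinuousAt (fun x => normSq (D x)) x₀ := continuous_normSq.continuousAt.comp cD
  have cpr : ContinuousAt (fun x => (p x).re) x₀ := continuous_re.continuousAt.comp cp
  have cpi : ContinuousAt (fun x => (p x).im) x₀ := continuous_im.continuousAt.comp cp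
  have cqr : ContinuousAt (fun x => (q x).re) x₀ := continuous_re.continuousAt.comp cq
  have cqi : ContinuousAt (fun x => (q x).im) x₀ := continuous_im.continuousAt.comp cq
  have cσ : ContinuousAt σ x₀ := by fun_prop
  have cκ : ContinuousAt κ x₀ := by fun_prop
  have cc : ContinuousAt c x₀ := by fun_prop
  have hD₀ : D x₀ = (2 * Real.cos b : ℝ) * S := jD.value
  have hp₀ : p x₀ = (normSq S : ℝ) := by
    obtain ⟨_, _, j, -⟩ := jP.mul_conj_of_parallel jD
    rw [hl, one_mul] at j
    exact j.value
  have hq₀ : q x₀ = (normSq S : ℝ) := by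
    obtain ⟨_, _, j, -⟩ := jR.mul_conj_of_parallel jD
    rw [hl, one_mul] at j
    exact j.value
  have hN₀ : normSq (D x₀) = 4 * Real.cos b ^ 2 * normSq S := by
    rw [hD₀, normSq_mul, normSq_ofReal]
    ring
  have hσ₀ : σ x₀ = 0 := by change Real.sin (2 * n * x₀ 0) = 0; rw [v0, hnb, Real.sin_pi]
  have hκ₀ : κ x₀ = 2 := by
    change 1 - Real.cos (2 * n * x₀ 0) = 2
    rw [v0, hnb, Real.cos_pi]
    norm_num
  have hc₀ : c x₀ = 0 := by
    simp only [c, hσ₀, hp₀, hq₀, ofReal_im]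
    simp
  have hT₀ : T x₀ = (4 * Real.cos b : ℝ) * S := by
    change D x₀ - cis (-(2 * n * x₀ 0)) * D x₀ = _
    rw [hD₀, v0, hnb, cis_eq_neg_of_sub (φ := 0) (by ring), cis_zero]
    push_cast
    ring
  have H1 : LinesNear b S x₀ (fun x => x 0) (fun x => x 1) c T :=
    ⟨cα, cβ, cc, cT, v0, v1, hc₀, _, by positivity, hT₀⟩
  have H2 : LinesNear b S x₀ (fun x => x 0) (fun x => x 1) (fun x => -(c x))
      (fun x => -(cis (2 * n * x 0) * T x)) :=
    ⟨cα, cβ, by fun_prop, by fun_prop, v0, v1, by rw [hc₀, neg_zero], 4 * Real.cos b,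
      by positivity, by
        rw [v0, hnb, cis_eq_neg_of_add (φ := 0) (by ring), cis_zero, hT₀]
        ring⟩
  have hstar : ∀ᶠ x in 𝓝 x₀, c x < 0 → (D x * conj (T x)).im < c x →
      Crosses (x 0) (x 1) (T x) (c x) ⟨1, 0, 0⟩ (strandTwo n) →
      Crosses (x 0) (x 1) (-(cis (2 * n * x 0) * T x)) (-(c x)) ⟨1, 0, 0⟩ (strandTwo n) →
      x ∈ orbitTile (PeriodicWord.ofList (pretzel n (strandTwo n)) (pretzel_ne_nil hn' _)) := by
    have t := h.heightsTwo
    have j10 := (t.joints hnb).2.2.2.2.2.2.2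
    have o := h.sineOrder
    have o1 := o.pos_one
    have o3 := o.two_lt
    refine H1.eventually_mem_orbitTile_pretzel h ?_ ?_ ?_ ?_ hn'
      (θ := fun x => (6 * n - 10) * x 1 - (4 * n - 10) * x 0) (D := D) (by fun_prop) cD ?_ ?_
      (Eventually.of_forall fun x => run_strandTwo _ _ hn) (fun x => rfl)
    · rw [t.zero]; linarith
    · exact pos_of_mul_pos_right (by rw [t.one]; exact o1) h.leg_pos.le
    · exact neg_of_mul_neg_right (by rw [t.neg_one]; linarith) h.leg_pos.le
    · rw [t.two]; linarith
    · rw [v0, v1]; linear_combination hnb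
    · change height S 0 (joint n (x₀ 0) (x₀ 1) 10) = 0
      rwa [v0, v1]
  have hS : 0 < normSq S := by
    rw [normSq_dirTwo]
    nlinarith [sq_nonneg (Real.cos b ^ 2 - 1 / 8)]
  have k1 : ∀ᶠ x in 𝓝 x₀, 0 < (p x).re :=
    cpr.eventually (lt_mem_nhds (by beta_reduce; rwa [hp₀, ofReal_re]))
  have k2 : ∀ᶠ x in 𝓝 x₀, 0 < (q x).re :=
    cqr.eventually (lt_mem_nhds (by beta_reduce; rwa [hq₀, ofReal_re]))
  have k3 : ∀ᶠ x in 𝓝 x₀, 0 < normSq (D x) - ((p x).re + (q x).re) := by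
    have : ContinuousAt (fun x => normSq (D x) - ((p x).re + (q x).re)) x₀ := by fun_prop
    refine this.eventually (lt_mem_nhds ?_)
    beta_reduce
    rw [hp₀, hq₀, hN₀, ofReal_re]
    nlinarith [h.half_lt_cos_sq]
  have k4 : ∀ᶠ x in 𝓝 x₀, 0 < κ x := cκ.eventually (lt_mem_nhds (by rw [hκ₀]; norm_num))
  filter_upwards [hstar, H1.eventually_crosses_strandTwo h, H2.eventually_crosses_strandTwo h, k1,
    k2, k3, k4, eventually_im_signs h v0 v1, h.eventually H1] with
    x hx w1 w2 k1 k2 k3 k4 ksigns ⟨_, i0, _, _, _⟩ ha hb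
  obtain ⟨s1, s2, s3⟩ := ksigns ha hb
  have hnpos : (0 : ℝ) < 2 * n := by
    have : (0 : ℝ) < n := by exact_mod_cast (by omega : 0 < n)
    positivity
  have hQ : 0 < σ x :=
    Real.sin_pos_of_pos_of_lt_pi (by positivity) (by rw [← hnb]; gcongr)
  have hroom : 0 < ((q x).im - (p x).im) * κ x - (normSq (D x) - (q x).re - (p x).re) * σ x := by
    rw [im_mul_one_sub_cis] at s3
    change 0 < (D x * conj (D x) - conj (q x) - p x).im * κ x -
      (D x * conj (D x) - conj (q x) - p x).re * σ x at s3
    rw [mul_conj, sub_im, sub_im, sub_re, sub_re, ofReal_im, ofReal_re, conj_im, conj_re] at s3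
    linarith
  obtain ⟨c1, c2, c3, c4, c5, c6⟩ := exists_room k4 hQ k1 k2 (by linarith) s1 s2 hroom
    (c := c x) rfl
  -- the two lines, in terms of the products with the conjugate of the last pivot
  have im_T (z : ℂ) : (z * conj (T x)).im = (z * conj (D x)).im * κ x -
      (z * conj (D x)).re * σ x := by
    rw [← im_mul_one_sub_cis]
    simp only [T, map_sub, map_mul, conj_cis, neg_neg]
    ring_nf
  have im_T' (z : ℂ) : (z * conj (-(cis (2 * n * x 0) * T x))).im = (z * conj (D x)).im * κ x +
      (z * conj (D x)).re * σ x := by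
    have e : -(cis (2 * n * x 0) * T x) = D x - cis (2 * n * x 0) * D x := by
      linear_combination D x * cis_mul_cis_neg (2 * n * x 0)
    have e' := im_mul_one_sub_cis (z * conj (D x)) (-(2 * n * x 0))
    rw [Real.cos_neg, Real.sin_neg, mul_neg, sub_neg_eq_add] at e'
    rw [e, ← e']
    simp only [map_sub, map_mul, conj_cis]
    ring_nf
  have eD : (D x * conj (D x)).im = 0 ∧ (D x * conj (D x)).re = normSq (D x) := by
    rw [mul_conj, ofReal_im, ofReal_re]
    exact ⟨rfl, rfl⟩
  have eZ : apexTwo n (x 0) (x 1) * conj (D x) = D x * conj (D x) - q x := by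
    change _ = D x * conj (D x) - (D x - apexTwo n (x 0) (x 1)) * conj (D x)
    ring
  have eZi : (apexTwo n (x 0) (x 1) * conj (D x)).im = -(q x).im := by
    rw [eZ, sub_im, eD.1, zero_sub]
  have eZr : (apexTwo n (x 0) (x 1) * conj (D x)).re = normSq (D x) - (q x).re := by
    rw [eZ, sub_re, eD.2]
  refine hx c4 ?_ (w1 ?_ ?_) (w2 ?_ ?_)
  · rw [im_T, eD.1, eD.2]
    linarith
  · rw [height, im_T]
    exact sub_neg.2 c2
  · rw [height, im_T, eZi, eZr]
    exact sub_neg.2 c3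
  · rw [height, im_T']
    change (p x).im * κ x + (p x).re * σ x - -c x < 0
    linarith
  · rw [height, im_T', eZi, eZr]
    linarith

end WordTwo

/-! ### Mirror images and quadrants -/

section Mirror

/-- The parameter of the mirror image of a triangle: the two small angles are exchanged. -/
noncomputable def mirrorPoint (x : Plane) : Plane := !₂[x 1, x 0]

lemma mirrorPoint_zero (x : Plane) : mirrorPoint x 0 = x 1 := rfl

lemma mirrorPoint_one (x : Plane) : mirrorPoint x 1 = x 0 := rfl

lemma mirrorPoint_veechPoint (n : ℕ) : mirrorPoint (veechPoint n) = veechPoint n := rfl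

lemma continuous_mirrorPoint : Continuous mirrorPoint := by
  refine (PiLp.continuous_toLp 2 _).comp (continuous_pi fun i => ?_)
  fin_cases i
  · exact (EuclideanSpace.proj (𝕜 := ℝ) (1 : Fin 2)).continuous
  · exact (EuclideanSpace.proj (𝕜 := ℝ) (0 : Fin 2)).continuous

/-- The word of the mirror image of a path: the labels of the two short sides are exchanged. -/
def PeriodicWord.mirror (W : PeriodicWord) : PeriodicWord where
  digit k := Equiv.swap 0 1 (W.digit k)
  periodic := by
    obtain ⟨m, hm, h⟩ := W.periodic
    exact ⟨m, hm, fun k => by rw [h]⟩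

lemma swap_add_one (i : Fin 3) : Equiv.swap (0 : Fin 3) 1 i + 1 = Equiv.swap 0 1 (i + 2) := by
  revert i
  decide

lemma swap_add_two (i : Fin 3) : Equiv.swap (0 : Fin 3) 1 i + 2 = Equiv.swap 0 1 (i + 1) := by
  revert i
  decide

variable {x : Plane}

/-- The reflection `z ↦ 1 - conj z` carries the triangle of the mirror parameter to the triangle. -/
lemma triangleVertex_mirror (h : Real.sin (x 0 + x 1) ≠ 0) (i : Fin 3) :
    triangleVertex x (Equiv.swap 0 1 i) = 1 - conj (triangleVertex (mirrorPoint x) i) := by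
  fin_cases i
  · change triangleVertex x 1 = 1 - conj (triangleVertex _ 0)
    simp [triangleVertex]
  · change triangleVertex x 0 = 1 - conj (triangleVertex _ 1)
    simp [triangleVertex]
  · change triangleVertex x 2 = 1 - conj (triangleVertex _ 2)
    rw [triangleVertex_two, triangleVertex_two, mirrorPoint_zero, mirrorPoint_one, map_mul,
      conj_ofReal, conj_cis, legLength_mul_cis h]

lemma mem_openSide_mirror (h : Real.sin (x 0 + x 1) ≠ 0) {i : Fin 3} {z : ℂ}
    (hz : z ∈ openSide (triangleVertex (mirrorPoint x)) i) :
    1 - conj z ∈ openSide (triangleVertex x) (Equiv.swap 0 1 i) := by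
  obtain ⟨s, t, hs, ht, hst, rfl⟩ := hz
  refine ⟨t, s, ht, hs, by rw [add_comm, hst], ?_⟩
  rw [swap_add_one, swap_add_two, triangleVertex_mirror h, triangleVertex_mirror h]
  have hst' : (s : ℂ) + t = 1 := by exact_mod_cast hst
  simp only [real_smul, map_add, map_mul, conj_ofReal]
  linear_combination hst'

lemma sideDirection_mirror (h : Real.sin (x 0 + x 1) ≠ 0) (i : Fin 3) :
    sideDirection (triangleVertex x) (Equiv.swap 0 1 i) =
      (sideDirection (triangleVertex (mirrorPoint x)) i).map
        (conjLIE.toLinearEquiv : ℂ →ₗ[ℝ] ℂ) := by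
  rw [sideDirection, sideDirection, Submodule.map_span, Set.image_singleton, swap_add_one,
    swap_add_two, triangleVertex_mirror h, triangleVertex_mirror h]
  congr 2
  change _ = conj _
  rw [map_sub]
  ring

/-- The mirror image of a periodic billiard path is a periodic billiard path in the mirror image of
the triangle. -/
theorem mem_orbitTile_mirror {W : PeriodicWord} (hx : mirrorPoint x ∈ orbitTile W) :
    x ∈ orbitTile W.mirror := by
  obtain ⟨⟨h0, h1, h2⟩, p, hp⟩ := hx
  rw [mirrorPoint_zero, mirrorPoint_one] at h2
  have hx : x ∈ parameterSpace := ⟨h1, h0, by linarith⟩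
  have h := (sin_add_pos_of_mem hx).ne'
  refine ⟨hx, fun k => 1 - conj (p k), ⟨fun k => mem_openSide_mirror h (hp.mem_side k),
    fun k e => hp.ne_succ k ?_, fun k => ?_, ?_⟩⟩
  · have e := congrArg conj (sub_right_injective e)
    rwa [conj_conj, conj_conj] at e
  · have hdiff : ∀ z w : ℂ, 1 - conj z - (1 - conj w) = -(conjLIE (z - w)) := by
      intro z w
      change _ = -conj (z - w)
      rw [map_sub]
      ring
    have hdir : sideDirection (triangleVertex x) (W.mirror.digit k) = _ :=
      sideDirection_mirror h (W.digit k)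
    simp only [hdir, hdiff, map_neg, Submodule.reflection_map_apply,
      LinearIsometryEquiv.symm_apply_apply]
    exact ((hp.reflect k).map (conjLIE.toLinearEquiv : ℂ →ₗ[ℝ] ℂ)).neg
  · obtain ⟨m, hm, hper⟩ := hp.closes
    exact ⟨m, hm, fun k => by rw [hper]⟩

end Mirror

section Quadrants

/-- A point near the base point that is not in the closure of the quadrant of larger angles has a
smaller angle. -/
lemma lt_or_lt_of_notMem_closure {n : ℕ} {ε : ℝ} {x : Plane}
    (hx : x ∈ Metric.ball (veechPoint n) ε) (hc : x ∉ closure (quadrantNhd 1 1 n ε)) :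
    x 0 < Real.pi / (2 * n) ∨ x 1 < Real.pi / (2 * n) := by
  by_contra! hle
  apply hc
  have hf : Tendsto (fun t : ℝ => x + t • (!₂[1, 1] : Plane)) (𝓝[>] 0) (𝓝 x) := by
    have : Continuous (fun t : ℝ => x + t • (!₂[1, 1] : Plane)) := by fun_prop
    have h := this.tendsto 0
    rw [zero_smul, add_zero] at h
    exact h.mono_left nhdsWithin_le_nhds
  refine mem_closure_of_tendsto hf ?_
  filter_upwards [hf.eventually (Metric.isOpen_ball.mem_nhds hx), self_mem_nhdsWithin] with t ht h0
  rw [Set.mem_Ioi] at h0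
  refine ⟨ht, ?_, ?_⟩ <;> rw [sign_eq_one_iff]
  · rw [veechPoint_zero]
    simp
    linarith
  · rw [veechPoint_one]
    simp
    linarith

end Quadrants

theorem theorem1p4 (n : ℕ) (hn : 4 ≤ n) :
    ∃ A B C : PeriodicWord, ∃ ε : ℝ, 0 < ε ∧
      quadrantNhd (-1) (-1) n ε ⊆ orbitTile A ∧
      quadrantNhd (-1) 1 n ε ⊆ orbitTile B ∧
      quadrantNhd 1 (-1) n ε ⊆ orbitTile C ∧
      Metric.ball (veechPoint n) ε \ closure (quadrantNhd 1 1 n ε) ⊆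
        orbitTile A ∪ orbitTile B ∪ orbitTile C := by
  have hn' : n ≠ 0 := by omega
  have v0 := veechPoint_zero n
  have v1 := veechPoint_one n
  have hA := eventually_mem_orbitTile_strandOne hn hn'
  have hB := eventually_mem_orbitTile_strandTwo hn hn'
  have hC : ∀ᶠ x in 𝓝 (veechPoint n), _ :=
    continuous_mirrorPoint.continuousAt.eventually
      (p := fun y => y 0 < Real.pi / (2 * n) → Real.pi / (2 * n) ≤ y 1 → _)
      (by rw [mirrorPoint_veechPoint]; exact hB)
  set A := PeriodicWord.ofList (pretzel n (strandOne n)) (pretzel_ne_nil hn' _)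
  set B := PeriodicWord.ofList (pretzel n (strandTwo n)) (pretzel_ne_nil hn' _)
  obtain ⟨ε, hε, h⟩ := Metric.eventually_nhds_iff_ball.1 (hA.and (hB.and hC))
  refine ⟨A, B, B.mirror, ε, hε, ?_, ?_, ?_, ?_⟩
  · rintro x ⟨hx, s0, s1⟩
    rw [sign_eq_neg_one_iff, v0, sub_neg] at s0
    rw [sign_eq_neg_one_iff, v1, sub_neg] at s1
    exact (h x hx).1 s0 s1
  · rintro x ⟨hx, s0, s1⟩
    rw [sign_eq_neg_one_iff, v0, sub_neg] at s0
    rw [sign_eq_one_iff, v1, sub_pos] at s1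
    exact (h x hx).2.1 s0 s1.le
  · rintro x ⟨hx, s0, s1⟩
    rw [sign_eq_one_iff, v0, sub_pos] at s0
    rw [sign_eq_neg_one_iff, v1, sub_neg] at s1
    exact mem_orbitTile_mirror ((h x hx).2.2 s1 s0.le)
  · rintro x ⟨hx, hc⟩
    obtain ⟨hA, hB, hC⟩ := h x hx
    rcases lt_or_ge (x 0) (Real.pi / (2 * n)) with s0 | s0
    · rcases lt_or_ge (x 1) (Real.pi / (2 * n)) with s1 | s1
      · exact Or.inl (Or.inl (hA s0 s1))
      · exact Or.inl (Or.inr (hB s0 s1))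
    · rcases lt_or_lt_of_notMem_closure hx hc with s1 | s1
      · exact absurd s1 s0.not_gt
      · exact Or.inr (mem_orbitTile_mirror (hC s1 s0))
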